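/- **Setting.** Let $H=(V,F)$ be a finite hypergraph (every $\alpha\in F$ is a non-empty subset of $V$; no repeated hyperedges), and let $d_i=|\{\alpha\in F: i\in\alpha\}|$. For each $i\in V$ let $\nu_i$ be a nonzero $\sigma$-finite measure on $\mathcal X_i$ and $\phi_i:\mathcal X_i\to\mathbb R^{r_i}$ a measurable statistic; for each $\alpha\in F$ let $\phi_{\langle\alpha\rangle}$ be a further measurable $\mathbb R^{s_\alpha}$-valued statistic on $\mathcal X_\alpha=\prod_{i\in\alpha}\mathcal X_i$, put $\phi_\alpha=(\phi_{\langle\alpha\rangle},(\phi_i)_{i\in\alpha})$ and $\nu_\alpha=\prod_{i\in\alpha}\nu_i$. For $a\in V\cup F$ let $\Theta_a$ be the interior of $\{\theta:\int e^{\langle\theta,\phi_a\rangle}d\nu_a<\infty\}$, $\psi_a(\theta)=\log\int e^{\langle\theta,\phi_a\rangle}d\nu_a$, $p_a(\cdot\,;\theta)=e^{\langle\theta,\phi_a\rangle-\psi_a(\theta)}$, $\Lambda_a(\theta)=\mathbb E_{p_a(\cdot;\theta)}[\phi_a]$, $Y_a=\Lambda_a(\Theta_a)$ and $\varphi_a(\eta)=\sup_{\theta\in\Theta_a}(\langle\theta,\eta\rangle-\psi_a(\theta))$.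 This collection is an *inference family* if (i) all covariance matrices of $\phi_a$ under $p_a(\cdot\,;\theta)$, $\theta\in\Theta_a$, are invertible, and (ii) for all $i\in\alpha\in F$ and $\theta\in\Theta_\alpha$ the marginal on $\mathcal X_i$ of $p_\alpha(\cdot\,;\theta)$ is $p_i(\cdot\,;\theta')$ for some $\theta'\in\Theta_i$. Let the compatibility functions be $\Psi_\alpha=\exp\langle\bar\theta_\alpha,\phi_\alpha\rangle$ with $\bar\theta_\alpha=(\bar\theta_{\langle\alpha\rangle},(\bar\theta^\alpha_i)_{i\in\alpha})$. For $\mu=(\mu_{\alpha\to i})_{i\in\alpha\in F}$, $\mu_{\alpha\to i}\in\mathbb R^{r_i}$, put $\theta_\alpha(\mu)=\big(\bar\theta_{\langle\alpha\rangle},(\bar\theta^\alpha_i+\sum_{\beta\ni i,\beta\ne\alpha}\mu_{\beta\to i})_{i\in\alpha}\big)$ and $\theta_i(\mu)=\sum_{\beta\ni i}\mu_{\beta\to i}$. The LBP update is $$T(\mu)_{\alpha\to i}=\Lambda_i^{-1}\big(\Lambda_\alpha(\theta_\alpha(\mu))_i\big)-\sum_{\beta\ni i,\,\beta\neq\alpha}\mu_{\beta\to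 i},$$ defined when $\theta_\alpha(\mu)\in\Theta_\alpha$ for all $\alpha\in F$, and $T_\epsilon=(1-\epsilon)T+\epsilon\,\mathrm{id}$ ($0\le\epsilon<1$) is the damped update. An LBP *fixed point* is a $\mu^*$ at which $T$ is defined, with $T(\mu^*)=\mu^*$ and $\theta_i(\mu^*)\in\Theta_i$ for all $i\in V$ (the last condition is automatic for $i$ lying in some factor). Its beliefs are $b_\alpha=p_\alpha(\cdot\,;\theta_\alpha(\mu^*))$ and $b_i=p_i(\cdot\,;\theta_i(\mu^*))$. LBP (with or without damping) is *locally stable* at $\mu^*$ if $\mu^*$ is an asymptotically stable fixed point of the update: iterates starting sufficiently close to $\mu^*$ stay close to and converge to $\mu^*$. Let $L$ be the set of all $\eta=((\eta_\alpha)_\alpha,(\eta_i)_i)$ with $\eta_\alpha\in Y_\alpha$, $\eta_i\in Y_i$ such that the $i$-component of $\eta_\alpha$ is $\eta_i$ whenever $i\in\alpha$. The Bethe free energy on $L$ is $$F(\eta)=-\sum_{\alpha}\langle\bar\theta_\alpha,\eta_\alpha\rangle+\sum_\alpha\varphi_\alpha(\eta_\alpha)+\sum_i(1-d_i)\varphi_i(\eta_i).$$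 "$\mu^*$ is a local minimum of $F$" means that the expectation parameters of the beliefs of $\mu^*$ lie in $L$ and are a local minimum of $F$ on $L$. **Theorem.** Let $\mu^*$ be an LBP fixed point of an inference family. Then $T$ is differentiable at $\mu^*$ and $T'(\mu^*)=\mathcal M(u)$, the matrix whose block at $(\alpha\to i,\ \beta\to j)$ is $\mathrm{Var}_{b_i}[\phi_i]^{-1}\mathrm{Cov}_{b_\alpha}[\phi_i,\phi_j]$ if $j\in\alpha\setminus\{i\}$ and $\beta\neq\alpha$, and $0$ otherwise. Suppose that $T'(\mu^*)$ has no (complex) eigenvalue of unit modulus. Then: 1. $\mathrm{Spec}\,T'(\mu^*)\subset\{|\lambda|<1\}$ if and only if LBP is locally stable at $\mu^*$. 2. $\mathrm{Spec}\,T'(\mu^*)\subset\{\mathrm{Re}\,\lambda<1\}$ if and only if, for some $\epsilon\in[0,1)$, LBP with damping $\epsilon$ is locally stable at $\mu^*$. 3. If $\mathrm{Spec}\,T'(\mu^*)\subset\mathbb C\setminus\mathbb R_{\ge1}$, then $\mu^*$ is a local minimum of the Bethe free energy. In particular, if LBP is locally stable at $\mu^*$, then $\mu^*$ is a local minimum of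 the Bethe free energy. All of this applies to multinomial and Gaussian families, which are inference families: the multinomial ones (all $\mathcal X_i$ finite, $\nu_i$ uniform, and for every $a\in V\cup F$ the constant $1$ and the components of $\phi_a$ form a basis of the real functions on $\mathcal X_a$) and, if all hyperedges have two elements, the Gaussian one ($\mathcal X_i=\mathbb R$ with Lebesgue measure, $\phi_i=(x_i,x_i^2)$, $\phi_{\langle\{i,j\}\rangle}=x_ix_j$). -/

import Mathlib

open MeasureTheory Filter Topology Matrix

universe u v

noncomputable section

/-! ### Exponential families -/

namespace ExpFam

variable {Ω ι : Type*} [MeasurableSpace Ω] [Fintype ι]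

/-- The space `Θ` of natural parameters of the exponential family with base measure `ν` and
sufficient statistic `φ`: the interior of the set where the partition function is finite. -/
def paramSpace (ν : Measure Ω) (φ : Ω → ι → ℝ) : Set (ι → ℝ) :=
  interior {θ | Integrable (fun x => Real.exp (θ ⬝ᵥ φ x)) ν}

/-- The log partition function `ψ`. -/
def logPartition (ν : Measure Ω) (φ : Ω → ι → ℝ) (θ : ι → ℝ) : ℝ :=
  Real.log (∫ x, Real.exp (θ ⬝ᵥ φ x) ∂ν)

/-- The density `p(x; θ) = exp (⟨θ, φ x⟩ - ψ θ)` with respect to `ν`. -/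
def density (ν : Measure Ω) (φ : Ω → ι → ℝ) (θ : ι → ℝ) (x : Ω) : ℝ :=
  Real.exp (θ ⬝ᵥ φ x - logPartition ν φ θ)

/-- The probability distribution with natural parameter `θ`. -/
def law (ν : Measure Ω) (φ : Ω → ι → ℝ) (θ : ι → ℝ) : Measure Ω :=
  ν.withDensity (fun x => ENNReal.ofReal (density ν φ θ x))

/-- The expectation parameter `Λ θ = E_θ[φ]`, that is, the gradient of the log partition
function. -/
def mean (ν : Measure Ω) (φ : Ω → ι → ℝ) (θ : ι → ℝ) : ι → ℝ :=
  fun k => ∫ x, φ x k ∂(law ν φ θ)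

/-- The covariance matrix `Var_θ[φ]`, that is, the Hessian of the log partition function. -/
def cov (ν : Measure Ω) (φ : Ω → ι → ℝ) (θ : ι → ℝ) : Matrix ι ι ℝ :=
  Matrix.of fun k l => ProbabilityTheory.covariance (fun x => φ x k) (fun x => φ x l) (law ν φ θ)

/-- The space `Y = Λ(Θ)` of expectation parameters. -/
def meanSpace (ν : Measure Ω) (φ : Ω → ι → ℝ) : Set (ι → ℝ) :=
  mean ν φ '' paramSpace ν φ

/-- The inverse `Λ⁻¹ : Y → Θ`. -/
def invMean (ν : Measure Ω) (φ : Ω → ι → ℝ) : (ι → ℝ) → (ι → ℝ) :=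
  Function.invFunOn (mean ν φ) (paramSpace ν φ)

/-- The Legendre transform `φ(η) = sup_{θ ∈ Θ} (⟨θ, η⟩ - ψ θ)` of the log partition function. -/
def legendre (ν : Measure Ω) (φ : Ω → ι → ℝ) (η : ι → ℝ) : ℝ :=
  sSup ((fun θ => θ ⬝ᵥ η - logPartition ν φ θ) '' paramSpace ν φ)

/-- The constant `1` together with the components of `φ` is a basis of the space of all real
functions: on a finite set, the exponential family consists of all positive densities. -/
def IsMultinomialStatistic (φ : Ω → ι → ℝ) : Prop :=
  LinearIndependent ℝ (fun o : Option ι => o.elim (fun _ : Ω => (1 : ℝ)) (fun k x => φ x k)) ∧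
  Submodule.span ℝ
    (Set.range (fun o : Option ι => o.elim (fun _ : Ω => (1 : ℝ)) (fun k x => φ x k))) = ⊤

end ExpFam

/-! ### Hypergraphs -/

/-- A finite hypergraph whose vertex set is all of `V`: a finite set of non-empty hyperedges, called
factors. -/
structure FactorGraph (V : Type*) where
  /-- The set of hyperedges. -/
  edges : Finset (Finset V)
  nonempty : ∀ α ∈ edges, α.Nonempty

namespace FactorGraph

variable {V : Type*}

/-- The type of factors. -/
abbrev Factor (H : FactorGraph V) : Type _ := {α : Finset V // α ∈ H.edges}

/-- The directed edges `α → i` with `i ∈ α`. -/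
abbrev DirEdge (H : FactorGraph V) : Type _ := Σ α : H.Factor, {i : V // i ∈ α.1}

/-- All hyperedges have exactly two elements. -/
def IsGraph (H : FactorGraph V) : Prop := ∀ α ∈ H.edges, α.card = 2

/-- The degree `d_i`, the number of factors containing `i`. -/
def degree [DecidableEq V] (H : FactorGraph V) (i : V) : ℕ := {α ∈ H.edges | i ∈ α}.card

end FactorGraph

/-! ### Collections of exponential families on a hypergraph -/

/-- Base measures and sufficient statistics on a hypergraph `H`: for every vertex `i` a measure
space `(X i, ν i)` with a statistic `φ i` of dimension `r i`, and for every factor `α` an additional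
statistic `φF α` of dimension `s α` on `∏_{i ∈ α} X i`. -/
structure StatFamily {V : Type u} (H : FactorGraph V) where
  X : V → Type v
  [mX : ∀ i, MeasurableSpace (X i)]
  ν : ∀ i, Measure (X i)
  [sigmaFinite : ∀ i, SigmaFinite (ν i)]
  [neZero : ∀ i, NeZero (ν i)]
  r : V → ℕ
  φ : ∀ i, X i → Fin (r i) → ℝ
  measurable_φ : ∀ i, Measurable (φ i)
  s : H.Factor → ℕ
  φF : ∀ α : H.Factor, (∀ i : {i : V // i ∈ α.1}, X i) → Fin (s α) → ℝ
  measurable_φF : ∀ α, Measurable (φF α)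

attribute [instance] StatFamily.mX StatFamily.sigmaFinite StatFamily.neZero

namespace StatFamily

variable {V : Type*} {H : FactorGraph V} (I : StatFamily H)

/-- The configuration space `∏_{i ∈ α} X i` of a factor. -/
abbrev XF (α : H.Factor) : Type _ := ∀ i : {i : V // i ∈ α.1}, I.X i

/-- The product base measure of a factor. -/
def νF (α : H.Factor) : Measure (I.XF α) := Measure.pi fun i => I.ν i

/-- Index type of the full statistic `(φF α, φ_{i₁}, …, φ_{i_k})` of a factor. -/
abbrev FactorIndex (α : H.Factor) : Type _ := Fin (I.s α) ⊕ (Σ i : {i : V // i ∈ α.1}, Fin (I.r i))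

/-- The full statistic `(φF α, φ_{i₁}, …, φ_{i_k})` of a factor. -/
def φFull (α : H.Factor) (x : I.XF α) : I.FactorIndex α → ℝ :=
  Sum.elim (fun a => I.φF α x a) (fun p => I.φ p.1 (x p.1) p.2)

/-- The family is an *inference family*: all covariance matrices are invertible on the parameter
spaces, and the families are closed under marginalization. -/
structure IsInferenceFamily [DecidableEq V] : Prop where
  isUnit_cov : ∀ i, ∀ θ ∈ ExpFam.paramSpace (I.ν i) (I.φ i), IsUnit (ExpFam.cov (I.ν i) (I.φ i) θ)
  isUnit_covF : ∀ α, ∀ θ ∈ ExpFam.paramSpace (I.νF α) (I.φFull α),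
    IsUnit (ExpFam.cov (I.νF α) (I.φFull α) θ)
  marginal : ∀ (α : H.Factor) (i : {i : V // i ∈ α.1}),
    ∀ θ ∈ ExpFam.paramSpace (I.νF α) (I.φFull α),
      ∃ θ' ∈ ExpFam.paramSpace (I.ν i) (I.φ i),
        (ExpFam.law (I.νF α) (I.φFull α) θ).map (fun x => x i) = ExpFam.law (I.ν i) (I.φ i) θ'

/-- Multinomial families: the sets `X i` are finite with uniform base measure, and the statistics
are such that the exponential families consist of all positive probability densities, without
redundant parameters. -/
structure IsMultinomial : Prop where
  finite : ∀ i, Finite (I.X i)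
  singleton : ∀ i, MeasurableSingletonClass (I.X i)
  uniform : ∀ i, ∃ c : NNReal, c ≠ 0 ∧ I.ν i = c • Measure.count
  vertex : ∀ i, ExpFam.IsMultinomialStatistic (I.φ i)
  factor : ∀ α, ExpFam.IsMultinomialStatistic (I.φFull α)

/-- The Gaussian family on a graph: `X i = ℝ` with Lebesgue measure, `φ_i = (x_i, x_i²)`, and
additional statistic `x_i x_j` for an edge `{i, j}`. -/
def gaussian (H : FactorGraph V) : StatFamily H where
  X _ := ℝ
  ν _ := volume
  r _ := 2
  φ _ x := ![x, x ^ 2]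
  measurable_φ _ := by
    refine measurable_pi_lambda _ fun k => ?_
    fin_cases k
    · exact measurable_id
    · exact measurable_id.pow_const 2
  s _ := 1
  φF _ x _ := ∏ i, x i
  measurable_φF _ :=
    measurable_pi_lambda _ fun _ => Finset.measurable_prod _ fun i _ => measurable_pi_apply i

/-! ### Loopy belief propagation -/

/-- Index type of the natural parameters of messages: one block of size `r i` for each `α → i`. -/
abbrev MsgIndex : Type _ := Σ e : H.DirEdge, Fin (I.r e.2)

/-- Natural parameters `μ_{α → i}` of a set of messages `m_{α → i} = exp ⟨μ_{α → i}, φ_i⟩`. -/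
abbrev Msg : Type _ := I.MsgIndex → ℝ

/-- Natural parameters of compatibility functions, `Ψ_α = exp ⟨θbar_α, (φF α, (φ_i)_{i ∈ α})⟩`. -/
abbrev Model : Type _ := ∀ α : H.Factor, I.FactorIndex α → ℝ

variable [DecidableEq V]

/-- `∑_{β ∋ i, β ≠ α} μ_{β → i}`. -/
def cavity (μ : I.Msg) (i : V) (α : H.Factor) : Fin (I.r i) → ℝ := fun k =>
  ∑ β : H.Factor, if h : i ∈ β.1 ∧ β ≠ α then μ ⟨⟨β, ⟨i, h.1⟩⟩, k⟩ else 0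

/-- `∑_{β ∋ i} μ_{β → i}`, the natural parameter of the belief `b_i`. -/
def nodeParam (μ : I.Msg) (i : V) : Fin (I.r i) → ℝ := fun k =>
  ∑ β : H.Factor, if h : i ∈ β.1 then μ ⟨⟨β, ⟨i, h⟩⟩, k⟩ else 0

/-- The natural parameter of the belief `b_α ∝ Ψ_α ∏_{j ∈ α} ∏_{β ∋ j, β ≠ α} m_{β → j}`. -/
def factorParam (θbar : I.Model) (μ : I.Msg) (α : H.Factor) : I.FactorIndex α → ℝ :=
  Sum.elim (fun a => θbar α (Sum.inl a))
    (fun p => θbar α (Sum.inr p) + I.cavity μ p.1 α p.2)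

/-- The (parallel) LBP update `T` in terms of the natural parameters of the messages. -/
def lbpUpdate (θbar : I.Model) (μ : I.Msg) : I.Msg := fun p =>
  ExpFam.invMean (I.ν p.1.2) (I.φ p.1.2)
      (fun k => ExpFam.mean (I.νF p.1.1) (I.φFull p.1.1) (I.factorParam θbar μ p.1.1)
        (Sum.inr ⟨p.1.2, k⟩)) p.2
    - I.cavity μ p.1.2 p.1.1 p.2

/-- The damped update `T_ε = (1 - ε) T + ε I`. -/
def dampedUpdate (θbar : I.Model) (ε : ℝ) (μ : I.Msg) : I.Msg :=
  (1 - ε) • I.lbpUpdate θbar μ + ε • μ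

/-- `μ` is a fixed point of LBP: the update is defined at `μ`, it leaves `μ` unchanged, and the
beliefs `b_i` can be normalized (this last condition follows from the others unless `i` lies in no
factor, in which case it says that the constant density can be normalized). -/
structure IsFixedPoint (θbar : I.Model) (μ : I.Msg) : Prop where
  mem_factor : ∀ α, I.factorParam θbar μ α ∈ ExpFam.paramSpace (I.νF α) (I.φFull α)
  fixed : I.lbpUpdate θbar μ = μ
  mem_node : ∀ i, I.nodeParam μ i ∈ ExpFam.paramSpace (I.ν i) (I.φ i)

/-! ### The matrix `M(u)` -/

/-- `u^α_{i → j} = Var_{b_j}[φ_j]⁻¹ Cov_{b_α}[φ_j, φ_i]` at the beliefs given by `μ`. -/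
def edgeWeight (θbar : I.Model) (μ : I.Msg) (α : H.Factor) (i j : {i : V // i ∈ α.1}) :
    Matrix (Fin (I.r j)) (Fin (I.r i)) ℝ :=
  (ExpFam.cov (I.ν j) (I.φ j) (I.nodeParam μ j))⁻¹ *
    (ExpFam.cov (I.νF α) (I.φFull α) (I.factorParam θbar μ α)).submatrix
      (fun k => Sum.inr ⟨j, k⟩) (fun l => Sum.inr ⟨i, l⟩)

/-- The matrix `M(u)` of matrix weights `u`: its block at `(α → i, β → j)` is `u^α_{j → i}` if
`j ∈ α ∖ i` and `α ≠ β`, and it is `0` otherwise. -/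
def edgeMatrix
    (u : ∀ (α : H.Factor) (i j : {i : V // i ∈ α.1}), Matrix (Fin (I.r j)) (Fin (I.r i)) ℝ) :
    Matrix I.MsgIndex I.MsgIndex ℝ :=
  Matrix.of fun p q =>
    if h : q.1.2.1 ∈ p.1.1.1 ∧ q.1.2.1 ≠ p.1.2.1 ∧ q.1.1 ≠ p.1.1 then
      u p.1.1 ⟨q.1.2.1, h.1⟩ p.1.2 p.2 q.2
    else 0

/-! ### The Bethe free energy -/

/-- Expectation parameters `({η_α}, {η_i})`. -/
abbrev Pseudo : Type _ := (∀ α : H.Factor, I.FactorIndex α → ℝ) × (∀ i : V, Fin (I.r i) → ℝ)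

/-- The set `L` of pseudomarginals: locally consistent families of expectation parameters. -/
def localPolytope : Set I.Pseudo :=
  {η | (∀ α, η.1 α ∈ ExpFam.meanSpace (I.νF α) (I.φFull α)) ∧
    (∀ i, η.2 i ∈ ExpFam.meanSpace (I.ν i) (I.φ i)) ∧
    ∀ (α : H.Factor) (i : {i : V // i ∈ α.1}) (k : Fin (I.r i)),
      η.1 α (Sum.inr ⟨i, k⟩) = η.2 i k}

/-- The Bethe free energy. -/
def bethe [Fintype V] (θbar : I.Model) (η : I.Pseudo) : ℝ :=
  -∑ α : H.Factor, θbar α ⬝ᵥ η.1 α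
    + ∑ α : H.Factor, ExpFam.legendre (I.νF α) (I.φFull α) (η.1 α)
    + ∑ i : V, (1 - (H.degree i : ℝ)) * ExpFam.legendre (I.ν i) (I.φ i) (η.2 i)

/-- The expectation parameters of the beliefs `({b_α}, {b_i})` given by messages `μ`. -/
def beliefs (θbar : I.Model) (μ : I.Msg) : I.Pseudo :=
  (fun α => ExpFam.mean (I.νF α) (I.φFull α) (I.factorParam θbar μ α),
    fun i => ExpFam.mean (I.ν i) (I.φ i) (I.nodeParam μ i))

/-- The pseudomarginals given by `μ` are a local minimum of the Bethe free energy on `L`. -/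
def IsBetheLocalMin [Fintype V] (θbar : I.Model) (μ : I.Msg) : Prop :=
  I.beliefs θbar μ ∈ I.localPolytope ∧
    IsLocalMinOn (I.bethe θbar) I.localPolytope (I.beliefs θbar μ)

end StatFamily

/-! ### Local stability and spectra -/

/-- Local (asymptotic) stability of `x` for the iteration of `f`: iterates that start close to `x`
stay close to `x` and converge to `x`. -/
def IsLocallyStable {E : Type*} [TopologicalSpace E] (f : E → E) (x : E) : Prop :=
  (∀ U ∈ 𝓝 x, ∀ᶠ y in 𝓝 x, ∀ n : ℕ, f^[n] y ∈ U) ∧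
    ∀ᶠ y in 𝓝 x, Tendsto (fun n : ℕ => f^[n] y) atTop (𝓝 x)

/-- The Jacobian matrix of `f` at `x`. -/
def jacobian {ι : Type*} [Fintype ι] [DecidableEq ι] (f : (ι → ℝ) → (ι → ℝ)) (x : ι → ℝ) :
    Matrix ι ι ℝ :=
  LinearMap.toMatrix' (fderiv ℝ f x : (ι → ℝ) →ₗ[ℝ] (ι → ℝ))

/-- The set of complex eigenvalues of a real matrix. -/
def complexSpectrum {ι : Type*} [Fintype ι] [DecidableEq ι] (A : Matrix ι ι ℝ) : Set ℂ :=
  spectrum ℂ (A.map (fun a : ℝ => (a : ℂ)))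

end

/-! Two facts about the matrix `M(u)` carry the theorem: it is the linearization of LBP, and it
controls where the Hessian of the Bethe free energy can degenerate.

Linearization. Natural parameters of beliefs are affine in the messages, `Λ` has derivative `Cov`,
and `Λ⁻¹` has derivative `Cov⁻¹`. The chain rule turns the update into `∑_{j ∈ α} Var_i⁻¹ Cov_{ij}
cavity_j - cavity_i`. At a fixed point the marginals of `b_α` are the `b_i`, so the term `j = i` is
`cavity_i` and cancels; the rest is `M(u)` (`IsFixedPoint.hasFDerivAt_lbpUpdate`). Stability is then
read off the spectrum by `isLocallyStable_of_spectrum` and `IsLocallyStable.norm_le_one`, both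
proved in complex coordinates in which the derivative is almost diagonal. Damping moves an
eigenvalue `λ` along the segment towards `1`. Close to `1` that segment lies in the open unit disc
when `Re λ < 1`; when `Re λ ≥ 1` it stays in `Re ≥ 1`, which meets the closed disc only at `1`
(`IsFixedPoint.exists_damping_iff`).

Bethe free energy. By Legendre duality the gradient of `φ_a` is `Λ_a⁻¹`, and the fixed-point
equations make the gradient of `F` vanish along the consistency constraints
(`betheGradient_beliefs`). The Hessian there is `∑_α Cov_α⁻¹ + ∑_i (1 - d_i) Var_i⁻¹`, restricted to
consistent directions. To see that it is positive, multiply all correlations between different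
blocks of each `Cov_α` by `t ∈ [0, 1]`. At `t = 0` the form is nonnegative, since the `d_i` copies
of `Var_i⁻¹` from the factors and the weight `1 - d_i` add up to one copy (`hessian_zero_nonneg`). A
null direction at time `t` produces nonzero messages `m` with `t M(u) m = m`, hence the real
eigenvalue `1 / t ≥ 1` (`eq_zero_of_hessian_eq_zero`). If there is no such eigenvalue, the form
never degenerates and is positive definite at `t = 1` (`exists_pos_le_of_nondegenerate_path`);
`isLocalMinOn_of_gradient` concludes. -/

set_option linter.unusedSectionVars false

/-! ### Differentiation of exponential integrals. -/

namespace ExpFam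

variable {Ω ι : Type*} [MeasurableSpace Ω] [Fintype ι] {ν : Measure Ω} {φ : Ω → ι → ℝ}

/-- The sum of the absolute values of the components of the statistic. -/
noncomputable def absSum (φ : Ω → ι → ℝ) (x : Ω) : ℝ := ∑ k, |φ x k|

/-- The unnormalized moment `∫ f exp ⟨θ, φ⟩ dν`. -/
noncomputable def moment (ν : Measure Ω) (φ : Ω → ι → ℝ) (f : Ω → ℝ) (θ : ι → ℝ) : ℝ :=
  ∫ x, f x * Real.exp (θ ⬝ᵥ φ x) ∂ν

/-- `f` is integrable against `exp ⟨θ, φ⟩` with an exponential margin. -/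
def Dominated (ν : Measure Ω) (φ : Ω → ι → ℝ) (f : Ω → ℝ) (θ : ι → ℝ) : Prop :=
  ∃ δ > 0, Integrable (fun x => f x * Real.exp (θ ⬝ᵥ φ x + δ * absSum φ x)) ν

lemma absSum_nonneg (φ : Ω → ι → ℝ) (x : Ω) : 0 ≤ absSum φ x :=
  Finset.sum_nonneg fun _ _ => abs_nonneg _

lemma abs_le_absSum (φ : Ω → ι → ℝ) (x : Ω) (k : ι) : |φ x k| ≤ absSum φ x :=
  Finset.single_le_sum (f := fun k => |φ x k|) (fun _ _ => abs_nonneg _) (Finset.mem_univ k)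

lemma measurable_dotProduct (hφ : Measurable φ) (θ : ι → ℝ) : Measurable fun x => θ ⬝ᵥ φ x := by
  unfold dotProduct
  exact Finset.measurable_sum _ fun k _ => ((measurable_pi_apply k).comp hφ).const_mul _

lemma measurable_absSum (hφ : Measurable φ) : Measurable (absSum φ) :=
  Finset.measurable_sum _ fun k _ => ((measurable_pi_apply k).comp hφ).abs

lemma abs_dotProduct_le (h : ι → ℝ) (x : Ω) : |h ⬝ᵥ φ x| ≤ ‖h‖ * absSum φ x := by
  unfold dotProduct absSum
  rw [Finset.mul_sum]
  refine (Finset.abs_sum_le_sum_abs _ _).trans (Finset.sum_le_sum fun k _ => ?_)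
  rw [abs_mul]
  exact mul_le_mul_of_nonneg_right (norm_le_pi_norm h k) (abs_nonneg _)

/-- A small cube around an interior point `θ` lies in the domain of finiteness. The sum of the
exponentials at its `2^ι` vertices is `exp ⟨θ, φ⟩ ∏ (e^{εφ_k/2} + e^{-εφ_k/2})`, which dominates
`exp (⟨θ, φ⟩ + (ε/2) ∑ |φ_k|)`. -/
lemma dominated_of_mem_paramSpace (hφ : Measurable φ) {θ : ι → ℝ} (hθ : θ ∈ paramSpace ν φ) :
    Dominated ν φ (fun _ => 1) θ := by
  classical
  obtain ⟨ε, hε, hball⟩ := Metric.mem_nhds_iff.1 (mem_interior_iff_mem_nhds.1 hθ)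
  let sg : Finset ι → ι → ℝ := fun t k => if k ∈ t then ε / 2 else -(ε / 2)
  have hint : ∀ t, Integrable (fun x => Real.exp ((θ + sg t) ⬝ᵥ φ x)) ν := by
    intro t
    refine hball ?_
    rw [Metric.mem_ball, dist_eq_norm, add_sub_cancel_left]
    refine lt_of_le_of_lt ((pi_norm_le_iff_of_nonneg (r := ε / 2) (by positivity)).2 fun k => ?_)
      (by linarith)
    simp only [sg]
    split_ifs <;> simp [abs_of_pos hε]
  refine ⟨ε / 2, by positivity, ?_⟩
  refine (integrable_finsetSum Finset.univ fun t _ => hint t).mono' ?_ ?_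
  · exact ((measurable_const.mul (((measurable_dotProduct hφ θ).add
      ((measurable_absSum hφ).const_mul _)).exp))).aestronglyMeasurable
  · refine Eventually.of_forall fun x => ?_
    have key := Fintype.prod_add (fun k => Real.exp (ε / 2 * φ x k))
      (fun k => Real.exp (-(ε / 2) * φ x k))
    have h1 : ∀ t : Finset ι, Real.exp ((θ + sg t) ⬝ᵥ φ x) = Real.exp (θ ⬝ᵥ φ x) *
        ((∏ a ∈ t, Real.exp (ε / 2 * φ x a)) * ∏ a ∈ tᶜ, Real.exp (-(ε / 2) * φ x a)) := by
      intro t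
      have h2 : sg t ⬝ᵥ φ x = ∑ a ∈ t, ε / 2 * φ x a + ∑ a ∈ tᶜ, -(ε / 2) * φ x a := by
        unfold dotProduct
        rw [← Finset.sum_add_sum_compl t (fun k => sg t k * φ x k)]
        congr 1
        · exact Finset.sum_congr rfl fun k hk => by simp [sg, hk]
        · exact Finset.sum_congr rfl fun k hk => by
            rw [Finset.mem_compl] at hk
            simp [sg, hk]
      rw [add_dotProduct, h2, Real.exp_add, Real.exp_add, Real.exp_sum, Real.exp_sum]
    simp only [h1]
    rw [← Finset.mul_sum, ← key, one_mul, Real.exp_add, Real.norm_eq_abs, abs_of_pos (by positivity)]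
    refine mul_le_mul_of_nonneg_left ?_ (Real.exp_pos _).le
    unfold absSum
    rw [Finset.mul_sum, Real.exp_sum]
    refine Finset.prod_le_prod (fun _ _ => (Real.exp_pos _).le) fun k _ => ?_
    rcases abs_cases (φ x k) with ⟨h, -⟩ | ⟨h, -⟩
    · rw [h]
      linarith [Real.exp_pos (-(ε / 2) * φ x k)]
    · rw [h, mul_neg, ← neg_mul]
      linarith [Real.exp_pos (ε / 2 * φ x k)]

lemma Dominated.integrable (hφ : Measurable φ) {f : Ω → ℝ} (hf : Measurable f) {θ : ι → ℝ}
    (h : Dominated ν φ f θ) : Integrable (fun x => f x * Real.exp (θ ⬝ᵥ φ x)) ν := by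
  obtain ⟨δ, hδ, hi⟩ := h
  refine hi.mono (hf.mul (measurable_dotProduct hφ θ).exp).aestronglyMeasurable
    (Eventually.of_forall fun x => ?_)
  rw [norm_mul, norm_mul, Real.norm_eq_abs (Real.exp _), Real.norm_eq_abs (Real.exp _),
    Real.abs_exp, Real.abs_exp]
  gcongr
  nlinarith [absSum_nonneg φ x]

lemma mul_exp_le {s δ : ℝ} (hδ : 0 < δ) : s * Real.exp (δ / 2 * s) ≤ 2 / δ * Real.exp (δ * s) := by
  have h1 : δ / 2 * s ≤ Real.exp (δ / 2 * s) := by linarith [Real.add_one_le_exp (δ / 2 * s)]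
  have h2 : Real.exp (δ * s) = Real.exp (δ / 2 * s) * Real.exp (δ / 2 * s) := by
    rw [← Real.exp_add]; ring_nf
  rw [h2, ← mul_assoc]
  refine mul_le_mul_of_nonneg_right ?_ (Real.exp_pos _).le
  rw [div_mul_eq_mul_div, le_div_iff₀ hδ]
  linarith

/-- Half of the exponential margin pays for the factor `φ_k`, by `mul_exp_le`. Iterating this gives
all the moments needed below. -/
lemma Dominated.mul (hφ : Measurable φ) {f : Ω → ℝ} (hf : Measurable f) {θ : ι → ℝ}
    (h : Dominated ν φ f θ) (k : ι) : Dominated ν φ (fun x => f x * φ x k) θ := by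
  obtain ⟨δ, hδ, hi⟩ := h
  refine ⟨δ / 2, by positivity, (hi.const_mul (2 / δ)).mono
    ((hf.mul ((measurable_pi_apply k).comp hφ)).mul ((measurable_dotProduct hφ θ).add
      ((measurable_absSum hφ).const_mul _)).exp).aestronglyMeasurable
    (Eventually.of_forall fun x => ?_)⟩
  simp only [norm_mul, Real.norm_eq_abs, Real.abs_exp, Real.exp_add]
  rw [abs_of_pos (by positivity : 0 < 2 / δ)]
  have := mul_exp_le (s := absSum φ x) hδ
  have h3 : |φ x k| * Real.exp (δ / 2 * absSum φ x) ≤ 2 / δ * Real.exp (δ * absSum φ x) :=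
    (mul_le_mul_of_nonneg_right (abs_le_absSum φ x k) (Real.exp_pos _).le).trans this
  calc |f x| * |φ x k| * (Real.exp (θ ⬝ᵥ φ x) * Real.exp (δ / 2 * absSum φ x))
      = |f x| * Real.exp (θ ⬝ᵥ φ x) * (|φ x k| * Real.exp (δ / 2 * absSum φ x)) := by ring
    _ ≤ |f x| * Real.exp (θ ⬝ᵥ φ x) * (2 / δ * Real.exp (δ * absSum φ x)) := by gcongr
    _ = _ := by ring

lemma exp_add_le {θ θ' : ι → ℝ} {δ : ℝ} (h : ‖θ' - θ‖ ≤ δ) (x : Ω) (c : ℝ) :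
    Real.exp (θ' ⬝ᵥ φ x + c * absSum φ x) ≤ Real.exp (θ ⬝ᵥ φ x + (δ + c) * absSum φ x) := by
  refine Real.exp_le_exp.2 ?_
  have h1 : θ' ⬝ᵥ φ x = θ ⬝ᵥ φ x + (θ' - θ) ⬝ᵥ φ x := by rw [sub_dotProduct]; ring
  have h2 := (le_abs_self _).trans (abs_dotProduct_le (φ := φ) (θ' - θ) x)
  have h3 := mul_le_mul_of_nonneg_right h (absSum_nonneg φ x)
  rw [h1]
  linarith

/-- Moving `θ` by at most `δ / 2` costs half of the margin `δ`. -/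
lemma Dominated.eventually (hφ : Measurable φ) {f : Ω → ℝ} (hf : Measurable f) {θ : ι → ℝ}
    (h : Dominated ν φ f θ) : ∀ᶠ θ' in 𝓝 θ, Dominated ν φ f θ' := by
  obtain ⟨δ, hδ, hi⟩ := h
  filter_upwards [Metric.closedBall_mem_nhds θ (half_pos hδ)] with θ' hθ'
  rw [mem_closedBall_iff_norm] at hθ'
  refine ⟨δ / 2, by positivity, hi.mono
    (hf.mul ((measurable_dotProduct hφ θ').add
      ((measurable_absSum hφ).const_mul _)).exp).aestronglyMeasurable
    (Eventually.of_forall fun x => ?_)⟩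
  simp only [norm_mul, Real.norm_eq_abs, Real.abs_exp]
  refine mul_le_mul_of_nonneg_left ?_ (abs_nonneg _)
  simpa using exp_add_le (φ := φ) hθ' x (δ / 2)

/-- The linear form with coefficients `c`. -/
noncomputable def coordForm (c : ι → ℝ) : (ι → ℝ) →L[ℝ] ℝ :=
  ∑ k, c k • ContinuousLinearMap.proj k

lemma coordForm_apply (c h : ι → ℝ) : coordForm c h = h ⬝ᵥ c := by
  simp [coordForm, dotProduct, mul_comm]

lemma norm_coordForm_le (x : Ω) : ‖coordForm (φ x)‖ ≤ absSum φ x :=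
  ContinuousLinearMap.opNorm_le_bound _ (absSum_nonneg φ x) fun h => by
    rw [coordForm_apply, Real.norm_eq_abs, mul_comm]
    exact abs_dotProduct_le h x

/-- Differentiation under the integral sign: on the ball of radius `δ / 2` the derivative of the
integrand is bounded by a multiple of the integrable function supplied by `Dominated`. -/
lemma hasFDerivAt_moment (hφ : Measurable φ) {f : Ω → ℝ} (hf : Measurable f) {θ : ι → ℝ}
    (h : Dominated ν φ f θ) : HasFDerivAt (moment ν φ f)
      (coordForm fun k => moment ν φ (fun x => f x * φ x k) θ) θ := by
  obtain ⟨δ, hδ, hi⟩ := id h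
  have hmeas : Measurable fun x => coordForm (φ x) := by
    unfold coordForm
    exact Finset.measurable_sum _ fun k _ =>
      (((measurable_pi_apply k).comp hφ).smul_const _)
  have hbound : ∀ x, ∀ θ' ∈ Metric.closedBall θ (δ / 2),
      ‖(f x * Real.exp (θ' ⬝ᵥ φ x)) • coordForm (φ x)‖ ≤
        2 / δ * ‖f x * Real.exp (θ ⬝ᵥ φ x + δ * absSum φ x)‖ := by
    intro x θ' hθ'
    rw [mem_closedBall_iff_norm] at hθ'
    simp only [norm_smul, norm_mul, Real.norm_eq_abs, Real.abs_exp]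
    have h1 := exp_add_le (φ := φ) hθ' x 0
    have h2 := mul_exp_le (s := absSum φ x) hδ
    simp only [zero_mul, add_zero] at h1
    rw [Real.exp_add] at h1 ⊢
    calc |f x| * Real.exp (θ' ⬝ᵥ φ x) * ‖coordForm (φ x)‖
        ≤ |f x| * (Real.exp (θ ⬝ᵥ φ x) * Real.exp (δ / 2 * absSum φ x)) * absSum φ x := by
          gcongr
          exact norm_coordForm_le x
      _ = |f x| * Real.exp (θ ⬝ᵥ φ x) * (absSum φ x * Real.exp (δ / 2 * absSum φ x)) := by ring
      _ ≤ |f x| * Real.exp (θ ⬝ᵥ φ x) * (2 / δ * Real.exp (δ * absSum φ x)) := by gcongr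
      _ = _ := by ring
  have key : HasFDerivAt (moment ν φ f)
      (∫ x, (f x * Real.exp (θ ⬝ᵥ φ x)) • coordForm (φ x) ∂ν) θ := by
    refine hasFDerivAt_integral_of_dominated_of_fderiv_le
      (F := fun θ x => f x * Real.exp (θ ⬝ᵥ φ x))
      (F' := fun θ x => (f x * Real.exp (θ ⬝ᵥ φ x)) • coordForm (φ x))
      (bound := fun x => 2 / δ * ‖f x * Real.exp (θ ⬝ᵥ φ x + δ * absSum φ x)‖)
      (Metric.closedBall_mem_nhds θ (half_pos hδ)) ?_ (h.integrable hφ hf) ?_ ?_ ?_ ?_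
    · exact Eventually.of_forall fun θ' =>
        (hf.mul (measurable_dotProduct hφ θ').exp).aestronglyMeasurable
    · exact ((hf.mul (measurable_dotProduct hφ θ).exp).smul hmeas).aestronglyMeasurable
    · exact Eventually.of_forall hbound
    · exact hi.norm.const_mul _
    · refine Eventually.of_forall fun x θ' _ => ?_
      have h1 : HasFDerivAt (fun θ : ι → ℝ => θ ⬝ᵥ φ x) (coordForm (φ x)) θ' := by
        have := (coordForm (φ x)).hasFDerivAt (x := θ')
        simpa only [funext fun h => coordForm_apply (φ x) h] using this
      have h2 := (h1.exp).const_mul (f x)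
      rwa [smul_smul] at h2
  convert key using 1
  ext v
  have hint : Integrable (fun x => (f x * Real.exp (θ ⬝ᵥ φ x)) • coordForm (φ x)) ν := by
    exact (hi.norm.const_mul _).mono'
      ((hf.mul (measurable_dotProduct hφ θ).exp).smul hmeas).aestronglyMeasurable
      (Eventually.of_forall fun x => hbound x θ (Metric.mem_closedBall_self (by positivity)))
  rw [ContinuousLinearMap.integral_apply hint, coordForm_apply]
  simp only [_root_.smul_apply, coordForm_apply, dotProduct, smul_eq_mul, moment]
  simp only [Finset.mul_sum, ← integral_const_mul]
  rw [integral_finsetSum]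
  · refine Finset.sum_congr rfl fun k _ => integral_congr_ae (Eventually.of_forall fun x => ?_)
    ring
  · intro k _
    refine ((Dominated.integrable hφ (hf.mul ((measurable_pi_apply k).comp hφ))
        (h.mul hφ hf k)).const_mul (v k)).congr (Eventually.of_forall fun x => ?_)
    simp only [dotProduct, Pi.mul_apply, Function.comp]
    ring

lemma continuous_coordForm : Continuous (coordForm : (ι → ℝ) → _) := by
  unfold coordForm
  fun_prop

/-- The partial derivatives are again moments of dominated functions, hence continuous. Strictness
is what the inverse function theorem asks for later. -/
lemma hasStrictFDerivAt_moment (hφ : Measurable φ) {f : Ω → ℝ} (hf : Measurable f) {θ : ι → ℝ}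
    (h : Dominated ν φ f θ) : HasStrictFDerivAt (moment ν φ f)
      (coordForm fun k => moment ν φ (fun x => f x * φ x k) θ) θ := by
  refine hasStrictFDerivAt_of_hasFDerivAt_of_continuousAt
    (f' := fun θ => coordForm fun k => moment ν φ (fun x => f x * φ x k) θ)
    ((h.eventually hφ hf).mono fun θ' h' => hasFDerivAt_moment hφ hf h') ?_
  refine continuous_coordForm.continuousAt.comp (continuousAt_pi.2 fun k => ?_)
  exact (hasFDerivAt_moment hφ (hf.mul ((measurable_pi_apply k).comp hφ))
    (h.mul hφ hf k)).continuousAt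

end ExpFam

/-! ### Means, covariances and Legendre duality. -/

namespace ExpFam

variable {Ω ι : Type*} [MeasurableSpace Ω] [Fintype ι] {ν : Measure Ω} {φ : Ω → ι → ℝ}

lemma integrable_exp_of_mem {θ : ι → ℝ} (hθ : θ ∈ paramSpace ν φ) :
    Integrable (fun x => Real.exp (θ ⬝ᵥ φ x)) ν :=
  interior_subset (s := {θ | Integrable (fun x => Real.exp (θ ⬝ᵥ φ x)) ν}) hθ

lemma logPartition_eq (θ : ι → ℝ) : logPartition ν φ θ = Real.log (moment ν φ (fun _ => 1) θ) := by
  simp [logPartition, moment]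

lemma moment_one_pos [NeZero ν] {θ : ι → ℝ} (hθ : Integrable (fun x => Real.exp (θ ⬝ᵥ φ x)) ν) :
    0 < moment ν φ (fun _ => 1) θ := by
  simpa [moment] using integral_exp_pos hθ

lemma density_eq [NeZero ν] {θ : ι → ℝ} (hθ : Integrable (fun x => Real.exp (θ ⬝ᵥ φ x)) ν)
    (x : Ω) : density ν φ θ x = Real.exp (θ ⬝ᵥ φ x) / moment ν φ (fun _ => 1) θ := by
  rw [density, logPartition_eq, Real.exp_sub, Real.exp_log (moment_one_pos hθ)]

lemma density_pos (θ : ι → ℝ) (x : Ω) : 0 < density ν φ θ x := Real.exp_pos _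

lemma measurable_density (hφ : Measurable φ) (θ : ι → ℝ) : Measurable (density ν φ θ) :=
  ((measurable_dotProduct hφ θ).sub_const _).exp

lemma integral_law [NeZero ν] (hφ : Measurable φ) {θ : ι → ℝ}
    (hθ : Integrable (fun x => Real.exp (θ ⬝ᵥ φ x)) ν) (g : Ω → ℝ) :
    ∫ x, g x ∂(law ν φ θ) = moment ν φ g θ / moment ν φ (fun _ => 1) θ := by
  rw [law, integral_withDensity_eq_integral_toReal_smul
    (measurable_density hφ θ).ennreal_ofReal (Eventually.of_forall fun _ => ENNReal.ofReal_lt_top)]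
  simp only [ENNReal.toReal_ofReal (density_pos θ _).le, smul_eq_mul]
  simp only [density_eq hθ]
  rw [moment.eq_def ν φ g, ← integral_div]
  exact integral_congr_ae (Eventually.of_forall fun x => by ring)

lemma isProbabilityMeasure_law [NeZero ν] {θ : ι → ℝ}
    (hθ : Integrable (fun x => Real.exp (θ ⬝ᵥ φ x)) ν) : IsProbabilityMeasure (law ν φ θ) := by
  have hd : Integrable (density ν φ θ) ν := by
    simp only [funext (density_eq hθ)]
    exact hθ.div_const _
  refine ⟨?_⟩
  rw [law, withDensity_apply _ MeasurableSet.univ, Measure.restrict_univ,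
    ← ofReal_integral_eq_lintegral_ofReal hd (Eventually.of_forall fun x => (density_pos θ x).le)]
  simp only [density_eq hθ]
  rw [integral_div, ENNReal.ofReal_eq_one]
  refine (div_eq_one_iff_eq (moment_one_pos hθ).ne').2 ?_
  simp [moment]

lemma integrable_law_of_dominated (hφ : Measurable φ) [NeZero ν] {θ : ι → ℝ}
    (hθ : Integrable (fun x => Real.exp (θ ⬝ᵥ φ x)) ν) {g : Ω → ℝ} (hg : Measurable g)
    (h : Dominated ν φ g θ) : Integrable g (law ν φ θ) := by
  rw [law, integrable_withDensity_iff_integrable_smul'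
    (measurable_density hφ θ).ennreal_ofReal (Eventually.of_forall fun _ => ENNReal.ofReal_lt_top)]
  simp only [ENNReal.toReal_ofReal (density_pos θ _).le, smul_eq_mul]
  simp only [density_eq hθ]
  refine ((h.integrable hφ hg).div_const (moment ν φ (fun _ => 1) θ)).congr
    (Eventually.of_forall fun x => by ring)

lemma dominated_apply (hφ : Measurable φ) {θ : ι → ℝ} (hθ : θ ∈ paramSpace ν φ) (k : ι) :
    Dominated ν φ (fun x => φ x k) θ := by
  simpa using (dominated_of_mem_paramSpace hφ hθ).mul hφ measurable_const k

lemma measurable_apply (hφ : Measurable φ) (k : ι) : Measurable fun x => φ x k :=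
  (measurable_pi_apply k).comp hφ

lemma memLp_apply [NeZero ν] (hφ : Measurable φ) {θ : ι → ℝ} (hθ : θ ∈ paramSpace ν φ) (k : ι) :
    MemLp (fun x => φ x k) 2 (law ν φ θ) := by
  rw [memLp_two_iff_integrable_sq (measurable_apply hφ k).aestronglyMeasurable]
  simp only [pow_two]
  exact integrable_law_of_dominated hφ (integrable_exp_of_mem hθ)
    ((measurable_apply hφ k).mul (measurable_apply hφ k))
    ((dominated_apply hφ hθ k).mul hφ (measurable_apply hφ k) k)

lemma mean_apply [NeZero ν] (hφ : Measurable φ) {θ : ι → ℝ}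
    (hθ : θ ∈ paramSpace ν φ) (k : ι) :
    mean ν φ θ k = moment ν φ (fun x => φ x k) θ / moment ν φ (fun _ => 1) θ :=
  integral_law hφ (integrable_exp_of_mem hθ) _

lemma cov_apply [NeZero ν] (hφ : Measurable φ) {θ : ι → ℝ}
    (hθ : θ ∈ paramSpace ν φ) (k l : ι) :
    cov ν φ θ k l = moment ν φ (fun x => φ x k * φ x l) θ / moment ν φ (fun _ => 1) θ -
      mean ν φ θ k * mean ν φ θ l := by
  have := isProbabilityMeasure_law (integrable_exp_of_mem hθ)
  rw [cov, of_apply, ProbabilityTheory.covariance_eq_sub (memLp_apply hφ hθ k)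
    (memLp_apply hφ hθ l), ← integral_law hφ (integrable_exp_of_mem hθ)]
  rfl

lemma dotProduct_cov_mulVec [NeZero ν] (hφ : Measurable φ) {θ : ι → ℝ}
    (hθ : θ ∈ paramSpace ν φ) (w : ι → ℝ) :
    w ⬝ᵥ cov ν φ θ *ᵥ w = ProbabilityTheory.variance (fun x => w ⬝ᵥ φ x) (law ν φ θ) := by
  have := isProbabilityMeasure_law (integrable_exp_of_mem hθ)
  rw [← ProbabilityTheory.covariance_self (measurable_dotProduct hφ w).aemeasurable]
  simp only [dotProduct]
  rw [ProbabilityTheory.covariance_fun_sum_fun_sum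
    (fun k => (memLp_apply hφ hθ k).const_mul _) (fun k => (memLp_apply hφ hθ k).const_mul _)]
  simp only [mulVec, dotProduct, ProbabilityTheory.covariance_const_mul_left,
    ProbabilityTheory.covariance_const_mul_right, cov, of_apply, Finset.mul_sum]
  exact Finset.sum_congr rfl fun _ _ => Finset.sum_congr rfl fun _ _ => by ring

lemma cov_posSemidef [NeZero ν] (hφ : Measurable φ) {θ : ι → ℝ} (hθ : θ ∈ paramSpace ν φ) :
    (cov ν φ θ).PosSemidef := by
  refine Matrix.PosSemidef.of_dotProduct_mulVec_nonneg ?_ fun w => ?_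
  · ext k l
    simp [cov, ProbabilityTheory.covariance_comm]
  · rw [star_trivial, dotProduct_cov_mulVec hφ hθ]
    exact ProbabilityTheory.variance_nonneg _ _

lemma cov_posDef [DecidableEq ι] [NeZero ν] (hφ : Measurable φ) {θ : ι → ℝ}
    (hθ : θ ∈ paramSpace ν φ) (hu : IsUnit (cov ν φ θ)) : (cov ν φ θ).PosDef :=
  (cov_posSemidef hφ hθ).posDef_iff_isUnit.2 hu

/-- The covariance matrix is invertible if no nontrivial linear combination of the components of
the statistic is almost everywhere constant. -/
lemma isUnit_cov_of_ae_const [DecidableEq ι] [NeZero ν] (hφ : Measurable φ)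
    (h : ∀ (w : ι → ℝ) (c : ℝ), (∀ᵐ x ∂ν, w ⬝ᵥ φ x = c) → w = 0) {θ : ι → ℝ}
    (hθ : θ ∈ paramSpace ν φ) : IsUnit (cov ν φ θ) := by
  have := isProbabilityMeasure_law (integrable_exp_of_mem hθ)
  refine ((cov_posSemidef hφ hθ).posDef_iff_isUnit).1
    (Matrix.PosDef.of_dotProduct_mulVec_pos (cov_posSemidef hφ hθ).1 fun w hw => ?_)
  rw [star_trivial, dotProduct_cov_mulVec hφ hθ]
  refine lt_of_le_of_ne (ProbabilityTheory.variance_nonneg _ _) fun h0 => hw ?_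
  have hL : MemLp (fun x => w ⬝ᵥ φ x) 2 (law ν φ θ) :=
    memLp_finsetSum _ fun k _ => (memLp_apply hφ hθ k).const_mul _
  have hae := ProbabilityTheory.ae_eq_integral_of_variance_eq_zero hL h0.symm
  -- The density is positive everywhere, so almost sure statements pass from the law to `ν`.
  rw [law, ae_withDensity_iff (measurable_density hφ θ).ennreal_ofReal] at hae
  refine h w _ (hae.mono fun x hx => hx ?_)
  simpa using density_pos θ x

/-- The mean is a quotient of moments, and the quotient rule yields `E[φ_k φ_l] - E[φ_k] E[φ_l]`. -/
lemma hasStrictFDerivAt_mean [NeZero ν] (hφ : Measurable φ) {θ : ι → ℝ}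
    (hθ : θ ∈ paramSpace ν φ) : HasStrictFDerivAt (mean ν φ)
      (Matrix.mulVecLin (cov ν φ θ)).toContinuousLinearMap θ := by
  rw [hasStrictFDerivAt_pi']
  intro k
  have h1 := hasStrictFDerivAt_moment hφ measurable_const (dominated_of_mem_paramSpace hφ hθ)
  have h2 := hasStrictFDerivAt_moment hφ (measurable_apply hφ k) (dominated_apply hφ hθ k)
  have hZ := (moment_one_pos (integrable_exp_of_mem hθ)).ne'
  have h3 := h2.fun_mul ((hasStrictDerivAt_inv hZ).comp_hasStrictFDerivAt θ h1)
  refine (h3.congr_of_eventuallyEq ?_).congr_fderiv ?_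
  · filter_upwards [isOpen_interior.mem_nhds hθ] with θ' hθ'
    simp [mean_apply hφ hθ' k, div_eq_mul_inv]
  · refine ContinuousLinearMap.ext fun w => ?_
    simp only [_root_.smul_apply, _root_.add_apply, coordForm_apply, smul_eq_mul,
      ContinuousLinearMap.comp_apply, ContinuousLinearMap.proj_apply,
      LinearMap.coe_toContinuousLinearMap', Matrix.mulVecLin_apply, mulVec, dotProduct, one_mul,
      cov_apply hφ hθ, mean_apply hφ hθ, Function.comp_apply]
    simp only [Finset.mul_sum]
    rw [← Finset.sum_add_distrib]
    refine Finset.sum_congr rfl fun l _ => ?_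
    field_simp
    ring

lemma hasFDerivAt_logPartition [NeZero ν] (hφ : Measurable φ) {θ : ι → ℝ}
    (hθ : θ ∈ paramSpace ν φ) :
    HasFDerivAt (logPartition ν φ) (coordForm (mean ν φ θ)) θ := by
  have hZ := (moment_one_pos (integrable_exp_of_mem hθ)).ne'
  have h1 := (hasFDerivAt_moment hφ measurable_const (dominated_of_mem_paramSpace hφ hθ)).log hZ
  rw [show logPartition ν φ = fun θ => Real.log (moment ν φ (fun _ => 1) θ) from
    funext logPartition_eq]
  refine h1.congr_fderiv ?_
  ext w
  simp only [_root_.smul_apply, coordForm_apply, smul_eq_mul, dotProduct, one_mul,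
    mean_apply hφ hθ, Finset.mul_sum]
  exact Finset.sum_congr rfl fun k _ => by ring

lemma convex_paramSpace (hφ : Measurable φ) : Convex ℝ (paramSpace ν φ) := by
  refine Convex.interior fun θ hθ θ' hθ' a b ha hb hab => ?_
  refine ((Integrable.const_mul hθ a).add (Integrable.const_mul hθ' b)).mono'
    (measurable_dotProduct hφ _).exp.aestronglyMeasurable (Eventually.of_forall fun x => ?_)
  rw [Real.norm_eq_abs, Real.abs_exp, add_dotProduct, smul_dotProduct, smul_dotProduct]
  exact convexOn_exp.2 (Set.mem_univ _) (Set.mem_univ _) ha hb hab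

lemma segment_mem (hφ : Measurable φ) {θ θ' : ι → ℝ} (hθ : θ ∈ paramSpace ν φ)
    (hθ' : θ' ∈ paramSpace ν φ) {s : ℝ} (hs : s ∈ Set.Icc (0 : ℝ) 1) :
    θ + s • (θ' - θ) ∈ paramSpace ν φ :=
  (convex_paramSpace hφ).add_smul_sub_mem hθ hθ' hs

lemma hasDerivAt_mean_segment [NeZero ν] (hφ : Measurable φ) (θ w : ι → ℝ) {s : ℝ}
    (hs : θ + s • w ∈ paramSpace ν φ) :
    HasDerivAt (fun s : ℝ => w ⬝ᵥ mean ν φ (θ + s • w)) (w ⬝ᵥ cov ν φ (θ + s • w) *ᵥ w) s := by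
  have h1 : HasDerivAt (fun s : ℝ => θ + s • w) w s := by
    simpa using ((hasDerivAt_id s).smul_const w).const_add θ
  have h2 := (hasStrictFDerivAt_mean hφ hs).hasFDerivAt.comp_hasDerivAt s h1
  have h3 := (coordForm w).hasFDerivAt.comp_hasDerivAt s h2
  simp only [coordForm_apply, LinearMap.coe_toContinuousLinearMap', Matrix.mulVecLin_apply] at h3
  rw [dotProduct_comm]
  refine h3.congr_of_eventuallyEq (Eventually.of_forall fun t => ?_)
  simp [coordForm_apply, dotProduct_comm]

/-- Along the segment from `θ` to `θ'`, with `w = θ' - θ ≠ 0`, the function `⟨w, Λ⟩` has derivative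
`⟨w, Cov w⟩ > 0`, so its values at the two ends differ. -/
lemma injOn_mean [DecidableEq ι] [NeZero ν] (hφ : Measurable φ)
    (hu : ∀ θ ∈ paramSpace ν φ, IsUnit (cov ν φ θ)) :
    Set.InjOn (mean ν φ) (paramSpace ν φ) := by
  intro θ hθ θ' hθ' heq
  by_contra hne
  have hw : θ' - θ ≠ 0 := sub_ne_zero.2 (Ne.symm hne)
  have hmono : StrictMonoOn (fun s : ℝ => (θ' - θ) ⬝ᵥ mean ν φ (θ + s • (θ' - θ)))
      (Set.Icc 0 1) := by
    refine strictMonoOn_of_deriv_pos (convex_Icc 0 1) (fun s hs =>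
      (hasDerivAt_mean_segment hφ θ _
        (segment_mem hφ hθ hθ' hs)).continuousAt.continuousWithinAt) fun s hs => ?_
    have hs' := segment_mem hφ hθ hθ' (interior_subset hs)
    rw [(hasDerivAt_mean_segment hφ θ _ hs').deriv]
    simpa using (cov_posDef hφ hs' (hu _ hs')).dotProduct_mulVec_pos hw
  have := hmono (by simp) (by simp) zero_lt_one
  simp [heq] at this

/-- The tangent inequality for the convex function `ψ`, obtained from monotonicity of its derivative
along segments. It shows that the supremum in the Legendre transform at `Λ θ` is attained at `θ`. -/
lemma logPartition_ge [NeZero ν] (hφ : Measurable φ) {θ θ' : ι → ℝ} (hθ : θ ∈ paramSpace ν φ)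
    (hθ' : θ' ∈ paramSpace ν φ) :
    logPartition ν φ θ + (θ' - θ) ⬝ᵥ mean ν φ θ ≤ logPartition ν φ θ' := by
  obtain ⟨w, rfl⟩ : ∃ w, θ' = θ + w := ⟨θ' - θ, by simp⟩
  rw [add_sub_cancel_left]
  have hseg : ∀ s ∈ Set.Icc (0 : ℝ) 1, θ + s • w ∈ paramSpace ν φ := fun s hs => by
    simpa using segment_mem hφ hθ hθ' hs
  have hmono : MonotoneOn (fun s : ℝ => w ⬝ᵥ mean ν φ (θ + s • w)) (Set.Icc 0 1) := by
    refine monotoneOn_of_deriv_nonneg (convex_Icc 0 1) (fun s hs =>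
      (hasDerivAt_mean_segment hφ θ _
        (hseg _ hs)).continuousAt.continuousWithinAt) (fun s hs =>
      (hasDerivAt_mean_segment hφ θ _ (hseg _
        (interior_subset hs))).differentiableAt.differentiableWithinAt) fun s hs => ?_
    have hs' := hseg _ (interior_subset hs)
    rw [(hasDerivAt_mean_segment hφ θ _ hs').deriv]
    simpa using (cov_posSemidef hφ hs').dotProduct_mulVec_nonneg w
  have hd : ∀ s ∈ Set.Icc (0 : ℝ) 1, HasDerivAt
      (fun s : ℝ => logPartition ν φ (θ + s • w) - s * (w ⬝ᵥ mean ν φ θ))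
      (w ⬝ᵥ mean ν φ (θ + s • w) - w ⬝ᵥ mean ν φ θ) s := by
    intro s hs
    have h1 : HasDerivAt (fun s : ℝ => θ + s • w) w s := by
      simpa using ((hasDerivAt_id s).smul_const w).const_add θ
    have h2 := (hasFDerivAt_logPartition hφ (hseg _ hs)).comp_hasDerivAt s h1
    rw [coordForm_apply] at h2
    have h3 := h2.sub ((hasDerivAt_id s).mul_const (w ⬝ᵥ mean ν φ θ))
    rw [one_mul] at h3
    exact h3
  have hm2 : MonotoneOn (fun s : ℝ => logPartition ν φ (θ + s • w) - s * (w ⬝ᵥ mean ν φ θ))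
      (Set.Icc 0 1) := by
    refine monotoneOn_of_deriv_nonneg (convex_Icc 0 1)
      (fun s hs => (hd s hs).continuousAt.continuousWithinAt)
      (fun s hs => (hd s (interior_subset hs)).differentiableAt.differentiableWithinAt)
      fun s hs => ?_
    have hs' := interior_subset hs
    rw [(hd s hs').deriv]
    have := hmono (by simp) hs' hs'.1
    simp only [zero_smul, add_zero] at this
    linarith
  have := hm2 (by simp) (by simp) zero_le_one
  simp only [zero_smul, add_zero, zero_mul, sub_zero, one_smul, one_mul] at this
  linarith

lemma legendre_mean [NeZero ν] (hφ : Measurable φ) {θ : ι → ℝ} (hθ : θ ∈ paramSpace ν φ) :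
    legendre ν φ (mean ν φ θ) = θ ⬝ᵥ mean ν φ θ - logPartition ν φ θ := by
  refine IsGreatest.csSup_eq ⟨⟨θ, hθ, rfl⟩, ?_⟩
  rintro _ ⟨θ', hθ', rfl⟩
  have := logPartition_ge hφ hθ hθ'
  rw [sub_dotProduct] at this
  simp only
  linarith

lemma invMean_mean [DecidableEq ι] [NeZero ν] (hφ : Measurable φ)
    (hu : ∀ θ ∈ paramSpace ν φ, IsUnit (cov ν φ θ)) {θ : ι → ℝ} (hθ : θ ∈ paramSpace ν φ) :
    invMean ν φ (mean ν φ θ) = θ :=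
  (injOn_mean hφ hu).leftInvOn_invFunOn hθ

/-- The inverse function theorem provides a smooth local inverse; injectivity of `Λ` on `Θ` forces
it to agree with the globally chosen `invMean` near `Λ θ`. -/
lemma exists_localInverse [DecidableEq ι] [NeZero ν] (hφ : Measurable φ)
    (hu : ∀ θ ∈ paramSpace ν φ, IsUnit (cov ν φ θ)) {θ : ι → ℝ} (hθ : θ ∈ paramSpace ν φ) :
    HasStrictFDerivAt (invMean ν φ)
      (Matrix.mulVecLin (cov ν φ θ)⁻¹).toContinuousLinearMap (mean ν φ θ) ∧
    ∀ᶠ η in 𝓝 (mean ν φ θ), invMean ν φ η ∈ paramSpace ν φ ∧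
      mean ν φ (invMean ν φ η) = η := by
  have hdet := (Matrix.isUnit_iff_isUnit_det _).1 (hu θ hθ)
  let e : (ι → ℝ) ≃ₗ[ℝ] (ι → ℝ) := LinearEquiv.ofLinearMap (Matrix.mulVecLin (cov ν φ θ))
    (Matrix.mulVecLin (cov ν φ θ)⁻¹)
    (by rw [← Matrix.mulVecLin_mul, Matrix.mul_nonsing_inv _ hdet, Matrix.mulVecLin_one])
    (by rw [← Matrix.mulVecLin_mul, Matrix.nonsing_inv_mul _ hdet, Matrix.mulVecLin_one])
  let e' : (ι → ℝ) ≃L[ℝ] (ι → ℝ) := e.toContinuousLinearEquiv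
  have h : HasStrictFDerivAt (mean ν φ) (e' : (ι → ℝ) →L[ℝ] (ι → ℝ)) θ :=
    (hasStrictFDerivAt_mean hφ hθ).congr_fderiv (by ext1 w; rfl)
  have h1 := h.to_localInverse
  have h2 := h.eventually_right_inverse
  have h3 : ∀ᶠ η in 𝓝 (mean ν φ θ), h.localInverse (mean ν φ) e' θ η ∈ paramSpace ν φ := by
    refine h.localInverse_continuousAt.eventually_mem (isOpen_interior.mem_nhds ?_)
    rw [h.localInverse_apply_image]
    exact hθ
  have h4 : ∀ᶠ η in 𝓝 (mean ν φ θ), h.localInverse (mean ν φ) e' θ η = invMean ν φ η := by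
    filter_upwards [h2, h3] with η h2 h3
    conv_rhs => rw [← h2]
    rw [invMean_mean hφ hu h3]
  refine ⟨(h1.congr_of_eventuallyEq h4).congr_fderiv (by ext1 w; rfl), ?_⟩
  filter_upwards [h2, h3, h4] with η h2 h3 h4
  exact ⟨h4 ▸ h3, h4 ▸ h2⟩

/-- The gradient of the Legendre transform is `Λ⁻¹`. -/
lemma hasFDerivAt_legendre [DecidableEq ι] [NeZero ν] (hφ : Measurable φ)
    (hu : ∀ θ ∈ paramSpace ν φ, IsUnit (cov ν φ θ)) {θ : ι → ℝ} (hθ : θ ∈ paramSpace ν φ) :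
    HasFDerivAt (legendre ν φ) (coordForm θ) (mean ν φ θ) := by
  obtain ⟨h1, h2⟩ := exists_localInverse hφ hu hθ
  -- Near `Λ θ` the supremum is attained at `Λ⁻¹ η`. In the derivative of the resulting formula the
  -- two terms containing the derivative of `Λ⁻¹` cancel, because `∇ψ = Λ`.
  have h3 : (fun η => invMean ν φ η ⬝ᵥ η - logPartition ν φ (invMean ν φ η))
      =ᶠ[𝓝 (mean ν φ θ)] legendre ν φ := by
    filter_upwards [h2] with η hη
    conv_rhs => rw [← hη.2]
    rw [legendre_mean hφ hη.1, hη.2]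
  have hinv := invMean_mean hφ hu hθ
  set D := (Matrix.mulVecLin (cov ν φ θ)⁻¹).toContinuousLinearMap
  have h4 : HasFDerivAt (fun η => logPartition ν φ (invMean ν φ η))
      ((coordForm (mean ν φ θ)).comp D) (mean ν φ θ) := by
    refine HasFDerivAt.comp (mean ν φ θ) (g := logPartition ν φ) ?_ h1.hasFDerivAt
    rw [hinv]
    exact hasFDerivAt_logPartition hφ hθ
  have h5 : HasFDerivAt (fun η => invMean ν φ η ⬝ᵥ η)
      (coordForm θ + (coordForm (mean ν φ θ)).comp D) (mean ν φ θ) := by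
    have h6 : ∀ k, HasFDerivAt (fun η => invMean ν φ η k)
        ((ContinuousLinearMap.proj k).comp D) (mean ν φ θ) :=
      fun k => (hasFDerivAt_pi'.1 h1.hasFDerivAt) k
    have h7 := HasFDerivAt.fun_sum (u := Finset.univ) fun k _ => (h6 k).fun_mul
      (ContinuousLinearMap.proj (R := ℝ) (φ := fun _ : ι => ℝ) k).hasFDerivAt
    refine h7.congr_fderiv ?_
    ext w
    simp [coordForm_apply, hinv, dotProduct, Finset.sum_add_distrib, mul_comm]
  refine ((h5.sub h4).congr_fderiv ?_).congr_of_eventuallyEq h3.symm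
  simp

end ExpFam

/-! ### Almost diagonal form of complex endomorphisms. -/

/-- A complex endomorphism is, in a suitable basis, arbitrarily close to the diagonal matrix of its
eigenvalues. -/
lemma Module.End.exists_basis_almost_diagonal (n : ℕ) : ∀ (E : Type u) [AddCommGroup E] [Module ℂ E]
    [FiniteDimensional ℂ E], Module.finrank ℂ E = n → ∀ (f : Module.End ℂ E) (δ : ℝ), 0 < δ →
    ∃ (b : Module.Basis (Fin n) ℂ E) (d : Fin n → ℂ) (A : Matrix (Fin n) (Fin n) ℂ),
      (∀ i, f.HasEigenvalue (d i)) ∧ (∀ z, f.HasEigenvalue z → ∃ i, d i = z) ∧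
      (∀ j, f (b j) = ∑ i, A i j • b i) ∧ ∀ i j, ‖A i j - Matrix.diagonal d i j‖ ≤ δ := by
  induction n with
  | zero =>
    intro E _ _ _ hn f δ hδ
    refine ⟨Module.finBasisOfFinrankEq ℂ E hn, Fin.elim0, 0, fun i => i.elim0, fun z hz => ?_,
      fun i => i.elim0, fun i => i.elim0⟩
    obtain ⟨w, hw⟩ := hz.exists_hasEigenvector
    have := Module.finrank_zero_iff.1 hn
    exact absurd (Subsingleton.elim w 0) hw.2
  | succ n ih =>
    intro E _ _ _ hn f δ hδ
    have hnt : Nontrivial E := Module.nontrivial_of_finrank_pos (R := ℂ) (by omega)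
    obtain ⟨c, hc⟩ := Module.End.exists_eigenvalue f
    -- Since `c` is an eigenvalue, `f - c` is not surjective and its range lies in a hyperplane `ker
    -- g`. This hyperplane is `f`-invariant, and `f` acts on the quotient by it as `c`.
    have hR : LinearMap.range (f - algebraMap ℂ (Module.End ℂ E) c) < ⊤ := by
      rw [lt_top_iff_ne_top, Ne, LinearMap.range_eq_top, ← LinearMap.injective_iff_surjective]
      intro hinj
      obtain ⟨w, hw⟩ := hc.exists_hasEigenvector
      refine hw.2 (hinj ?_)
      simp [hw.apply_eq_smul]
    obtain ⟨g, hg, hle⟩ := Submodule.exists_le_ker_of_lt_top _ hR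
    have hmem : ∀ x, f x - c • x ∈ LinearMap.ker g := fun x => hle ⟨x, by simp⟩
    have hinv : ∀ x ∈ LinearMap.ker g, f x ∈ LinearMap.ker g := fun x hx => by
      have := (LinearMap.ker g).add_mem (hmem x) ((LinearMap.ker g).smul_mem c hx)
      simpa using this
    have hfin : Module.finrank ℂ (LinearMap.ker g) = n := by
      have := Module.Dual.finrank_ker_add_one_of_ne_zero hg
      omega
    obtain ⟨b, d, A, h1, h2, h3, h4⟩ := ih (LinearMap.ker g) hfin (f.restrict hinv) δ hδ
    obtain ⟨w, hw⟩ : ∃ w, g w ≠ 0 := by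
      by_contra! h
      exact hg (LinearMap.ext h)
    let t : Fin n → ℂ := b.repr ⟨f w - c • w, hmem w⟩
    have ht : f w - c • w = ∑ i, t i • (b i : E) := by
      have := congrArg (LinearMap.ker g).subtype (b.sum_repr ⟨f w - c • w, hmem w⟩)
      rw [map_sum] at this
      exact this.symm
    -- Scaling the new basis vector `w` by `s` scales the new off-diagonal entries to `s * t i`; the
    -- denominator `‖t‖ + 1` avoids a division by zero.
    obtain ⟨s, hs, hst⟩ : ∃ s : ℝ, 0 < s ∧ ∀ i, s * ‖t i‖ ≤ δ := by
      refine ⟨δ / (‖t‖ + 1), by positivity, fun i => ?_⟩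
      rw [div_mul_eq_mul_div, div_le_iff₀ (by positivity)]
      have := norm_le_pi_norm t i
      nlinarith
    have hs' : (s : ℂ) ≠ 0 := by exact_mod_cast hs.ne'
    let B : Module.Basis (Fin (n + 1)) ℂ E := Module.Basis.mkFinCons ((s : ℂ) • w) b
      (fun a x hx h => by
        have := congrArg g h
        rw [LinearMap.mem_ker] at hx
        simpa [hx, hs', hw] using this)
      (fun z => ⟨-(g z / (s * g w)), by
        rw [LinearMap.mem_ker]
        simp only [map_add, map_smul, smul_eq_mul]
        field_simp
        ring⟩)
    have hB : (B : Fin (n + 1) → E) = Fin.cons ((s : ℂ) • w) (fun i => (b i : E)) :=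
      Module.Basis.coe_mkFinCons _ _ _ _
    refine ⟨B, Fin.cons c d, Matrix.of (Fin.cons (Fin.cons c 0)
      (fun i => Fin.cons (s * t i) (A i))), ?_, ?_, ?_, ?_⟩
    · refine Fin.cases hc fun i => ?_
      obtain ⟨y, hy⟩ := (h1 i).exists_hasEigenvector
      refine Module.End.hasEigenvalue_of_hasEigenvector (x := (y : E))
        ⟨Module.End.mem_eigenspace_iff.2 ?_, fun h => hy.2 (Subtype.ext h)⟩
      simpa using congrArg Subtype.val hy.apply_eq_smul
    · intro z hz
      by_cases hzc : z = c
      · exact ⟨0, by simp [hzc]⟩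
      obtain ⟨y, hy⟩ := hz.exists_hasEigenvector
      -- An eigenvector for `z ≠ c` lies in the hyperplane, because `(f - c) y = (z - c) y` does.
      have hyk : y ∈ LinearMap.ker g := by
        have := hmem y
        rw [hy.apply_eq_smul, ← sub_smul] at this
        exact ((LinearMap.ker g).smul_mem_iff (sub_ne_zero.2 hzc)).1 this
      obtain ⟨i, hi⟩ := h2 z (Module.End.hasEigenvalue_of_hasEigenvector (x := ⟨y, hyk⟩)
        ⟨Module.End.mem_eigenspace_iff.2 (Subtype.ext (by simpa using hy.apply_eq_smul)),
          fun h => hy.2 (congrArg Subtype.val h)⟩)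
      exact ⟨i.succ, by simpa using hi⟩
    · rw [hB]
      refine Fin.cases ?_ fun j => ?_
      · rw [Fin.sum_univ_succ]
        simp only [Fin.cons_zero, Fin.cons_succ, of_apply, map_smul]
        simp only [mul_smul, ← Finset.smul_sum, ← ht]
        module
      · rw [Fin.sum_univ_succ]
        simp only [Fin.cons_zero, Fin.cons_succ, of_apply]
        simpa using congrArg Subtype.val (h3 j)
    · refine Fin.cases (Fin.cases ?_ fun j => ?_) fun i => Fin.cases ?_ fun j => ?_
      · simpa using hδ.le
      · simp [Matrix.diagonal, (Fin.succ_ne_zero j).symm, hδ.le]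
      · simpa [Matrix.diagonal, abs_of_pos hs] using hst i
      · simpa [Matrix.diagonal] using h4 i j

/-! ### Linearized stability and instability of fixed points. -/

section Stability

variable {ι : Type*} [Fintype ι] [DecidableEq ι]

/-- The map `f`, centred at `x`, applied to real and imaginary parts. -/
noncomputable def complexify (f : (ι → ℝ) → (ι → ℝ)) (x : ι → ℝ) (z : ι → ℂ) : ι → ℂ := fun k =>
  ⟨f (x + fun k => (z k).re) k - x k, f (x + fun k => (z k).im) k - x k⟩

/-- Real and imaginary parts evolve independently under `f`. A real dynamical system can thus be
studied in complex coordinates adapted to the eigenvalues. -/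
lemma complexify_iterate (f : (ι → ℝ) → (ι → ℝ)) {x : ι → ℝ} (n : ℕ) (z : ι → ℂ) :
    (complexify f x)^[n] z = complexify (f^[n]) x z := by
  induction n with
  | zero => ext k; apply Complex.ext <;> simp [complexify]
  | succ n ih =>
    rw [Function.iterate_succ_apply', ih]
    ext k
    have h1 : ∀ y : ι → ℝ, (x + fun k => y k - x k) = y := fun y => by ext k; simp
    simp only [complexify, h1, Function.iterate_succ_apply']

/-- The complexified map has the complexified `A` as its linear part at the origin. In an almost
diagonal basis, both the off-diagonal entries and the first-order remainder are absorbed into the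
error `η ‖P z‖`. -/
lemma exists_almost_diagonal {f : (ι → ℝ) → (ι → ℝ)} {x : ι → ℝ} {A : (ι → ℝ) →L[ℝ] (ι → ℝ)}
    (hf : HasFDerivAt f A x) (hx : f x = x) {η : ℝ} (hη : 0 < η) :
    ∃ (n : ℕ) (d : Fin n → ℂ) (P : (ι → ℂ) ≃L[ℂ] (Fin n → ℂ)),
      Set.range d = complexSpectrum (LinearMap.toMatrix' (A : (ι → ℝ) →ₗ[ℝ] (ι → ℝ))) ∧
      ∀ᶠ z in 𝓝 0, ‖P (complexify f x z) - d * P z‖ ≤ η * ‖P z‖ := by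
  set M := LinearMap.toMatrix' (A : (ι → ℝ) →ₗ[ℝ] (ι → ℝ)) with hM
  set F : Module.End ℂ (ι → ℂ) := Matrix.toLin' (M.map (fun a : ℝ => (a : ℂ))) with hF
  -- Half of `η` is reserved for the off-diagonal entries, `card ι` of them in each row; the other
  -- half is for the remainder.
  obtain ⟨δ, hδ, hδη⟩ : ∃ δ : ℝ, 0 < δ ∧ Fintype.card ι * δ ≤ η / 2 :=
    ⟨η / 2 / (Fintype.card ι + 1), by positivity, by
      rw [mul_div_assoc', div_le_iff₀ (by positivity)]; nlinarith⟩
  obtain ⟨b, d, B, h1, h2, h3, h4⟩ := Module.End.exists_basis_almost_diagonal (Fintype.card ι)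
    (ι → ℂ) (by simp) F δ hδ
  let P : (ι → ℂ) ≃L[ℂ] (Fin (Fintype.card ι) → ℂ) := b.equivFun.toContinuousLinearEquiv
  refine ⟨_, d, P, ?_, ?_⟩
  · ext z
    have : z ∈ complexSpectrum M ↔ F.HasEigenvalue z := by
      rw [Module.End.hasEigenvalue_iff_mem_spectrum, hF, Matrix.spectrum_toLin', complexSpectrum]
    rw [this]
    exact ⟨fun ⟨i, hi⟩ => hi ▸ h1 i, fun h => h2 z h⟩
  -- the linear part
  have hlin : ∀ z, ‖P (F z) - d * P z‖ ≤ η / 2 * ‖P z‖ := by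
    intro z
    have hz : P (F z) = B *ᵥ P z := by
      have h5 : F z = ∑ i, (B *ᵥ P z) i • b i := by
        conv_lhs => rw [← b.sum_equivFun z]
        simp only [map_sum, map_smul, h3, mulVec, dotProduct, Finset.smul_sum, Finset.sum_smul]
        rw [Finset.sum_comm]
        refine Finset.sum_congr rfl fun i _ => Finset.sum_congr rfl fun j _ => ?_
        rw [smul_smul, mul_comm]
        rfl
      have h6 : P (F z) = b.equivFun (F z) := rfl
      rw [h6, h5, ← Module.Basis.equivFun_symm_apply, LinearEquiv.apply_symm_apply]
    refine (pi_norm_le_iff_of_nonneg (by positivity)).2 fun i => ?_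
    have h5 : (P (F z) - d * P z) i = ∑ j, (B i j - Matrix.diagonal d i j) * P z j := by
      rw [hz]
      simp only [sub_mul, Finset.sum_sub_distrib, Pi.sub_apply, Pi.mul_apply]
      congr 1
      exact (Matrix.mulVec_diagonal d (P z) i).symm
    rw [h5]
    calc ‖∑ j, (B i j - Matrix.diagonal d i j) * P z j‖
        ≤ ∑ j : Fin (Fintype.card ι), δ * ‖P z‖ := by
          refine (norm_sum_le _ _).trans (Finset.sum_le_sum fun j _ => ?_)
          rw [norm_mul]
          exact mul_le_mul (h4 i j) (norm_le_pi_norm _ _) (norm_nonneg _) hδ.le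
      _ = Fintype.card ι * δ * ‖P z‖ := by simp [mul_assoc]
      _ ≤ _ := by gcongr
  -- the remainder
  have hAM : ∀ y : ι → ℝ, A y = M *ᵥ y := fun y => by
    rw [hM, ← Matrix.toLin'_apply, Matrix.toLin'_toMatrix']
    rfl
  have hFz : ∀ (z : ι → ℂ) (k : ι), F z k = ⟨A (fun k => (z k).re) k, A (fun k => (z k).im) k⟩ := by
    intro z k
    simp only [hF, hAM, Matrix.toLin'_apply, mulVec, dotProduct, Matrix.map_apply]
    apply Complex.ext <;> simp
  have hnre : ∀ z : ι → ℂ, ‖fun k => (z k).re‖ ≤ ‖z‖ := fun z =>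
    (pi_norm_le_iff_of_nonneg (norm_nonneg _)).2 fun k =>
      (Complex.abs_re_le_norm _).trans (norm_le_pi_norm z k)
  have hnim : ∀ z : ι → ℂ, ‖fun k => (z k).im‖ ≤ ‖z‖ := fun z =>
    (pi_norm_le_iff_of_nonneg (norm_nonneg _)).2 fun k =>
      (Complex.abs_im_le_norm _).trans (norm_le_pi_norm z k)
  -- `K` compensates for the distortion `‖P‖ ‖P⁻¹‖` of the coordinate change; the factor `2`
  -- accounts for the remainders of the real and the imaginary part.
  obtain ⟨K, hK, hKP⟩ : ∃ K : ℝ, 0 < K ∧ ∀ z w, ‖w‖ ≤ 2 * K * ‖z‖ → ‖P w‖ ≤ η / 2 * ‖P z‖ := by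
    set a := ‖(P : (ι → ℂ) →L[ℂ] (Fin (Fintype.card ι) → ℂ))‖
    set c := ‖(P.symm : (Fin (Fintype.card ι) → ℂ) →L[ℂ] (ι → ℂ))‖
    refine ⟨η / 4 / (a * c + 1), by positivity, fun z w h => ?_⟩
    have ha : ‖P w‖ ≤ a * ‖w‖ := (P : (ι → ℂ) →L[ℂ] (Fin (Fintype.card ι) → ℂ)).le_opNorm w
    have hc : ‖z‖ ≤ c * ‖P z‖ := by
      simpa using (P.symm : (Fin (Fintype.card ι) → ℂ) →L[ℂ] (ι → ℂ)).le_opNorm (P z)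
    calc ‖P w‖ ≤ a * (2 * (η / 4 / (a * c + 1)) * (c * ‖P z‖)) := by
          refine ha.trans (mul_le_mul_of_nonneg_left (h.trans ?_) (norm_nonneg _))
          gcongr
      _ = (a * c) / (a * c + 1) * (η / 2 * ‖P z‖) := by ring
      _ ≤ 1 * (η / 2 * ‖P z‖) := by
          gcongr
          exact (div_le_one (by positivity)).2 (by linarith)
      _ = _ := one_mul _
  have hrem : ∀ᶠ h in 𝓝 (0 : ι → ℝ), ‖f (x + h) - x - A h‖ ≤ K * ‖h‖ := by
    have := (hasFDerivAt_iff_isLittleO_nhds_zero.1 hf).def hK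
    simpa only [hx] using this
  have hre : Tendsto (fun z : ι → ℂ => fun k => (z k).re) (𝓝 0) (𝓝 0) :=
    Continuous.tendsto' (by fun_prop) _ _ (by ext; simp)
  have him : Tendsto (fun z : ι → ℂ => fun k => (z k).im) (𝓝 0) (𝓝 0) :=
    Continuous.tendsto' (by fun_prop) _ _ (by ext; simp)
  filter_upwards [hre.eventually hrem, him.eventually hrem] with z hz1 hz2
  have h5 : ‖complexify f x z - F z‖ ≤ 2 * K * ‖z‖ := by
    refine (pi_norm_le_iff_of_nonneg (by positivity)).2 fun k => ?_
    refine (Complex.norm_le_abs_re_add_abs_im _).trans ?_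
    rw [Pi.sub_apply, hFz]
    have h6 := (norm_le_pi_norm _ k).trans (hz1.trans (mul_le_mul_of_nonneg_left (hnre z) hK.le))
    have h7 := (norm_le_pi_norm _ k).trans (hz2.trans (mul_le_mul_of_nonneg_left (hnim z) hK.le))
    simp only [complexify, Complex.sub_re, Complex.sub_im]
    simp only [Pi.sub_apply, Real.norm_eq_abs] at h6 h7
    linarith
  have h6 := hKP z _ h5
  calc ‖P (complexify f x z) - d * P z‖
      = ‖P (complexify f x z - F z) + (P (F z) - d * P z)‖ := by rw [map_sub]; congr 1; abel
    _ ≤ η / 2 * ‖P z‖ + η / 2 * ‖P z‖ := (norm_add_le _ _).trans (add_le_add h6 (hlin z))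
    _ = _ := by ring

end Stability

section Stability

variable {ι : Type*} [Fintype ι] [DecidableEq ι]

lemma exists_forall_norm_lt {p : (ι → ℂ) → Prop} {n : ℕ} (P : (ι → ℂ) ≃L[ℂ] (Fin n → ℂ))
    (h : ∀ᶠ z in 𝓝 0, p z) : ∃ r > 0, ∀ z, ‖P z‖ < r → p z := by
  have h1 : ∀ᶠ w in 𝓝 (0 : Fin n → ℂ), p (P.symm w) :=
    (P.symm.continuous.tendsto' 0 0 (map_zero _)).eventually h
  obtain ⟨r, hr, hb⟩ := Metric.eventually_nhds_iff.1 h1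
  refine ⟨r, hr, fun z hz => ?_⟩
  simpa using hb (y := P z) (by simpa using hz)

/-- Linearized stability: a fixed point at which all eigenvalues of the derivative have modulus
less than one is asymptotically stable. -/
theorem isLocallyStable_of_spectrum {f : (ι → ℝ) → (ι → ℝ)} {x : ι → ℝ}
    {A : (ι → ℝ) →L[ℝ] (ι → ℝ)} (hf : HasFDerivAt f A x) (hx : f x = x)
    (hA : ∀ z ∈ complexSpectrum (LinearMap.toMatrix' (A : (ι → ℝ) →ₗ[ℝ] (ι → ℝ))), ‖z‖ < 1) :
    IsLocallyStable f x := by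
  obtain ⟨q, hq0, hq1, hq⟩ : ∃ q : ℝ, 0 ≤ q ∧ q < 1 ∧
      ∀ z ∈ complexSpectrum (LinearMap.toMatrix' (A : (ι → ℝ) →ₗ[ℝ] (ι → ℝ))), ‖z‖ ≤ q := by
    obtain ⟨n, d, P, hd, -⟩ := exists_almost_diagonal hf hx one_pos
    rw [← hd] at hA ⊢
    rcases isEmpty_or_nonempty (Fin n) with h | h
    · exact ⟨0, le_rfl, one_pos, by rintro _ ⟨i, -⟩; exact h.elim i⟩
    · obtain ⟨i, hi⟩ := Finite.exists_max fun i => ‖d i‖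
      exact ⟨‖d i‖, norm_nonneg _, hA _ ⟨i, rfl⟩, by rintro _ ⟨j, rfl⟩; exact hi j⟩
  -- With the error `(1 - q) / 2`, the map contracts in the coordinates `P` by the factor `ρ`,
  -- midway between the spectral bound `q` and `1`.
  obtain ⟨n, d, P, hd, hP⟩ := exists_almost_diagonal hf hx (half_pos (sub_pos.2 hq1))
  set ρ := q + (1 - q) / 2 with hρ
  have hρ0 : 0 ≤ ρ := by rw [hρ]; linarith
  have hρ1 : ρ < 1 := by rw [hρ]; linarith
  obtain ⟨r, hr, hstep⟩ := exists_forall_norm_lt P hP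
  have hstep' : ∀ z, ‖P z‖ < r → ‖P (complexify f x z)‖ ≤ ρ * ‖P z‖ := by
    intro z hz
    have h1 := hstep z hz
    have h2 : ‖d * P z‖ ≤ q * ‖P z‖ := by
      refine (pi_norm_le_iff_of_nonneg (by positivity)).2 fun i => ?_
      rw [Pi.mul_apply, norm_mul]
      exact mul_le_mul (hq _ (hd ▸ ⟨i, rfl⟩)) (norm_le_pi_norm _ _) (norm_nonneg _) hq0
    have h3 := norm_le_norm_add_norm_sub' (P (complexify f x z)) (d * P z)
    rw [hρ, add_mul]
    linarith
  have hiter : ∀ z, ‖P z‖ < r → ∀ k, ‖P ((complexify f x)^[k] z)‖ ≤ ρ ^ k * ‖P z‖ := by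
    intro z hz k
    induction k with
    | zero => simp
    | succ k ih =>
      have h1 : ρ ^ k * ‖P z‖ ≤ ‖P z‖ :=
        mul_le_of_le_one_left (norm_nonneg _) (pow_le_one₀ hρ0 hρ1.le)
      rw [Function.iterate_succ_apply']
      refine (hstep' _ ((ih.trans h1).trans_lt hz)).trans ?_
      rw [pow_succ', mul_assoc]
      exact mul_le_mul_of_nonneg_left ih hρ0
  let c := ‖(P.symm : (Fin n → ℂ) →L[ℂ] (ι → ℂ))‖
  let emb : (ι → ℝ) → (ι → ℂ) := fun y k => ((y k - x k : ℝ) : ℂ)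
  have hemb : Tendsto (fun y => ‖P (emb y)‖) (𝓝 x) (𝓝 0) :=
    Continuous.tendsto' (by fun_prop) _ _ (by
      rw [norm_eq_zero, show emb x = 0 by ext; simp [emb], map_zero])
  have hmain : ∀ y, ‖P (emb y)‖ < r → ∀ k, ‖f^[k] y - x‖ ≤ c * (ρ ^ k * ‖P (emb y)‖) := by
    intro y hy k
    have h1 := hiter _ hy k
    have h2 := (P.symm : (Fin n → ℂ) →L[ℂ] (ι → ℂ)).le_opNorm (P ((complexify f x)^[k] (emb y)))
    have h3 : ‖f^[k] y - x‖ ≤ ‖(complexify f x)^[k] (emb y)‖ := by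
      refine (pi_norm_le_iff_of_nonneg (norm_nonneg _)).2 fun i => ?_
      refine le_trans ?_ (norm_le_pi_norm _ i)
      refine le_trans (le_of_eq ?_) (Complex.abs_re_le_norm _)
      rw [complexify_iterate]
      have h4 : (x + fun k => (emb y k).re) = y := by ext k; simp [emb]
      simp only [complexify, h4, Pi.sub_apply, Real.norm_eq_abs]
    refine h3.trans (le_trans ?_ (mul_le_mul_of_nonneg_left h1 (norm_nonneg _)))
    simpa using h2
  refine ⟨fun U hU => ?_, ?_⟩
  · obtain ⟨ε, hε, hU⟩ := Metric.mem_nhds_iff.1 hU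
    have h5 : Tendsto (fun y => c * ‖P (emb y)‖) (𝓝 x) (𝓝 0) := by simpa using hemb.const_mul c
    filter_upwards [hemb.eventually_lt_const hr, h5.eventually_lt_const hε] with y hy1 hy2 k
    refine hU ?_
    rw [Metric.mem_ball, dist_eq_norm]
    refine (hmain y hy1 k).trans_lt (lt_of_le_of_lt ?_ hy2)
    refine mul_le_mul_of_nonneg_left ?_ (norm_nonneg _)
    exact mul_le_of_le_one_left (norm_nonneg _) (pow_le_one₀ hρ0 hρ1.le)
  · filter_upwards [hemb.eventually_lt_const hr] with y hy
    rw [tendsto_iff_norm_sub_tendsto_zero]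
    refine squeeze_zero (fun _ => norm_nonneg _) (hmain y hy) ?_
    simpa using ((tendsto_pow_atTop_nhds_zero_of_lt_one hρ0 hρ1).mul_const ‖P (emb y)‖).const_mul c

/-- A cone argument. If an expanding coordinate attains the sup norm of `w`, that coordinate has
size at least `(b - η) ‖w‖` in `w'`, while non-expanding ones have size at most `(1 + η) ‖w‖ ≤ (b -
η) ‖w‖`. The cone is therefore mapped to itself, with growth by `b - η`. -/
lemma norm_le_of_dominant {n : ℕ} {d w w' : Fin n → ℂ} {b η : ℝ}
    (hb : ∀ i, 1 < ‖d i‖ → b ≤ ‖d i‖) (hbη : 1 + 2 * η ≤ b)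
    (hw' : ‖w' - d * w‖ ≤ η * ‖w‖) (hw : ∃ i, 1 < ‖d i‖ ∧ ‖w‖ ≤ ‖w i‖) :
    (∃ i, 1 < ‖d i‖ ∧ ‖w'‖ ≤ ‖w' i‖) ∧ (b - η) * ‖w‖ ≤ ‖w'‖ := by
  obtain ⟨i, hi, hwi⟩ := hw
  have hcoord : ∀ j, ‖w' j - d j * w j‖ ≤ η * ‖w‖ := fun j =>
    (norm_le_pi_norm (w' - d * w) j).trans hw'
  have h1 : (b - η) * ‖w‖ ≤ ‖w' i‖ := by
    have h2 := norm_le_norm_add_norm_sub (w' i) (d i * w i)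
    have h3 : b * ‖w‖ ≤ ‖d i * w i‖ := by
      rw [norm_mul]
      exact mul_le_mul (hb i hi) hwi (norm_nonneg _) (norm_nonneg _)
    linarith [hcoord i]
  have h4 : ∀ j, ¬ 1 < ‖d j‖ → ‖w' j‖ ≤ ‖w' i‖ := by
    intro j hj
    have h2 := norm_le_norm_add_norm_sub' (w' j) (d j * w j)
    have h3 : ‖d j * w j‖ ≤ 1 * ‖w‖ := by
      rw [norm_mul]
      exact mul_le_mul (not_lt.1 hj) (norm_le_pi_norm _ _) (norm_nonneg _) zero_le_one
    nlinarith [hcoord j, norm_nonneg w]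
  obtain ⟨m, hm, hmax⟩ := Finset.exists_max_image (Finset.univ.filter fun j => 1 < ‖d j‖)
    (fun j => ‖w' j‖) ⟨i, by simpa using hi⟩
  refine ⟨⟨m, by simpa using hm, (pi_norm_le_iff_of_nonneg (norm_nonneg _)).2 fun j => ?_⟩,
    h1.trans (norm_le_pi_norm _ _)⟩
  by_cases hj : 1 < ‖d j‖
  · exact hmax j (by simpa using hj)
  · exact (h4 j hj).trans (hmax i (by simpa using hi))

/-- Linearized instability: at a stable fixed point no eigenvalue of the derivative has modulus
larger than one. -/
theorem IsLocallyStable.norm_le_one {f : (ι → ℝ) → (ι → ℝ)} {x : ι → ℝ}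
    {A : (ι → ℝ) →L[ℝ] (ι → ℝ)} (hf : HasFDerivAt f A x) (hx : f x = x)
    (hs : IsLocallyStable f x) :
    ∀ z ∈ complexSpectrum (LinearMap.toMatrix' (A : (ι → ℝ) →ₗ[ℝ] (ι → ℝ))), ‖z‖ ≤ 1 := by
  intro z hz
  by_contra! hz1
  obtain ⟨b, hb1, hb⟩ : ∃ b : ℝ, 1 < b ∧
      ∀ z ∈ complexSpectrum (LinearMap.toMatrix' (A : (ι → ℝ) →ₗ[ℝ] (ι → ℝ))),
        1 < ‖z‖ → b ≤ ‖z‖ := by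
    obtain ⟨n, d, P, hd, -⟩ := exists_almost_diagonal hf hx one_pos
    rw [← hd] at hz ⊢
    obtain ⟨i, rfl⟩ := hz
    obtain ⟨m, hm, hmin⟩ := Finset.exists_min_image (Finset.univ.filter fun j => 1 < ‖d j‖)
      (fun j => ‖d j‖) ⟨i, by simpa using hz1⟩
    refine ⟨‖d m‖, by simpa using hm, ?_⟩
    rintro _ ⟨j, rfl⟩ hj
    exact hmin j (by simpa using hj)
  obtain ⟨η, hη, hbη⟩ : ∃ η : ℝ, 0 < η ∧ 1 + 2 * η = b := ⟨(b - 1) / 2, by linarith, by ring⟩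
  obtain ⟨n, d, P, hd, hP⟩ := exists_almost_diagonal hf hx hη
  obtain ⟨r, hr, hstep⟩ := exists_forall_norm_lt P hP
  obtain ⟨i, hi⟩ : z ∈ Set.range d := hd ▸ hz
  -- stability of the complexified map
  have hstab : ∀ᶠ w in 𝓝 (0 : ι → ℂ), ∀ k, ‖P ((complexify f x)^[k] w)‖ < r := by
    have hU : ∀ᶠ w in 𝓝 (0 : ι → ℂ), ‖P w‖ < r := by
      have : Tendsto (fun w => ‖P w‖) (𝓝 0) (𝓝 0) :=
        Continuous.tendsto' (by fun_prop) _ _ (by simp)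
      exact this.eventually_lt_const hr
    obtain ⟨ε, hε, hball⟩ := Metric.eventually_nhds_iff.1 hU
    have h1 := hs.1 _ (Metric.ball_mem_nhds x (by positivity : 0 < ε / 4))
    have hre : Tendsto (fun w : ι → ℂ => x + fun k => (w k).re) (𝓝 0) (𝓝 x) :=
      Continuous.tendsto' (by fun_prop) _ _ (by ext; simp)
    have him : Tendsto (fun w : ι → ℂ => x + fun k => (w k).im) (𝓝 0) (𝓝 x) :=
      Continuous.tendsto' (by fun_prop) _ _ (by ext; simp)
    filter_upwards [hre.eventually h1, him.eventually h1] with w hw1 hw2 k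
    apply hball
    rw [dist_zero_right, complexify_iterate]
    refine lt_of_le_of_lt (b := ε / 2) ?_ (by linarith)
    refine (pi_norm_le_iff_of_nonneg (by positivity)).2 fun j => ?_
    refine (Complex.norm_le_abs_re_add_abs_im _).trans ?_
    have h2 := (norm_le_pi_norm _ j).trans (mem_ball_iff_norm.1 (hw1 k)).le
    have h3 := (norm_le_pi_norm _ j).trans (mem_ball_iff_norm.1 (hw2 k)).le
    simp only [Pi.sub_apply, Real.norm_eq_abs] at h2 h3
    simp only [complexify]
    linarith
  obtain ⟨s, hs0, hstab⟩ := exists_forall_norm_lt P hstab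
  -- A starting point in the cone, on the axis of an expanding eigenvalue. Its orbit grows
  -- geometrically as long as it stays in the ball of radius `r`, which stability says it never
  -- leaves.
  let w : ι → ℂ := P.symm (Pi.single i ((s / 2 : ℝ) : ℂ))
  have hPw : P w = Pi.single i ((s / 2 : ℝ) : ℂ) := P.apply_symm_apply _
  have hnw : ‖P w‖ = s / 2 := by
    rw [hPw, Pi.norm_single, Complex.norm_real, Real.norm_eq_abs, abs_of_pos (by positivity)]
  have hbd := hstab w (by rw [hnw]; linarith)
  have hgrow : ∀ k, (∃ j, 1 < ‖d j‖ ∧ ‖P ((complexify f x)^[k] w)‖ ≤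
      ‖P ((complexify f x)^[k] w) j‖) ∧
      (b - η) ^ k * (s / 2) ≤ ‖P ((complexify f x)^[k] w)‖ := by
    intro k
    induction k with
    | zero =>
      refine ⟨⟨i, hi ▸ hz1, ?_⟩, ?_⟩
      · rw [Function.iterate_zero_apply, hnw, hPw, Pi.single_eq_same, Complex.norm_real,
          Real.norm_eq_abs, abs_of_pos (by positivity)]
      · rw [Function.iterate_zero_apply, hnw, pow_zero, one_mul]
    | succ k ih =>
      rw [Function.iterate_succ_apply']
      have h1 := norm_le_of_dominant (fun j hj => hb _ (hd ▸ ⟨j, rfl⟩) hj) hbη.le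
        (hstep _ (hbd k)) ih.1
      refine ⟨h1.1, le_trans ?_ h1.2⟩
      rw [pow_succ', mul_assoc]
      exact mul_le_mul_of_nonneg_left ih.2 (by linarith)
  have htop : Tendsto (fun k : ℕ => (b - η) ^ k * (s / 2)) atTop atTop :=
    (tendsto_pow_atTop_atTop_of_one_lt (by linarith)).atTop_mul_const (by positivity)
  obtain ⟨k, hk⟩ := (htop.eventually_ge_atTop r).exists
  linarith [hbd k, (hgrow k).2]

/-! ### Spectra under damping. -/

lemma mem_complexSpectrum_iff {M : Matrix ι ι ℝ} {z : ℂ} : z ∈ complexSpectrum M ↔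
    ∃ w : ι → ℂ, w ≠ 0 ∧ M.map (fun a : ℝ => (a : ℂ)) *ᵥ w = z • w := by
  rw [complexSpectrum, ← Matrix.spectrum_toLin', ← Module.End.hasEigenvalue_iff_mem_spectrum]
  constructor
  · intro h
    obtain ⟨w, hw⟩ := h.exists_hasEigenvector
    exact ⟨w, hw.2, by simpa using hw.apply_eq_smul⟩
  · rintro ⟨w, hw, h⟩
    exact Module.End.hasEigenvalue_of_hasEigenvector
      ⟨Module.End.mem_eigenspace_iff.2 (by simpa using h), hw⟩

/-- The spectrum of the damped derivative. -/
lemma mem_complexSpectrum_damped {M : Matrix ι ι ℝ} {ε : ℝ} (hε : ε < 1) {z : ℂ} :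
    z ∈ complexSpectrum ((1 - ε) • M + ε • (1 : Matrix ι ι ℝ)) ↔
      ∃ y ∈ complexSpectrum M, z = (1 - ε) * y + ε := by
  have h1 : ((1 : ℂ) - ε) ≠ 0 := by
    rw [sub_ne_zero]; exact_mod_cast hε.ne'
  have h2 : ∀ w : ι → ℂ, ((1 - ε) • M + ε • (1 : Matrix ι ι ℝ)).map (fun a : ℝ => (a : ℂ)) *ᵥ w =
      (1 - ε : ℂ) • (M.map (fun a : ℝ => (a : ℂ)) *ᵥ w) + (ε : ℂ) • w := by
    intro w
    have : ((1 - ε) • M + ε • (1 : Matrix ι ι ℝ)).map (fun a : ℝ => (a : ℂ)) =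
        (1 - ε : ℂ) • M.map (fun a : ℝ => (a : ℂ)) + (ε : ℂ) • (1 : Matrix ι ι ℂ) := by
      ext i j
      by_cases h : i = j <;> simp [h]
    rw [this, add_mulVec, smul_mulVec, smul_mulVec, one_mulVec]
  simp only [mem_complexSpectrum_iff, h2]
  constructor
  · rintro ⟨w, hw, h⟩
    refine ⟨(z - ε) / (1 - ε), ⟨w, hw, ?_⟩, by field_simp; ring⟩
    rw [← eq_sub_iff_add_eq, ← sub_smul] at h
    rw [div_eq_inv_mul, mul_smul, ← h, inv_smul_smul₀ h1]
  · rintro ⟨y, ⟨w, hw, h⟩, rfl⟩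
    exact ⟨w, hw, by rw [h]; module⟩

lemma finite_complexSpectrum (M : Matrix ι ι ℝ) : (complexSpectrum M).Finite := by
  rw [complexSpectrum, ← Matrix.spectrum_toLin']
  exact Module.End.finite_spectrum _

/-- If all eigenvalues have real part less than one, sufficiently strong damping moves them into
the unit disc. -/
lemma exists_damping {S : Set ℂ} (hS : S.Finite) (h : ∀ z ∈ S, z.re < 1) :
    ∃ ε : ℝ, 0 ≤ ε ∧ ε < 1 ∧ ∀ z ∈ S, ‖(1 - ε : ℂ) * z + ε‖ < 1 := by
  have h1 : ∀ z ∈ S, ∀ᶠ t : ℝ in 𝓝[>] 0, ‖(t : ℂ) * z + (1 - t)‖ < 1 := by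
    intro z hz
    have hre := h z hz
    -- With `t = 1 - ε` one has `|t z + 1 - t|² = 1 + t (2 (Re z - 1) + t |z - 1|²)`, and the
    -- bracket is negative for small `t`.
    have h2 : Tendsto (fun t : ℝ => 2 * (z.re - 1) + t * Complex.normSq (z - 1)) (𝓝[>] 0)
        (𝓝 (2 * (z.re - 1) + 0 * Complex.normSq (z - 1))) :=
      (Continuous.tendsto (by fun_prop) 0).mono_left nhdsWithin_le_nhds
    filter_upwards [h2.eventually_lt_const (u := 0) (by linarith), self_mem_nhdsWithin] with t ht ht0
    have ht0' : 0 < t := ht0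
    rw [← abs_norm, ← sq_lt_one_iff_abs_lt_one, ← Complex.normSq_eq_norm_sq]
    simp only [Complex.normSq_apply, Complex.sub_re, Complex.sub_im, Complex.add_re, Complex.add_im,
      Complex.mul_re, Complex.mul_im, Complex.ofReal_re, Complex.ofReal_im, Complex.one_re,
      Complex.one_im] at ht ⊢
    nlinarith [mul_neg_of_pos_of_neg ht0' ht]
  have h3 : ∀ᶠ t : ℝ in 𝓝[>] 0, ∀ z ∈ S, ‖(t : ℂ) * z + (1 - t)‖ < 1 :=
    (Set.Finite.eventually_all hS).2 h1
  have h4 : ∀ᶠ t : ℝ in 𝓝[>] 0, t ≤ 1 :=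
    (eventually_le_nhds one_pos).filter_mono nhdsWithin_le_nhds
  obtain ⟨t, ht, ht1, ht0⟩ := (h3.and (h4.and self_mem_nhdsWithin)).exists
  refine ⟨1 - t, by linarith, by linarith [show 0 < t from ht0], fun z hz => ?_⟩
  simpa using ht z hz

end Stability

/-! ### Fixed points of LBP and the derivative of the update. -/

lemma Finset.sum_subtype_mem {V M : Type*} [Fintype V] [DecidableEq V] [AddCommMonoid M]
    (s : Finset V) (F : {i // i ∈ s} → M) :
    ∑ i, F i = ∑ i : V, if h : i ∈ s then F ⟨i, h⟩ else 0 := by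
  refine Fintype.sum_of_injective Subtype.val Subtype.val_injective _ _ ?_ ?_
  · intro i hi
    rw [dif_neg]
    simpa using hi
  · intro i
    simp

namespace StatFamily

variable {V : Type*} {H : FactorGraph V} (I : StatFamily H)

lemma measurable_φFull (α : H.Factor) : Measurable (I.φFull α) := by
  refine measurable_pi_lambda _ fun a => ?_
  rcases a with a | p
  · exact (measurable_pi_apply a).comp (I.measurable_φF α)
  · exact (measurable_pi_apply p.2).comp ((I.measurable_φ p.1).comp (measurable_pi_apply p.1))

instance neZero_νF (α : H.Factor) : NeZero (I.νF α) := by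
  refine ⟨fun h => ?_⟩
  have h1 : I.νF α Set.univ = 0 := by simp [h]
  rw [νF, Measure.pi_univ, Finset.prod_eq_zero_iff] at h1
  obtain ⟨i, -, hi⟩ := h1
  exact (NeZero.ne (I.ν i)) (Measure.measure_univ_eq_zero.1 hi)

lemma measurable_eval (α : H.Factor) (i : {i : V // i ∈ α.1}) :
    Measurable fun x : I.XF α => x i := measurable_pi_apply i

lemma mean_factor_of_marginal {α : H.Factor} {i : {i : V // i ∈ α.1}} {θ : I.FactorIndex α → ℝ}
    {θ' : Fin (I.r i) → ℝ}
    (h : (ExpFam.law (I.νF α) (I.φFull α) θ).map (fun x => x i) = ExpFam.law (I.ν i) (I.φ i) θ')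
    (k : Fin (I.r i)) :
    ExpFam.mean (I.νF α) (I.φFull α) θ (Sum.inr ⟨i, k⟩) = ExpFam.mean (I.ν i) (I.φ i) θ' k := by
  rw [ExpFam.mean, ExpFam.mean, ← h, integral_map (I.measurable_eval α i).aemeasurable]
  · rfl
  · exact ((measurable_pi_apply k).comp (I.measurable_φ i)).aestronglyMeasurable

lemma cov_factor_of_marginal {α : H.Factor} {i : {i : V // i ∈ α.1}} {θ : I.FactorIndex α → ℝ}
    {θ' : Fin (I.r i) → ℝ}
    (h : (ExpFam.law (I.νF α) (I.φFull α) θ).map (fun x => x i) = ExpFam.law (I.ν i) (I.φ i) θ')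
    (k l : Fin (I.r i)) :
    ExpFam.cov (I.νF α) (I.φFull α) θ (Sum.inr ⟨i, k⟩) (Sum.inr ⟨i, l⟩) =
      ExpFam.cov (I.ν i) (I.φ i) θ' k l := by
  rw [ExpFam.cov, ExpFam.cov, of_apply, of_apply, ← h, ProbabilityTheory.covariance_map]
  · rfl
  · exact ((measurable_pi_apply k).comp (I.measurable_φ i)).aestronglyMeasurable
  · exact ((measurable_pi_apply l).comp (I.measurable_φ i)).aestronglyMeasurable
  · exact (I.measurable_eval α i).aemeasurable

variable [DecidableEq V]

lemma cavity_add (μ : I.Msg) (α : H.Factor) (i : {i : V // i ∈ α.1}) (k : Fin (I.r i)) :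
    I.cavity μ i α k + μ ⟨⟨α, i⟩, k⟩ = I.nodeParam μ i k := by
  unfold cavity nodeParam
  rw [← Finset.add_sum_erase _ _ (Finset.mem_univ α), ← Finset.add_sum_erase _ _ (Finset.mem_univ α)]
  rw [dif_neg (by simp), zero_add, dif_pos i.2, add_comm]
  congr 1
  refine Finset.sum_congr rfl fun β hβ => ?_
  have hne := (Finset.mem_erase.1 hβ).1
  by_cases h : i.1 ∈ β.1
  · rw [dif_pos ⟨h, hne⟩, dif_pos h]
  · rw [dif_neg (fun h' => h h'.1), dif_neg h]

section FixedPoint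

variable {I} {θbar : I.Model} {μ : I.Msg}

/-- The marginals of the beliefs `b_α` at a fixed point are the beliefs `b_i`. -/
lemma IsFixedPoint.map_law (hI : I.IsInferenceFamily) (hμ : I.IsFixedPoint θbar μ) (α : H.Factor)
    (i : {i : V // i ∈ α.1}) :
    (ExpFam.law (I.νF α) (I.φFull α) (I.factorParam θbar μ α)).map (fun x => x i) =
      ExpFam.law (I.ν i) (I.φ i) (I.nodeParam μ i) := by
  obtain ⟨θ', hθ', h⟩ := hI.marginal α i _ (hμ.mem_factor α)
  -- The fixed-point equation says that `Λ_i⁻¹` of the factor's mean is `μ_{α → i}` plus the cavity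
  -- sum, that is, `nodeParam`.
  have h1 : I.nodeParam μ i = θ' := by
    rw [← ExpFam.invMean_mean (I.measurable_φ i) (hI.isUnit_cov i) hθ']
    ext k
    rw [← I.cavity_add μ α i k]
    have h2 := congrFun hμ.fixed ⟨⟨α, i⟩, k⟩
    simp only [lbpUpdate] at h2
    rw [← h2, add_sub_cancel]
    congr 2
    ext l
    exact I.mean_factor_of_marginal h l
  rw [h, h1]

lemma IsFixedPoint.mean_factor (hI : I.IsInferenceFamily) (hμ : I.IsFixedPoint θbar μ)
    (α : H.Factor) (i : {i : V // i ∈ α.1}) (k : Fin (I.r i)) :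
    ExpFam.mean (I.νF α) (I.φFull α) (I.factorParam θbar μ α) (Sum.inr ⟨i, k⟩) =
      ExpFam.mean (I.ν i) (I.φ i) (I.nodeParam μ i) k :=
  I.mean_factor_of_marginal (hμ.map_law hI α i) k

/-- The diagonal blocks of the factor covariances are the vertex covariances. This produces both the
cancellation in the derivative of the update and the positivity of the Hessian without correlations.
-/
lemma IsFixedPoint.cov_factor (hI : I.IsInferenceFamily) (hμ : I.IsFixedPoint θbar μ)
    (α : H.Factor) (i : {i : V // i ∈ α.1}) (k l : Fin (I.r i)) :
    ExpFam.cov (I.νF α) (I.φFull α) (I.factorParam θbar μ α) (Sum.inr ⟨i, k⟩) (Sum.inr ⟨i, l⟩) =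
      ExpFam.cov (I.ν i) (I.φ i) (I.nodeParam μ i) k l :=
  I.cov_factor_of_marginal (hμ.map_law hI α i) k l

lemma IsFixedPoint.beliefs_mem (hI : I.IsInferenceFamily) (hμ : I.IsFixedPoint θbar μ) :
    I.beliefs θbar μ ∈ I.localPolytope :=
  ⟨fun α => ⟨_, hμ.mem_factor α, rfl⟩, fun i => ⟨_, hμ.mem_node i, rfl⟩, fun α i k =>
    hμ.mean_factor hI α i k⟩

end FixedPoint

/-- A cavity sum as a linear form in the messages. -/
noncomputable def cavityForm (i : V) (α : H.Factor) (k : Fin (I.r i)) : I.Msg →L[ℝ] ℝ :=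
  ∑ β : H.Factor, if h : i ∈ β.1 ∧ β ≠ α then
    ContinuousLinearMap.proj (R := ℝ) (φ := fun _ : I.MsgIndex => ℝ) ⟨⟨β, ⟨i, h.1⟩⟩, k⟩ else 0

lemma cavityForm_apply (i : V) (α : H.Factor) (k : Fin (I.r i)) (μ : I.Msg) :
    I.cavityForm i α k μ = I.cavity μ i α k := by
  rw [cavityForm, _root_.sum_apply, cavity]
  refine Finset.sum_congr rfl fun β _ => ?_
  split_ifs <;> rfl

lemma hasFDerivAt_factorParam (θbar : I.Model) (μ : I.Msg) (α : H.Factor) :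
    HasFDerivAt (fun μ => I.factorParam θbar μ α)
      (ContinuousLinearMap.pi (Sum.elim (0 : Fin (I.s α) → I.Msg →L[ℝ] ℝ)
        fun p => I.cavityForm p.1 α p.2)) μ := by
  rw [hasFDerivAt_pi]
  rintro (a | p)
  · exact hasFDerivAt_const _ _
  · have h := ((I.cavityForm p.1 α p.2).hasFDerivAt (x := μ)).const_add (θbar α (Sum.inr p))
    simp only [cavityForm_apply] at h
    exact h

variable [Fintype V]

/-- Grouping the columns `(β → j)` by `j` shows that `M(u)` sees the messages only through their
cavity sums; the condition `β ≠ α` is the one in `cavity`. -/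
lemma edgeMatrix_mulVec
    (u : ∀ (α : H.Factor) (i j : {i : V // i ∈ α.1}), Matrix (Fin (I.r j)) (Fin (I.r i)) ℝ)
    (m : I.Msg) (α : H.Factor) (i : {i : V // i ∈ α.1}) (k : Fin (I.r i)) :
    (I.edgeMatrix u *ᵥ m) ⟨⟨α, i⟩, k⟩ =
      ∑ j : {j : V // j ∈ α.1}, if j = i then 0 else ∑ l, u α j i k l * I.cavity m j α l := by
  rw [mulVec, dotProduct, Fintype.sum_sigma, Fintype.sum_sigma]
  rw [Finset.sum_subtype_mem α.1]
  refine (Finset.sum_congr rfl fun β _ => Finset.sum_subtype_mem β.1 _).trans ?_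
  rw [Finset.sum_comm]
  refine Finset.sum_congr rfl fun j _ => ?_
  by_cases hj : j ∈ α.1
  · rw [dif_pos hj]
    by_cases hji : (⟨j, hj⟩ : {j : V // j ∈ α.1}) = i
    · rw [if_pos hji]
      refine Finset.sum_eq_zero fun β _ => ?_
      split_ifs with hβ
      · refine Finset.sum_eq_zero fun l _ => ?_
        simp only [edgeMatrix, of_apply]
        rw [dif_neg, zero_mul]
        rintro ⟨-, h, -⟩
        exact h (congrArg Subtype.val hji)
      · rfl
    · rw [if_neg hji]
      simp only [cavity, Finset.mul_sum]
      rw [Finset.sum_comm (γ := Fin _)]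
      refine Finset.sum_congr rfl fun β _ => ?_
      by_cases hβ : j ∈ β.1
      · rw [dif_pos hβ]
        refine Finset.sum_congr rfl fun l _ => ?_
        simp only [edgeMatrix, of_apply]
        by_cases hβα : β = α
        · rw [dif_neg (fun h => h.2.2 hβα), dif_neg (fun h => h.2 hβα), zero_mul, mul_zero]
        · rw [dif_pos ⟨hj, fun h => hji (Subtype.ext h), hβα⟩, dif_pos ⟨hβ, hβα⟩]
      · rw [dif_neg hβ]
        refine (Finset.sum_eq_zero fun l _ => ?_).symm
        rw [dif_neg (fun h => hβ h.1), mul_zero]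
  · rw [dif_neg hj]
    refine Finset.sum_eq_zero fun β _ => ?_
    split_ifs with hβ
    · refine Finset.sum_eq_zero fun l _ => ?_
      simp only [edgeMatrix, of_apply]
      rw [dif_neg (fun h => hj h.1), zero_mul]
    · rfl

/-- The derivative of the LBP update at a fixed point. -/
theorem IsFixedPoint.hasFDerivAt_lbpUpdate {I : StatFamily H} {θbar : I.Model} {μ : I.Msg}
    (hI : I.IsInferenceFamily) (hμ : I.IsFixedPoint θbar μ) :
    HasFDerivAt (I.lbpUpdate θbar)
      (Matrix.mulVecLin (I.edgeMatrix (I.edgeWeight θbar μ))).toContinuousLinearMap μ := by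
  rw [hasFDerivAt_pi']
  rintro ⟨⟨α, i⟩, k⟩
  set C := ExpFam.cov (I.νF α) (I.φFull α) (I.factorParam θbar μ α) with hC
  set W := ExpFam.cov (I.ν i) (I.φ i) (I.nodeParam μ i) with hW
  have h1 := (ExpFam.hasStrictFDerivAt_mean (I.measurable_φFull α) (hμ.mem_factor α)).hasFDerivAt
  have h2 := h1.comp μ (I.hasFDerivAt_factorParam θbar μ α)
  have h3 : HasFDerivAt (fun μ (k : Fin (I.r i)) => ExpFam.mean (I.νF α) (I.φFull α)
      (I.factorParam θbar μ α) (Sum.inr ⟨i, k⟩)) _ μ :=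
    hasFDerivAt_pi.2 fun k => hasFDerivAt_pi'.1 h2 (Sum.inr ⟨i, k⟩)
  have hval : (fun k => ExpFam.mean (I.νF α) (I.φFull α)
      (I.factorParam θbar μ α) (Sum.inr ⟨i, k⟩)) = ExpFam.mean (I.ν i) (I.φ i) (I.nodeParam μ i) :=
    funext fun k => hμ.mean_factor hI α i k
  have h4 := (ExpFam.exists_localInverse (I.measurable_φ i) (hI.isUnit_cov i)
    (hμ.mem_node i)).1.hasFDerivAt
  rw [← hval] at h4
  have h5 := h4.comp μ h3
  have h6 := (hasFDerivAt_pi'.1 h5 k).sub ((I.cavityForm i α k).hasFDerivAt (x := μ))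
  refine (h6.congr_fderiv ?_).congr_of_eventuallyEq (Eventually.of_forall fun m => ?_)
  · refine ContinuousLinearMap.ext fun m => ?_
    have hdet : IsUnit W.det := (Matrix.isUnit_iff_isUnit_det _).1 (hI.isUnit_cov i _ (hμ.mem_node i))
    have h7 : ∀ l, (C *ᵥ (fun a => (Sum.elim 0 (fun p => I.cavityForm p.1 α p.2) :
        I.FactorIndex α → I.Msg →L[ℝ] ℝ) a m)) (Sum.inr ⟨i, l⟩) =
        ∑ j : {j : V // j ∈ α.1}, (C.submatrix (fun k => Sum.inr ⟨i, k⟩)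
          (fun l => Sum.inr ⟨j, l⟩) *ᵥ I.cavity m j α) l := by
      intro l
      rw [mulVec, dotProduct, Fintype.sum_sum_type, Fintype.sum_sigma]
      simp [cavityForm_apply, mulVec, dotProduct]
    have h8 : (W⁻¹ *ᵥ (fun l => ∑ j : {j : V // j ∈ α.1}, (C.submatrix (fun k => Sum.inr ⟨i, k⟩)
          (fun l => Sum.inr ⟨j, l⟩) *ᵥ I.cavity m j α) l)) =
        ∑ j : {j : V // j ∈ α.1}, I.edgeWeight θbar μ α j i *ᵥ I.cavity m j α := by
      rw [show (fun l => ∑ j : {j : V // j ∈ α.1}, (C.submatrix (fun k => Sum.inr ⟨i, k⟩)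
          (fun l => Sum.inr ⟨j, l⟩) *ᵥ I.cavity m j α) l) =
          ∑ j : {j : V // j ∈ α.1}, (C.submatrix (fun k => Sum.inr ⟨i, k⟩)
          (fun l => Sum.inr ⟨j, l⟩) *ᵥ I.cavity m j α) by ext l; simp, Matrix.mulVec_sum]
      refine Finset.sum_congr rfl fun j _ => ?_
      rw [mulVec_mulVec]
      rfl
    -- The term `j = i` of the chain rule is exactly the cavity sum that the update subtracts.
    have h9 : I.edgeWeight θbar μ α i i = 1 := by
      rw [edgeWeight, ← hW, ← hC]
      have : C.submatrix (fun k => Sum.inr ⟨i, k⟩) (fun l => Sum.inr ⟨i, l⟩) = W := by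
        ext k l
        exact hμ.cov_factor hI α i k l
      rw [this, Matrix.nonsing_inv_mul _ hdet]
    have h10 : (W⁻¹ *ᵥ (fun l => (C *ᵥ (fun a => (Sum.elim 0 (fun p => I.cavityForm p.1 α p.2) :
        I.FactorIndex α → I.Msg →L[ℝ] ℝ) a m)) (Sum.inr ⟨i, l⟩))) k - I.cavity m i α k =
        (I.edgeMatrix (I.edgeWeight θbar μ) *ᵥ m) ⟨⟨α, i⟩, k⟩ := by
      rw [funext h7, h8, edgeMatrix_mulVec, Finset.sum_apply,
        ← Finset.add_sum_erase _ _ (Finset.mem_univ i),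
        ← Finset.add_sum_erase _ (fun j => if j = i then (0 : ℝ) else _) (Finset.mem_univ i),
        h9, one_mulVec, add_sub_cancel_left, if_pos rfl, zero_add]
      refine Finset.sum_congr rfl fun j hj => ?_
      rw [if_neg (Finset.mem_erase.1 hj).1]
      rfl
    refine Eq.trans ?_ h10
    rw [← cavityForm_apply]
    rfl
  · rw [Pi.sub_apply, cavityForm_apply]
    rfl

lemma IsFixedPoint.jacobian_lbpUpdate {I : StatFamily H} {θbar : I.Model} {μ : I.Msg}
    (hI : I.IsInferenceFamily) (hμ : I.IsFixedPoint θbar μ) :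
    jacobian (I.lbpUpdate θbar) μ = I.edgeMatrix (I.edgeWeight θbar μ) := by
  rw [jacobian, (hμ.hasFDerivAt_lbpUpdate hI).fderiv]
  exact LinearMap.toMatrix'_toLin' _

end StatFamily

/-! ### Paths of quadratic forms and second-order minimality. -/

/-- Multiply the entries outside the diagonal blocks of a matrix by `t`. -/
def Matrix.scaleOffDiag {ι κ : Type*} [DecidableEq κ] (blk : ι → κ) (C : Matrix ι ι ℝ) (t : ℝ) :
    Matrix ι ι ℝ :=
  Matrix.of fun a b => if blk a = blk b then C a b else t * C a b

lemma Matrix.scaleOffDiag_one {ι κ : Type*} [DecidableEq κ] (blk : ι → κ) (C : Matrix ι ι ℝ) :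
    C.scaleOffDiag blk 1 = C := by
  ext a b
  simp [scaleOffDiag]

/-- The scaled matrix is the convex combination `(1 - t) D + t C`, where `D` is the block diagonal
part of `C`. The form of `D` sums that of `C` over the restrictions `y c` of the vector to single
blocks. -/
lemma Matrix.PosDef.scaleOffDiag {ι κ : Type*} [Fintype ι] [Fintype κ] [DecidableEq κ]
    (blk : ι → κ) {C : Matrix ι ι ℝ} (hC : C.PosDef) {t : ℝ} (ht : t ∈ Set.Icc (0 : ℝ) 1) :
    (C.scaleOffDiag blk t).PosDef := by
  refine Matrix.PosDef.of_dotProduct_mulVec_pos ?_ fun x hx => ?_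
  · ext a b
    have h1 : C b a = C a b := by simpa using hC.1.apply a b
    simp [Matrix.scaleOffDiag, h1, eq_comm]
  · let y : κ → ι → ℝ := fun c a => if blk a = c then x a else 0
    have h1 : star x ⬝ᵥ C.scaleOffDiag blk t *ᵥ x =
        (1 - t) * ∑ c, y c ⬝ᵥ C *ᵥ y c + t * (x ⬝ᵥ C *ᵥ x) := by
      have h2 : ∑ c, y c ⬝ᵥ C *ᵥ y c = ∑ a, ∑ b, if blk a = blk b then x a * (C a b * x b) else 0 := by
        simp only [dotProduct, mulVec, Finset.mul_sum, y]
        rw [Finset.sum_comm]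
        refine Finset.sum_congr rfl fun a _ => ?_
        rw [Finset.sum_comm]
        refine Finset.sum_congr rfl fun b _ => ?_
        simp only [ite_mul, mul_ite, zero_mul, mul_zero]
        by_cases h : blk a = blk b
        · simp [h]
        · simp [h]
      rw [h2]
      simp only [star_trivial, dotProduct, mulVec, Matrix.scaleOffDiag, of_apply, Finset.mul_sum]
      rw [← Finset.sum_add_distrib]
      refine Finset.sum_congr rfl fun a _ => ?_
      rw [← Finset.sum_add_distrib]
      refine Finset.sum_congr rfl fun b _ => ?_
      split_ifs <;> ring
    have h3 : 0 < x ⬝ᵥ C *ᵥ x := by simpa using hC.dotProduct_mulVec_pos hx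
    have h4 : 0 < ∑ c, y c ⬝ᵥ C *ᵥ y c := by
      obtain ⟨a, ha⟩ := Function.ne_iff.1 hx
      refine Finset.sum_pos' (fun c _ => by
        simpa using hC.posSemidef.dotProduct_mulVec_nonneg (y c)) ⟨blk a, Finset.mem_univ _, ?_⟩
      have : y (blk a) ≠ 0 := fun h => ha (by simpa [y] using congrFun h a)
      simpa using hC.dotProduct_mulVec_pos this
    rw [h1]
    obtain ⟨ht0, ht1⟩ := ht
    rcases ht0.eq_or_lt with h | h
    · rw [← h]; linarith
    · have := mul_pos h h3
      have := mul_nonneg (sub_nonneg.2 ht1) h4.le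
      linarith

lemma Matrix.continuousOn_inv_scaleOffDiag {ι κ : Type*} [Fintype ι] [DecidableEq ι] [Fintype κ]
    [DecidableEq κ] (blk : ι → κ) {C : Matrix ι ι ℝ} (hC : C.PosDef) :
    ContinuousOn (fun t => (C.scaleOffDiag blk t)⁻¹) (Set.Icc 0 1) := by
  have h1 : Continuous fun t => C.scaleOffDiag blk t := by
    refine continuous_matrix fun a b => ?_
    simp only [scaleOffDiag, of_apply]
    split_ifs <;> fun_prop
  simp only [Matrix.inv_def, Ring.inverse_eq_inv']
  refine ContinuousOn.smul (ContinuousOn.inv₀ h1.matrix_det.continuousOn fun t ht => ?_)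
    h1.matrix_adjugate.continuousOn
  exact (hC.scaleOffDiag blk ht).det_pos.ne'

lemma nonneg_quadratic_imp {a b : ℝ} (h : ∀ s : ℝ, 0 ≤ 2 * s * b + s ^ 2 * a) : b = 0 := by
  by_contra hb
  -- At this `s` the expression equals `(b / (|a| + 1))² (a - 2 (|a| + 1))`, negative unless `b =
  -- 0`.
  have h1 := h (-b / (|a| + 1))
  have h2 : 0 < |a| + 1 := by positivity
  have h3 : 2 * (-b / (|a| + 1)) * b + (-b / (|a| + 1)) ^ 2 * a =
      (b / (|a| + 1)) ^ 2 * (a - 2 * (|a| + 1)) := by field_simp; ring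
  rw [h3] at h1
  have h4 : 0 < (b / (|a| + 1)) ^ 2 := by positivity
  have h5 : a - 2 * (|a| + 1) < 0 := by linarith [le_abs_self a, abs_nonneg a]
  linarith [mul_neg_of_pos_of_neg h4 h5]

/-- A continuous path of nondegenerate quadratic forms that starts with a positive form ends with
a positive form. -/
lemma exists_pos_le_of_nondegenerate_path {E : Type*} [NormedAddCommGroup E] [NormedSpace ℝ E]
    [FiniteDimensional ℝ E] (W : Submodule ℝ E) {Q : ℝ → E → ℝ} {B : ℝ → E → E → ℝ}
    (hcont : ContinuousOn (fun p : ℝ × E => Q p.1 p.2) (Set.Icc 0 1 ×ˢ Set.univ))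
    (hexp : ∀ t ∈ Set.Icc (0 : ℝ) 1, ∀ v w s,
      Q t (v + s • w) = Q t v + 2 * s * B t v w + s ^ 2 * Q t w)
    (hhom : ∀ t (s : ℝ) w, Q t (s • w) = s ^ 2 * Q t w)
    (h0 : ∀ w ∈ W, 0 ≤ Q 0 w)
    (hnd : ∀ t ∈ Set.Icc (0 : ℝ) 1, ∀ v ∈ W, (∀ w ∈ W, B t v w = 0) → v = 0) :
    ∃ c > 0, ∀ w ∈ W, c * ‖w‖ ^ 2 ≤ Q 1 w := by
  have hK : IsCompact (Metric.sphere (0 : E) 1 ∩ W) :=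
    have : ProperSpace E := FiniteDimensional.proper ℝ E
    (isCompact_sphere 0 1).inter_right W.closed_of_finiteDimensional
  have hpos : ∀ t ∈ Set.Icc (0 : ℝ) 1, ∀ v ∈ Metric.sphere (0 : E) 1 ∩ W, 0 < Q t v := by
    by_contra! hcon
    obtain ⟨t₀, ht₀, v₀, hv₀, hle₀⟩ := hcon
    let S : Set (ℝ × E) := (Set.Icc 0 1 ×ˢ (Metric.sphere (0 : E) 1 ∩ W)) ∩
      {p | Q p.1 p.2 ≤ 0}
    have hS : IsCompact S := by
      have hcK := (isCompact_Icc (a := (0 : ℝ)) (b := 1)).prod hK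
      refine hcK.of_isClosed_subset ?_ Set.inter_subset_left
      exact (hcont.mono (Set.prod_mono_right (Set.subset_univ _))).preimage_isClosed_of_isClosed
        hcK.isClosed isClosed_Iic
    -- The earliest time at which positivity fails, with a unit vector witnessing it. At that time
    -- the form is still nonnegative on `W`: by hypothesis if `t = 0`, otherwise as a limit from
    -- earlier times.
    obtain ⟨⟨t, v⟩, ⟨⟨ht, hv⟩, hle⟩, hmin⟩ := hS.exists_isMinOn ⟨(t₀, v₀), ⟨ht₀, hv₀⟩, hle₀⟩
      continuous_fst.continuousOn
    have hbefore : ∀ s ∈ Set.Ico 0 t, ∀ w ∈ W, 0 ≤ Q s w := by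
      intro s hs w hw
      have hs1 : s ∈ Set.Icc (0 : ℝ) 1 := ⟨hs.1, hs.2.le.trans ht.2⟩
      by_cases hw0 : w = 0
      · have := hhom s 0 w
        rw [zero_smul] at this
        rw [hw0, this]; simp
      have hn : ‖w‖ ≠ 0 := norm_ne_zero_iff.2 hw0
      by_contra! hneg
      have h1 : Q s (‖w‖⁻¹ • w) ≤ 0 := by
        rw [hhom]
        exact mul_nonpos_of_nonneg_of_nonpos (by positivity) hneg.le
      have h2 := hmin (a := (s, ‖w‖⁻¹ • w)) ⟨⟨hs1, by simp [norm_smul, hn], W.smul_mem _ hw⟩, h1⟩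
      exact absurd hs.2 (not_lt.2 h2)
    have hat : ∀ w ∈ W, 0 ≤ Q t w := by
      intro w hw
      rcases ht.1.eq_or_lt with h | h
      · exact h ▸ h0 w hw
      have hc : ContinuousOn (fun s => Q s w) (Set.Icc 0 1) :=
        hcont.comp (f := fun s : ℝ => (s, w)) (by fun_prop) fun s hs => ⟨hs, Set.mem_univ _⟩
      have hc' : Tendsto (fun s => Q s w) (𝓝[Set.Ico 0 t] t) (𝓝 (Q t w)) :=
        (hc t ht).mono_left (nhdsWithin_mono _ fun s hs => ⟨hs.1, hs.2.le.trans ht.2⟩)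
      have : (𝓝[Set.Ico 0 t] t).NeBot := by
        rw [← mem_closure_iff_nhdsWithin_neBot, closure_Ico h.ne]
        exact ⟨h.le, le_rfl⟩
      exact ge_of_tendsto hc' (eventually_mem_nhdsWithin.mono fun s hs => hbefore s hs w hw)
    have hv0 : Q t v = 0 := le_antisymm hle (hat v hv.2)
    -- A null vector of a nonnegative form lies in its radical.
    have hzero : v = 0 := hnd t ht v hv.2 fun w hw => nonneg_quadratic_imp (a := Q t w) fun s => by
      have h1 := hat _ (W.add_mem hv.2 (W.smul_mem s hw))
      rwa [hexp t ht, hv0, zero_add] at h1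
    have := hv.1
    rw [hzero] at this
    simp at this
  have h1 : (1 : ℝ) ∈ Set.Icc (0 : ℝ) 1 := by simp
  have hc : ContinuousOn (fun w => Q 1 w) (Metric.sphere (0 : E) 1 ∩ W) :=
    hcont.comp (f := fun w : E => ((1 : ℝ), w)) (by fun_prop) fun s hs => ⟨h1, Set.mem_univ _⟩
  obtain ⟨c, hc0, hcle⟩ : ∃ c > 0, ∀ v ∈ Metric.sphere (0 : E) 1 ∩ W, c ≤ Q 1 v := by
    rcases (Metric.sphere (0 : E) 1 ∩ W).eq_empty_or_nonempty with h | h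
    · exact ⟨1, one_pos, by simp [h]⟩
    · obtain ⟨v, hv, hmin⟩ := hK.exists_isMinOn h hc
      exact ⟨Q 1 v, hpos 1 h1 v hv, fun w hw => hmin hw⟩
  refine ⟨c, hc0, fun w hw => ?_⟩
  by_cases hw0 : w = 0
  · have := hhom 1 0 w
    rw [zero_smul] at this
    rw [hw0, this]; simp
  have hn : ‖w‖ ≠ 0 := norm_ne_zero_iff.2 hw0
  have h2 := hcle (‖w‖⁻¹ • w) ⟨by simp [norm_smul, hn], W.smul_mem _ hw⟩
  rw [hhom, inv_pow, ← div_eq_inv_mul, le_div_iff₀ (by positivity)] at h2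
  exact h2

/-- A second-order criterion for local minima on a set of displacements from `x` along which the
gradient vanishes at `x`. -/
lemma isLocalMinOn_of_gradient {E : Type*} [NormedAddCommGroup E] [NormedSpace ℝ E] {F : E → ℝ}
    {g : E → E →L[ℝ] ℝ} {Q : E → ℝ} {x : E} {L : Set E} {c : ℝ} (hc : 0 < c)
    (hF : ∀ᶠ y in 𝓝 x, HasFDerivAt F (g y) y) (hg : ∀ y ∈ L, g x (y - x) = 0)
    (hQ : ∀ y ∈ L, c * ‖y - x‖ ^ 2 ≤ Q (y - x)) (hhom : ∀ (s : ℝ) w, Q (s • w) = s ^ 2 * Q w)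
    (ho : (fun h => g (x + h) h - g x h - Q h) =o[𝓝 0] fun h => ‖h‖ ^ 2) :
    IsLocalMinOn F L x := by
  obtain ⟨r₁, hr₁, h1⟩ := Metric.eventually_nhds_iff.1 hF
  obtain ⟨r₂, hr₂, h2⟩ := Metric.eventually_nhds_iff.1 (ho.def hc)
  refine mem_nhdsWithin_iff_exists_mem_nhds_inter.2
    ⟨Metric.ball x (min r₁ r₂), Metric.ball_mem_nhds _ (by positivity), ?_⟩
  rintro y ⟨hy, hyL⟩
  obtain ⟨w, rfl⟩ : ∃ w, y = x + w := ⟨y - x, by simp⟩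
  have hg' := hg _ hyL
  have hQ' := hQ _ hyL
  rw [add_sub_cancel_left] at hg' hQ'
  rw [Metric.mem_ball, dist_eq_norm, add_sub_cancel_left, lt_min_iff] at hy
  have hsw : ∀ s ∈ Set.Icc (0 : ℝ) 1, ‖s • w‖ ≤ ‖w‖ := fun s hs => by
    rw [norm_smul, Real.norm_eq_abs, abs_of_nonneg hs.1]
    exact mul_le_of_le_one_left (norm_nonneg _) hs.2
  have hd : ∀ s ∈ Set.Icc (0 : ℝ) 1,
      HasDerivAt (fun s : ℝ => F (x + s • w)) (g (x + s • w) w) s := by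
    intro s hs
    have h3 : HasDerivAt (fun s : ℝ => x + s • w) w s := by
      simpa using ((hasDerivAt_id s).smul_const w).const_add x
    refine (h1 ?_).comp_hasDerivAt s h3
    rw [dist_eq_norm, add_sub_cancel_left]
    exact (hsw s hs).trans_lt hy.1
  -- The segment may leave `L`, but `F` is differentiable on a full ball. There `s g(x + s w) w =
  -- g(x + s w)(s w) ≥ s² (Q w - c ‖w‖²) ≥ 0`, so no second derivative of `F` away from `x` is
  -- needed.
  have hmono : MonotoneOn (fun s : ℝ => F (x + s • w)) (Set.Icc 0 1) := by
    refine monotoneOn_of_deriv_nonneg (convex_Icc 0 1)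
      (fun s hs => (hd s hs).continuousAt.continuousWithinAt)
      (fun s hs => (hd s (interior_subset hs)).differentiableAt.differentiableWithinAt)
      fun s hs => ?_
    have hs' := interior_subset hs
    rw [interior_Icc] at hs
    rw [(hd s hs').deriv]
    have h3 := h2 (y := s • w) (by rw [dist_zero_right]; exact (hsw s hs').trans_lt hy.2)
    rw [map_smul, map_smul, hg', hhom, Real.norm_eq_abs, Real.norm_eq_abs,
      abs_of_nonneg (by positivity : 0 ≤ ‖s • w‖ ^ 2), norm_smul, Real.norm_eq_abs,
      abs_of_pos hs.1] at h3
    have h4 := (abs_le.1 h3).1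
    simp only [smul_eq_mul, mul_zero, sub_zero] at h4
    have h5 : 0 ≤ s ^ 2 * (Q w - c * ‖w‖ ^ 2) := mul_nonneg (sq_nonneg _) (by linarith)
    have h6 : 0 ≤ s * g (x + s • w) w := by nlinarith
    exact nonneg_of_mul_nonneg_right h6 hs.1
  have := hmono (by simp) (by simp) zero_le_one
  simpa using this

lemma inv_mulVec_dotProduct_add_smul {ι : Type*} [Fintype ι] [DecidableEq ι] {M : Matrix ι ι ℝ}
    (hM : M.IsHermitian) (x y : ι → ℝ) (s : ℝ) : M⁻¹ *ᵥ (x + s • y) ⬝ᵥ (x + s • y) =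
      M⁻¹ *ᵥ x ⬝ᵥ x + 2 * s * (M⁻¹ *ᵥ x ⬝ᵥ y) + s ^ 2 * (M⁻¹ *ᵥ y ⬝ᵥ y) := by
  have h1 : (M⁻¹)ᵀ = M⁻¹ := by
    have := hM.inv
    rwa [Matrix.IsHermitian, Matrix.conjTranspose_eq_transpose_of_trivial] at this
  have h2 : M⁻¹ *ᵥ y ⬝ᵥ x = M⁻¹ *ᵥ x ⬝ᵥ y := by
    rw [dotProduct_comm, dotProduct_mulVec, ← mulVec_transpose, h1]
  simp only [mulVec_add, mulVec_smul, add_dotProduct, dotProduct_add, smul_dotProduct,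
    dotProduct_smul, smul_eq_mul, h2]
  ring

/-! ### The Hessian of the Bethe free energy on consistent directions. -/

namespace StatFamily

variable {V : Type*} {H : FactorGraph V} (I : StatFamily H)

/-- The directions of the affine hull of the local polytope. -/
def tangentSpace : Submodule ℝ I.Pseudo where
  carrier := {w | ∀ (α : H.Factor) (i : {i : V // i ∈ α.1}) (k : Fin (I.r i)),
    w.1 α (Sum.inr ⟨i, k⟩) = w.2 i k}
  zero_mem' := fun _ _ _ => rfl
  add_mem' := fun {v w} hv hw α i k => by
    simp [hv α i k, hw α i k]
  smul_mem' := fun c w hw α i k => by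
    simp [hw α i k]

lemma sub_mem_tangentSpace {η η' : I.Pseudo} (h : η ∈ I.localPolytope) (h' : η' ∈ I.localPolytope) :
    η - η' ∈ I.tangentSpace := fun α i k => by
  simp [h.2.2 α i k, h'.2.2 α i k]

/-- The block of the full statistic of a factor to which a component belongs. -/
def block (α : H.Factor) : I.FactorIndex α → Option {i : V // i ∈ α.1} :=
  Sum.elim (fun _ => none) (fun p => some p.1)

variable [DecidableEq V]

lemma sum_factor_mem_const (i : V) (c : ℝ) :
    (∑ α : H.Factor, if i ∈ α.1 then c else 0) = H.degree i * c := by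
  rw [← Finset.sum_filter, Finset.sum_const, nsmul_eq_mul, FactorGraph.degree]
  congr 2
  refine Finset.card_bij (fun α _ => α.1) (fun α hα => ?_) (fun α _ β _ h => Subtype.ext h)
    fun α hα => ?_
  · simpa using hα
  · rw [Finset.mem_filter] at hα
    exact ⟨⟨α, hα.1⟩, by simpa using hα.2, rfl⟩

variable [Fintype V]

/-- Pairing of gradients with tangent vectors. -/
lemma sum_dotProduct_of_mem_tangentSpace {w : I.Pseudo} (hw : w ∈ I.tangentSpace)
    (z : ∀ α : H.Factor, I.FactorIndex α → ℝ) (n : ∀ i : V, Fin (I.r i) → ℝ) :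
    ∑ α, z α ⬝ᵥ w.1 α + ∑ i, (1 - (H.degree i : ℝ)) * (n i ⬝ᵥ w.2 i) =
      ∑ α, ∑ a, z α (Sum.inl a) * w.1 α (Sum.inl a) +
      ∑ i, ∑ k, ((∑ α : H.Factor, if h : i ∈ α.1 then z α (Sum.inr ⟨⟨i, h⟩, k⟩) else 0) +
        (1 - (H.degree i : ℝ)) * n i k) * w.2 i k := by
  have h1 : ∀ α : H.Factor, z α ⬝ᵥ w.1 α = ∑ a, z α (Sum.inl a) * w.1 α (Sum.inl a) +
      ∑ i : V, ∑ k, (if h : i ∈ α.1 then z α (Sum.inr ⟨⟨i, h⟩, k⟩) else 0) * w.2 i k := by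
    intro α
    rw [dotProduct, Fintype.sum_sum_type, Fintype.sum_sigma]
    congr 1
    rw [Finset.sum_subtype_mem α.1]
    refine Finset.sum_congr rfl fun i _ => ?_
    split_ifs with h
    · exact Finset.sum_congr rfl fun k _ => by rw [hw α ⟨i, h⟩ k]
    · simp
  simp only [h1]
  rw [Finset.sum_add_distrib, add_assoc, Finset.sum_comm (s := (Finset.univ : Finset H.Factor)) (t := (Finset.univ : Finset V)), ← Finset.sum_add_distrib]
  congr 1
  refine Finset.sum_congr rfl fun i _ => ?_
  rw [Finset.sum_comm, dotProduct, Finset.mul_sum, ← Finset.sum_add_distrib]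
  refine Finset.sum_congr rfl fun k _ => ?_
  rw [← Finset.sum_mul]
  ring

section Hessian

variable (C : ∀ α : H.Factor, Matrix (I.FactorIndex α) (I.FactorIndex α) ℝ)
  (W : ∀ i : V, Matrix (Fin (I.r i)) (Fin (I.r i)) ℝ)

/-- The Hessian of the Bethe free energy, for the covariance matrices `C α` and `W i`, when the
correlations between the statistics of different blocks are multiplied by `t`. -/
noncomputable def hessian (t : ℝ) (v w : I.Pseudo) : ℝ :=
  ∑ α, ((C α).scaleOffDiag (I.block α) t)⁻¹ *ᵥ v.1 α ⬝ᵥ w.1 α +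
    ∑ i, (1 - (H.degree i : ℝ)) * ((W i)⁻¹ *ᵥ v.2 i ⬝ᵥ w.2 i)

lemma hessian_add_smul_self {t : ℝ} (hC : ∀ α, ((C α).scaleOffDiag (I.block α) t).IsHermitian)
    (hW : ∀ i, (W i).IsHermitian) (v w : I.Pseudo) (s : ℝ) :
    I.hessian C W t (v + s • w) (v + s • w) =
      I.hessian C W t v v + 2 * s * I.hessian C W t v w + s ^ 2 * I.hessian C W t w w := by
  have e1 : ∀ α, (v + s • w).1 α = v.1 α + s • w.1 α := fun _ => rfl
  have e2 : ∀ i, (v + s • w).2 i = v.2 i + s • w.2 i := fun _ => rfl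
  simp only [hessian, e1, e2]
  rw [Finset.sum_congr rfl fun α _ => inv_mulVec_dotProduct_add_smul (hC α) (v.1 α) (w.1 α) s,
    Finset.sum_congr rfl fun i _ => congrArg _ (inv_mulVec_dotProduct_add_smul (hW i) (v.2 i) (w.2 i) s)]
  simp only [mul_add, Finset.sum_add_distrib, Finset.mul_sum]
  have e3 : ∑ i, (1 - (H.degree i : ℝ)) * (2 * s * ((W i)⁻¹ *ᵥ v.2 i ⬝ᵥ w.2 i)) =
      ∑ i, 2 * s * ((1 - (H.degree i : ℝ)) * ((W i)⁻¹ *ᵥ v.2 i ⬝ᵥ w.2 i)) :=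
    Finset.sum_congr rfl fun i _ => by ring
  have e4 : ∑ i, (1 - (H.degree i : ℝ)) * (s ^ 2 * ((W i)⁻¹ *ᵥ w.2 i ⬝ᵥ w.2 i)) =
      ∑ i, s ^ 2 * ((1 - (H.degree i : ℝ)) * ((W i)⁻¹ *ᵥ w.2 i ⬝ᵥ w.2 i)) :=
    Finset.sum_congr rfl fun i _ => by ring
  rw [e3, e4]
  ring

lemma hessian_smul_self (t s : ℝ) (w : I.Pseudo) :
    I.hessian C W t (s • w) (s • w) = s ^ 2 * I.hessian C W t w w := by
  have e1 : ∀ α, (s • w).1 α = s • w.1 α := fun _ => rfl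
  have e2 : ∀ i, (s • w).2 i = s • w.2 i := fun _ => rfl
  simp only [hessian, e1, e2, mulVec_smul, smul_dotProduct, dotProduct_smul, smul_eq_mul, mul_add,
    Finset.mul_sum]
  congr 1
  · exact Finset.sum_congr rfl fun _ _ => by ring
  · exact Finset.sum_congr rfl fun _ _ => by ring

lemma continuousOn_hessian (hC : ∀ α, (C α).PosDef) :
    ContinuousOn (fun p : ℝ × I.Pseudo => I.hessian C W p.1 p.2 p.2) (Set.Icc 0 1 ×ˢ Set.univ) := by
  have h1 : ∀ α, Continuous fun p : Set.Icc (0 : ℝ) 1 ×ˢ (Set.univ : Set I.Pseudo) =>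
      ((C α).scaleOffDiag (I.block α) p.1.1)⁻¹ := fun α =>
    (continuousOn_iff_continuous_domRestrict.1
      (Matrix.continuousOn_inv_scaleOffDiag (I.block α) (hC α))).comp
      (f := fun p : Set.Icc (0 : ℝ) 1 ×ˢ (Set.univ : Set I.Pseudo) => (⟨p.1.1, p.2.1⟩ : Set.Icc (0 : ℝ) 1))
      (by fun_prop)
  rw [continuousOn_iff_continuous_domRestrict]
  unfold hessian Set.domRestrict
  refine Continuous.add (continuous_finsetSum _ fun α _ => ?_)
    (continuous_finsetSum _ fun i _ => Continuous.mul continuous_const ?_)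
  · exact ((h1 α).matrix_mulVec (by fun_prop)).dotProduct (by fun_prop)
  · exact (continuous_const.matrix_mulVec (by fun_prop)).dotProduct (by fun_prop)

variable {C W}

/-- The alternative in `hy` removes the coupling to the additional statistic in both applications:
for null directions its component of `y` vanishes, and at `t = 0` the coupling itself does. -/
lemma scaleOffDiag_mulVec_inr {t : ℝ} (hCW : ∀ (α : H.Factor) (i : {i : V // i ∈ α.1})
      (k l : Fin (I.r i)), C α (Sum.inr ⟨i, k⟩) (Sum.inr ⟨i, l⟩) = W i k l)
    {α : H.Factor} {y : I.FactorIndex α → ℝ} (hy : ∀ a, y (Sum.inl a) = 0 ∨ t = 0)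
    (i : {i : V // i ∈ α.1}) :
    (fun k => ((C α).scaleOffDiag (I.block α) t *ᵥ y) (Sum.inr ⟨i, k⟩)) =
      W i *ᵥ (fun k => y (Sum.inr ⟨i, k⟩)) + t • ∑ j : {j : V // j ∈ α.1}, if j = i then 0 else
        (C α).submatrix (fun k => Sum.inr ⟨i, k⟩) (fun l => Sum.inr ⟨j, l⟩) *ᵥ
          (fun l => y (Sum.inr ⟨j, l⟩)) := by
  ext k
  rw [mulVec, dotProduct, Fintype.sum_sum_type, Fintype.sum_sigma, Finset.sum_eq_zero, zero_add]
  · rw [← Finset.add_sum_erase _ _ (Finset.mem_univ i), Pi.add_apply, Pi.smul_apply,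
      Finset.sum_apply, ← Finset.add_sum_erase (a := i) _ (fun j => (ite (j = i) _ _ : _ → ℝ) k)
        (Finset.mem_univ i), if_pos rfl, Pi.zero_apply, zero_add]
    congr 1
    · refine Finset.sum_congr rfl fun l _ => ?_
      simp [scaleOffDiag, block, hCW]
    · rw [smul_eq_mul, Finset.mul_sum]
      refine Finset.sum_congr rfl fun j hj => ?_
      have hji := (Finset.mem_erase.1 hj).1
      rw [if_neg hji, mulVec, dotProduct, Finset.mul_sum]
      refine Finset.sum_congr rfl fun l _ => ?_
      simp [scaleOffDiag, block, Ne.symm hji, mul_assoc]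
  · intro a _
    rcases hy a with h | h <;> simp [scaleOffDiag, block, h]

/-- If the Hessian is degenerate on the tangent space, `t M(u)` has eigenvalue one. -/
lemma eq_zero_of_hessian_eq_zero {t : ℝ} (ht : t ∈ Set.Icc (0 : ℝ) 1) (hC : ∀ α, (C α).PosDef)
    (hW : ∀ i, (W i).PosDef) (hCW : ∀ (α : H.Factor) (i : {i : V // i ∈ α.1})
      (k l : Fin (I.r i)), C α (Sum.inr ⟨i, k⟩) (Sum.inr ⟨i, l⟩) = W i k l)
    (hM : ∀ m : I.Msg, t • (I.edgeMatrix (fun α i j => (W j)⁻¹ * (C α).submatrix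
      (fun k => Sum.inr ⟨j, k⟩) (fun l => Sum.inr ⟨i, l⟩)) *ᵥ m) = m → m = 0)
    {v : I.Pseudo} (hv : v ∈ I.tangentSpace) (h0 : ∀ w ∈ I.tangentSpace, I.hessian C W t v w = 0) :
    v = 0 := by
  have hCt := fun α => (hC α).scaleOffDiag (I.block α) ht
  have hdC := fun α => (Matrix.isUnit_iff_isUnit_det _).1 (hCt α).isUnit
  have hdW := fun i => (Matrix.isUnit_iff_isUnit_det _).1 (hW i).isUnit
  set y : ∀ α : H.Factor, I.FactorIndex α → ℝ := fun α =>
    ((C α).scaleOffDiag (I.block α) t)⁻¹ *ᵥ v.1 α with hy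
  have hCy : ∀ α, (C α).scaleOffDiag (I.block α) t *ᵥ y α = v.1 α := fun α => by
    rw [hy, mulVec_mulVec, Matrix.mul_nonsing_inv _ (hdC α), one_mulVec]
  set n : ∀ i : V, Fin (I.r i) → ℝ := fun i => (W i)⁻¹ *ᵥ v.2 i with hn
  have hWn : ∀ i, W i *ᵥ n i = v.2 i := fun i => by
    rw [hn, mulVec_mulVec, Matrix.mul_nonsing_inv _ (hdW i), one_mulVec]
  let R : ∀ i : V, Fin (I.r i) → ℝ := fun i k =>
    (∑ α : H.Factor, if h : i ∈ α.1 then y α (Sum.inr ⟨⟨i, h⟩, k⟩) else 0) +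
        (1 - (H.degree i : ℝ)) * n i k
  -- Testing against the tangent vector formed by the coefficients of the pairing makes the pairing
  -- a sum of squares, so all the coefficients vanish.
  let w : I.Pseudo := (fun α => Sum.elim (fun a => y α (Sum.inl a)) (fun p => R p.1 p.2), R)
  have hw : w ∈ I.tangentSpace := fun α i k => rfl
  have hsum : ∑ α, ∑ a, y α (Sum.inl a) * y α (Sum.inl a) + ∑ i, ∑ k, R i k * R i k = 0 :=
    (I.sum_dotProduct_of_mem_tangentSpace hw y n).symm.trans (h0 w hw)
  have hs1 : 0 ≤ ∑ α, ∑ a, y α (Sum.inl a) * y α (Sum.inl a) :=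
    Finset.sum_nonneg fun α _ => Finset.sum_nonneg fun a _ => mul_self_nonneg (y α (Sum.inl a))
  have hs2 : 0 ≤ ∑ i, ∑ k, R i k * R i k :=
    Finset.sum_nonneg fun i _ => Finset.sum_nonneg fun k _ => mul_self_nonneg (R i k)
  have hs1' : ∑ α, ∑ a, y α (Sum.inl a) * y α (Sum.inl a) = 0 :=
    le_antisymm (by linarith) hs1
  have hs2' : ∑ i, ∑ k, R i k * R i k = 0 := le_antisymm (by linarith) hs2
  have hyl : ∀ α a, y α (Sum.inl a) = 0 := by
    intro α a
    rw [Finset.sum_eq_zero_iff_of_nonneg fun α _ => Finset.sum_nonneg fun a _ =>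
      mul_self_nonneg (y α (Sum.inl a))] at hs1'
    have h1 := hs1' α (Finset.mem_univ _)
    rw [Finset.sum_eq_zero_iff_of_nonneg fun a _ => mul_self_nonneg (y α (Sum.inl a))] at h1
    exact mul_self_eq_zero.1 (h1 a (Finset.mem_univ _))
  have hR : ∀ i k, R i k = 0 := by
    intro i k
    rw [Finset.sum_eq_zero_iff_of_nonneg fun i _ => Finset.sum_nonneg fun k _ =>
      mul_self_nonneg (R i k)] at hs2'
    have h1 := hs2' i (Finset.mem_univ _)
    rw [Finset.sum_eq_zero_iff_of_nonneg fun k _ => mul_self_nonneg (R i k)] at h1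
    exact mul_self_eq_zero.1 (h1 k (Finset.mem_univ _))
  -- Chosen so that, thanks to `R = 0`, the total of the messages into `i` is `n i` and the cavity
  -- sums are the components of `y`. The `i`-rows of `C_t y = v` then read `m = t M(u) m`.
  let m : I.Msg := fun p => n p.1.2 p.2 - y p.1.1 (Sum.inr ⟨p.1.2, p.2⟩)
  have hnode : ∀ i, I.nodeParam m i = n i := by
    intro i
    ext k
    have h1 : I.nodeParam m i k = (∑ α : H.Factor, if i ∈ α.1 then n i k else 0) -
        ∑ α : H.Factor, if h : i ∈ α.1 then y α (Sum.inr ⟨⟨i, h⟩, k⟩) else 0 := by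
      rw [nodeParam, ← Finset.sum_sub_distrib]
      refine Finset.sum_congr rfl fun α _ => ?_
      split_ifs
      · rfl
      · simp
    have h2 := hR i k
    simp only [R] at h2
    rw [h1, sum_factor_mem_const]
    linarith
  have hcav : ∀ (α : H.Factor) (j : {j : V // j ∈ α.1}),
      I.cavity m j α = fun l => y α (Sum.inr ⟨j, l⟩) := by
    intro α j
    ext l
    have h1 := I.cavity_add m α j l
    rw [hnode] at h1
    simp only [m] at h1
    linarith
  have hm : m = 0 := by
    refine hM m ?_
    ext ⟨⟨α, i⟩, k⟩
    rw [Pi.smul_apply, edgeMatrix_mulVec]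
    have h1 := I.scaleOffDiag_mulVec_inr hCW (t := t) (y := y α) (fun a => Or.inl (hyl α a)) i
    rw [hCy] at h1
    have h2 : (fun k => v.1 α (Sum.inr ⟨i, k⟩)) = v.2 i := funext fun k => hv α i k
    rw [h2] at h1
    have h3 := congrArg (fun x => (W i)⁻¹ *ᵥ x) h1
    simp only [mulVec_add, mulVec_smul, mulVec_sum] at h3
    rw [mulVec_mulVec, Matrix.nonsing_inv_mul _ (hdW i), one_mulVec] at h3
    have h4 := congrFun h3 k
    have h5 : n i k = y α (Sum.inr ⟨i, k⟩) + t • ∑ j : {j : V // j ∈ α.1}, if j = i then 0 else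
        ∑ l, ((W i)⁻¹ * (C α).submatrix (fun k => Sum.inr ⟨i, k⟩) (fun l => Sum.inr ⟨j, l⟩)) k l *
          I.cavity m j α l := by
      refine h4.trans ?_
      rw [Pi.add_apply, Pi.smul_apply, Finset.sum_apply]
      congr 2
      refine Finset.sum_congr rfl fun j _ => ?_
      split_ifs with hji
      · simp
      · rw [mulVec_mulVec, hcav]
        rfl
    simp only [m]
    rw [h5, add_sub_cancel_left]
  have hn0 : ∀ i, n i = 0 := fun i => by
    rw [← hnode, hm]
    ext k
    simp [nodeParam]
  have hy0 : ∀ α, y α = 0 := by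
    intro α
    ext (a | p)
    · exact hyl α a
    · have h1 := congrFun hm ⟨⟨α, p.1⟩, p.2⟩
      simp only [m, hn0, Pi.zero_apply, zero_sub, neg_eq_zero] at h1
      exact h1
  refine Prod.ext (funext fun α => ?_) (funext fun i => ?_)
  · rw [← hCy, hy0, mulVec_zero]; rfl
  · rw [← hWn, hn0, mulVec_zero]; rfl

/-- Without correlations, each factor containing `i` contributes `⟨v_i, W_i⁻¹ v_i⟩`. These `d_i`
contributions and the weight `1 - d_i` add up to one, and the blocks of the additional statistics
contribute nonnegative terms. -/
lemma hessian_zero_nonneg (hC : ∀ α, (C α).PosDef)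
    (hW : ∀ i, (W i).PosDef) (hCW : ∀ (α : H.Factor) (i : {i : V // i ∈ α.1})
      (k l : Fin (I.r i)), C α (Sum.inr ⟨i, k⟩) (Sum.inr ⟨i, l⟩) = W i k l)
    {v : I.Pseudo} (hv : v ∈ I.tangentSpace) : 0 ≤ I.hessian C W 0 v v := by
  have h0 : (0 : ℝ) ∈ Set.Icc (0 : ℝ) 1 := by simp
  have hCt := fun α => (hC α).scaleOffDiag (I.block α) h0
  have hdC := fun α => (Matrix.isUnit_iff_isUnit_det _).1 (hCt α).isUnit
  have hdW := fun i => (Matrix.isUnit_iff_isUnit_det _).1 (hW i).isUnit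
  set y : ∀ α : H.Factor, I.FactorIndex α → ℝ := fun α =>
    ((C α).scaleOffDiag (I.block α) 0)⁻¹ *ᵥ v.1 α with hy
  have hCy : ∀ α, (C α).scaleOffDiag (I.block α) 0 *ᵥ y α = v.1 α := fun α => by
    rw [hy, mulVec_mulVec, Matrix.mul_nonsing_inv _ (hdC α), one_mulVec]
  have hyr : ∀ (α : H.Factor) (i : {i : V // i ∈ α.1}) (k : Fin (I.r i)),
      y α (Sum.inr ⟨i, k⟩) = ((W i)⁻¹ *ᵥ v.2 i) k := by
    intro α i k
    have h1 := I.scaleOffDiag_mulVec_inr hCW (t := 0) (y := y α) (fun a => Or.inr rfl) i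
    rw [hCy, zero_smul, add_zero, show (fun k => v.1 α (Sum.inr ⟨i, k⟩)) = v.2 i from
      funext fun k => hv α i k] at h1
    rw [h1, mulVec_mulVec, Matrix.nonsing_inv_mul _ (hdW i), one_mulVec]
  rw [hessian, I.sum_dotProduct_of_mem_tangentSpace hv y (fun i => (W i)⁻¹ *ᵥ v.2 i)]
  refine add_nonneg (Finset.sum_nonneg fun α _ => ?_) (Finset.sum_nonneg fun i _ => ?_)
  -- Extension by zero identifies this term with a value of the positive form of the block diagonal
  -- matrix.
  · let z : I.FactorIndex α → ℝ := Sum.elim (fun a => y α (Sum.inl a)) 0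
    have h1 : z ⬝ᵥ (C α).scaleOffDiag (I.block α) 0 *ᵥ z =
        ∑ a, y α (Sum.inl a) * v.1 α (Sum.inl a) := by
      rw [dotProduct, Fintype.sum_sum_type]
      simp only [z, Sum.elim_inl, Sum.elim_inr, Pi.zero_apply, zero_mul, Finset.sum_const_zero,
        add_zero]
      refine Finset.sum_congr rfl fun a _ => ?_
      rw [← hCy]
      congr 1
      rw [mulVec, mulVec, dotProduct, dotProduct, Fintype.sum_sum_type, Fintype.sum_sum_type]
      simp [scaleOffDiag, block]
    rw [← h1]
    simpa using (hCt α).posSemidef.dotProduct_mulVec_nonneg z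
  · have h1 : ∀ k, (∑ α : H.Factor, if h : i ∈ α.1 then y α (Sum.inr ⟨⟨i, h⟩, k⟩) else 0) =
        H.degree i * ((W i)⁻¹ *ᵥ v.2 i) k := by
      intro k
      rw [← sum_factor_mem_const]
      refine Finset.sum_congr rfl fun α _ => ?_
      split_ifs with h
      · exact hyr α ⟨i, h⟩ k
      · rfl
    have h2 : ∑ k, ((∑ α : H.Factor, if h : i ∈ α.1 then y α (Sum.inr ⟨⟨i, h⟩, k⟩) else 0) +
        (1 - (H.degree i : ℝ)) * ((W i)⁻¹ *ᵥ v.2 i) k) * v.2 i k = v.2 i ⬝ᵥ (W i)⁻¹ *ᵥ v.2 i := by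
      rw [dotProduct]
      exact Finset.sum_congr rfl fun k _ => by rw [h1]; ring
    rw [h2]
    simpa using (hW i).inv.posSemidef.dotProduct_mulVec_nonneg (v.2 i)

end Hessian

end StatFamily

/-! ### The Bethe gradient and the local minimum. -/

lemma complexSpectrum_of_mulVec_eq {ι : Type*} [Fintype ι] [DecidableEq ι] {M : Matrix ι ι ℝ}
    {c : ℝ} {m : ι → ℝ} (hm : m ≠ 0) (h : M *ᵥ m = c • m) : (c : ℂ) ∈ complexSpectrum M := by
  refine mem_complexSpectrum_iff.2 ⟨fun k => (m k : ℂ), fun h0 => hm ?_, ?_⟩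
  · ext k
    simpa using congrFun h0 k
  · ext k
    have := congrFun h k
    simp only [mulVec, dotProduct, Pi.smul_apply, smul_eq_mul, Matrix.map_apply] at this ⊢
    exact_mod_cast this

/-- The second-order remainder of a map that is differentiable at a point, paired with the
increment. -/
lemma isLittleO_dotProduct_remainder {ι E : Type*} [Fintype ι] [NormedAddCommGroup E]
    [NormedSpace ℝ E] (p : E →L[ℝ] (ι → ℝ)) {f : (ι → ℝ) → (ι → ℝ)} {M : Matrix ι ι ℝ} {x : E}
    (hf : HasFDerivAt f (Matrix.mulVecLin M).toContinuousLinearMap (p x)) :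
    (fun h => (f (p (x + h)) - f (p x) - M *ᵥ p h) ⬝ᵥ p h) =o[𝓝 0] fun h => ‖h‖ ^ 2 := by
  have h1 : (fun h => f (p (x + h)) - f (p x) - M *ᵥ p h) =o[𝓝 0] fun h : E => ‖h‖ := by
    have h2 := hasFDerivAt_iff_isLittleO_nhds_zero.1 (hf.comp x p.hasFDerivAt)
    exact h2.norm_right
  have h3 : ∀ k, (fun h => p h k) =O[𝓝 0] fun h : E => ‖h‖ := fun k =>
    ((ContinuousLinearMap.proj (R := ℝ) (φ := fun _ : ι => ℝ) k).comp p).isBigO_id _ |>.norm_right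
  simp only [dotProduct, pow_two]
  exact Asymptotics.IsLittleO.fun_sum fun k _ => (Asymptotics.isLittleO_pi.1 h1 k).mul_isBigO (h3 k)

namespace StatFamily

variable {V : Type*} {H : FactorGraph V} [DecidableEq V] [Fintype V]

/-- The projection to the expectation parameter of a factor. -/
noncomputable def factorProj (I : StatFamily H) (α : H.Factor) :
    I.Pseudo →L[ℝ] (I.FactorIndex α → ℝ) :=
  (ContinuousLinearMap.proj (R := ℝ) (φ := fun α : H.Factor => I.FactorIndex α → ℝ) α).comp
    (ContinuousLinearMap.fst ℝ _ _)

/-- The projection to the expectation parameter of a vertex. -/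
noncomputable def nodeProj (I : StatFamily H) (i : V) : I.Pseudo →L[ℝ] (Fin (I.r i) → ℝ) :=
  (ContinuousLinearMap.proj (R := ℝ) (φ := fun i : V => Fin (I.r i) → ℝ) i).comp
    (ContinuousLinearMap.snd ℝ _ _)

/-- The gradient of the Bethe free energy. -/
noncomputable def betheGradient (I : StatFamily H) (θbar : I.Model) (η : I.Pseudo) :
    I.Pseudo →L[ℝ] ℝ :=
  -∑ α, (ExpFam.coordForm (θbar α)).comp (I.factorProj α) +
    ∑ α, (ExpFam.coordForm (ExpFam.invMean (I.νF α) (I.φFull α) (η.1 α))).comp (I.factorProj α) +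
    ∑ i, (1 - (H.degree i : ℝ)) •
      (ExpFam.coordForm (ExpFam.invMean (I.ν i) (I.φ i) (η.2 i))).comp (I.nodeProj i)

lemma betheGradient_apply (I : StatFamily H) (θbar : I.Model) (η w : I.Pseudo) :
    I.betheGradient θbar η w =
      ∑ α, (ExpFam.invMean (I.νF α) (I.φFull α) (η.1 α) - θbar α) ⬝ᵥ w.1 α +
      ∑ i, (1 - (H.degree i : ℝ)) * (ExpFam.invMean (I.ν i) (I.φ i) (η.2 i) ⬝ᵥ w.2 i) := by
  simp only [betheGradient, _root_.add_apply, _root_.neg_apply, _root_.sum_apply,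
    _root_.smul_apply, ContinuousLinearMap.comp_apply, ExpFam.coordForm_apply, sub_dotProduct,
    Finset.sum_sub_distrib, smul_eq_mul]
  simp only [dotProduct_comm (w.1 _), dotProduct_comm (w.2 _), factorProj, nodeProj,
    ContinuousLinearMap.comp_apply, ContinuousLinearMap.proj_apply,
    ContinuousLinearMap.coe_fst', ContinuousLinearMap.coe_snd']
  ring

variable {I : StatFamily H}

/-- The neighbourhood is a full one, not relative to `L`: parameters near those of a point of `L`
remain expectation parameters, by `exists_localInverse`. -/
lemma hasFDerivAt_bethe (hI : I.IsInferenceFamily) (θbar : I.Model) {η : I.Pseudo}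
    (hη : η ∈ I.localPolytope) :
    ∀ᶠ ξ in 𝓝 η, HasFDerivAt (I.bethe θbar) (I.betheGradient θbar ξ) ξ := by
  have h1 : ∀ᶠ ξ in 𝓝 η, ∀ α : H.Factor, HasFDerivAt (ExpFam.legendre (I.νF α) (I.φFull α))
      (ExpFam.coordForm (ExpFam.invMean (I.νF α) (I.φFull α) (ξ.1 α))) (ξ.1 α) := by
    refine eventually_all.2 fun α => ?_
    obtain ⟨θ, hθ, hθη⟩ := hη.1 α
    have h2 := (ExpFam.exists_localInverse (I.measurable_φFull α) (hI.isUnit_covF α) hθ).2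
    rw [hθη] at h2
    filter_upwards [((I.factorProj α).continuous.tendsto η).eventually h2] with ξ hξ
    have h3 := ExpFam.hasFDerivAt_legendre (I.measurable_φFull α) (hI.isUnit_covF α) hξ.1
    rwa [hξ.2] at h3
  have h2 : ∀ᶠ ξ in 𝓝 η, ∀ i : V, HasFDerivAt (ExpFam.legendre (I.ν i) (I.φ i))
      (ExpFam.coordForm (ExpFam.invMean (I.ν i) (I.φ i) (ξ.2 i))) (ξ.2 i) := by
    refine eventually_all.2 fun i => ?_
    obtain ⟨θ, hθ, hθη⟩ := hη.2.1 i
    have h2 := (ExpFam.exists_localInverse (I.measurable_φ i) (hI.isUnit_cov i) hθ).2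
    rw [hθη] at h2
    filter_upwards [((I.nodeProj i).continuous.tendsto η).eventually h2] with ξ hξ
    have h3 := ExpFam.hasFDerivAt_legendre (I.measurable_φ i) (hI.isUnit_cov i) hξ.1
    rwa [hξ.2] at h3
  filter_upwards [h1, h2] with ξ h1 h2
  refine HasFDerivAt.add (HasFDerivAt.add (HasFDerivAt.neg (HasFDerivAt.fun_sum fun α _ => ?_))
    (HasFDerivAt.fun_sum fun α _ => ?_)) (HasFDerivAt.fun_sum fun i _ => ?_)
  · have h3 := ((ExpFam.coordForm (θbar α)).comp (I.factorProj α)).hasFDerivAt (x := ξ)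
    refine h3.congr_of_eventuallyEq (Eventually.of_forall fun ζ => ?_)
    rw [ContinuousLinearMap.comp_apply, ExpFam.coordForm_apply, dotProduct_comm]
    rfl
  · exact (h1 α).comp ξ (I.factorProj α).hasFDerivAt
  · exact ((h2 i).comp ξ (I.nodeProj i).hasFDerivAt).const_mul _

/-- The gradient is assembled from the maps `Λ_a⁻¹`, whose derivatives at the beliefs are the
inverse covariances; at `t = 1` the scaling does nothing. -/
lemma betheGradient_sub_isLittleO (hI : I.IsInferenceFamily) {θbar : I.Model} {μ : I.Msg}
    (hμ : I.IsFixedPoint θbar μ) :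
    (fun h => I.betheGradient θbar (I.beliefs θbar μ + h) h -
      I.betheGradient θbar (I.beliefs θbar μ) h - I.hessian
        (fun α => ExpFam.cov (I.νF α) (I.φFull α) (I.factorParam θbar μ α))
        (fun i => ExpFam.cov (I.ν i) (I.φ i) (I.nodeParam μ i)) 1 h h) =o[𝓝 0]
      fun h => ‖h‖ ^ 2 := by
  set η := I.beliefs θbar μ
  have h1 : ∀ α : H.Factor, _ := fun α => isLittleO_dotProduct_remainder (x := η) (I.factorProj α)
    (ExpFam.exists_localInverse (I.measurable_φFull α) (hI.isUnit_covF α)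
      (hμ.mem_factor α)).1.hasFDerivAt
  have h2 : ∀ i : V, _ := fun i => isLittleO_dotProduct_remainder (x := η) (I.nodeProj i)
    (ExpFam.exists_localInverse (I.measurable_φ i) (hI.isUnit_cov i)
      (hμ.mem_node i)).1.hasFDerivAt
  have h3 := (Asymptotics.IsLittleO.fun_sum (s := Finset.univ) fun α _ => h1 α).add
    (Asymptotics.IsLittleO.fun_sum (s := Finset.univ)
      fun i _ => (h2 i).const_mul_left (1 - (H.degree i : ℝ)))
  refine h3.congr_left fun h => ?_
  simp only [betheGradient_apply, hessian, Matrix.scaleOffDiag_one, sub_dotProduct, mul_sub,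
    Finset.sum_sub_distrib]
  have e1 : ∀ (α : H.Factor) (ζ : I.Pseudo), I.factorProj α ζ = ζ.1 α := fun _ _ => rfl
  have e2 : ∀ (i : V) (ζ : I.Pseudo), I.nodeProj i ζ = ζ.2 i := fun _ _ => rfl
  simp only [e1, e2]
  ring

/-- `θ_α - θbar_α` has no component along the additional statistic, and its `i`-component is `θ_i -
μ_{α → i}`. Summed over `α ∋ i` this is `(d_i - 1) θ_i`, which the vertex term `(1 - d_i) θ_i`
cancels. -/
lemma betheGradient_beliefs (hI : I.IsInferenceFamily) {θbar : I.Model} {μ : I.Msg}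
    (hμ : I.IsFixedPoint θbar μ) {w : I.Pseudo} (hw : w ∈ I.tangentSpace) :
    I.betheGradient θbar (I.beliefs θbar μ) w = 0 := by
  have e1 : ∀ α : H.Factor, ExpFam.invMean (I.νF α) (I.φFull α) ((I.beliefs θbar μ).1 α) =
      I.factorParam θbar μ α := fun α =>
    ExpFam.invMean_mean (I.measurable_φFull α) (hI.isUnit_covF α) (hμ.mem_factor α)
  have e2 : ∀ i : V, ExpFam.invMean (I.ν i) (I.φ i) ((I.beliefs θbar μ).2 i) =
      I.nodeParam μ i := fun i =>
    ExpFam.invMean_mean (I.measurable_φ i) (hI.isUnit_cov i) (hμ.mem_node i)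
  rw [betheGradient_apply]
  simp only [e1, e2]
  rw [I.sum_dotProduct_of_mem_tangentSpace hw (fun α => I.factorParam θbar μ α - θbar α)
    (fun i => I.nodeParam μ i)]
  rw [Finset.sum_eq_zero, Finset.sum_eq_zero, add_zero]
  · intro i _
    refine Finset.sum_eq_zero fun k _ => ?_
    have h1 : (∑ α : H.Factor, if h : i ∈ α.1 then
        (I.factorParam θbar μ α - θbar α) (Sum.inr ⟨⟨i, h⟩, k⟩) else 0) =
        (∑ α : H.Factor, if i ∈ α.1 then I.nodeParam μ i k else 0) - I.nodeParam μ i k := by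
      conv_rhs => rw [nodeParam.eq_def I μ i]
      rw [← Finset.sum_sub_distrib]
      refine Finset.sum_congr rfl fun α _ => ?_
      split_ifs with h
      · have h2 := I.cavity_add μ α ⟨i, h⟩ k
        rw [nodeParam] at h2
        simp only [Pi.sub_apply, factorParam, Sum.elim_inr]
        linarith
      · simp
    rw [h1, sum_factor_mem_const]
    ring
  · intro α _
    exact Finset.sum_eq_zero fun a _ => by simp [factorParam]

/-- If the derivative of the LBP update at a fixed point has no real eigenvalue `≥ 1`, then the
beliefs are a local minimum of the Bethe free energy. -/
theorem IsFixedPoint.isBetheLocalMin (hI : I.IsInferenceFamily) {θbar : I.Model} {μ : I.Msg}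
    (hμ : I.IsFixedPoint θbar μ)
    (hspec : ∀ z ∈ complexSpectrum (I.edgeMatrix (I.edgeWeight θbar μ)),
      ¬ ∃ t : ℝ, 1 ≤ t ∧ z = (t : ℂ)) : I.IsBetheLocalMin θbar μ := by
  have hmem := hμ.beliefs_mem hI
  refine ⟨hmem, ?_⟩
  set C := fun α => ExpFam.cov (I.νF α) (I.φFull α) (I.factorParam θbar μ α) with hCdef
  set W := fun i => ExpFam.cov (I.ν i) (I.φ i) (I.nodeParam μ i) with hWdef
  have hC : ∀ α, (C α).PosDef := fun α => ExpFam.cov_posDef (I.measurable_φFull α)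
    (hμ.mem_factor α) (hI.isUnit_covF α _ (hμ.mem_factor α))
  have hW : ∀ i, (W i).PosDef := fun i => ExpFam.cov_posDef (I.measurable_φ i)
    (hμ.mem_node i) (hI.isUnit_cov i _ (hμ.mem_node i))
  have hCW : ∀ (α : H.Factor) (i : {i : V // i ∈ α.1})
      (k l : Fin (I.r i)), C α (Sum.inr ⟨i, k⟩) (Sum.inr ⟨i, l⟩) = W i k l :=
    fun α i k l => hμ.cov_factor hI α i k l
  -- A nonzero fixed vector of `t M(u)` would be an eigenvector of `M(u)` for `1 / t ≥ 1`.
  have hM : ∀ t ∈ Set.Icc (0 : ℝ) 1, ∀ m : I.Msg,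
      t • (I.edgeMatrix (I.edgeWeight θbar μ) *ᵥ m) = m → m = 0 := by
    intro t ht m hm
    by_contra hm0
    have ht0 : t ≠ 0 := by
      rintro rfl
      rw [zero_smul] at hm
      exact hm0 hm.symm
    have htpos : 0 < t := lt_of_le_of_ne ht.1 ht0.symm
    refine hspec _ (complexSpectrum_of_mulVec_eq (c := t⁻¹) hm0 ?_)
      ⟨t⁻¹, (one_le_inv₀ htpos).2 ht.2, rfl⟩
    conv_rhs => rw [← hm]
    rw [inv_smul_smul₀ ht0]
  obtain ⟨c, hc, hpos⟩ := exists_pos_le_of_nondegenerate_path I.tangentSpace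
    (Q := fun t v => I.hessian C W t v v) (B := fun t v w => I.hessian C W t v w)
    (I.continuousOn_hessian C W hC)
    (fun t ht v w s => I.hessian_add_smul_self C W
      (fun α => ((hC α).scaleOffDiag (I.block α) ht).1) (fun i => (hW i).1) v w s)
    (fun t s w => I.hessian_smul_self C W t s w)
    (fun w hw => I.hessian_zero_nonneg hC hW hCW hw)
    (fun t ht v hv h => I.eq_zero_of_hessian_eq_zero ht hC hW hCW (hM t ht) hv h)
  exact isLocalMinOn_of_gradient hc (hasFDerivAt_bethe hI θbar hmem)
    (fun η hη => betheGradient_beliefs hI hμ (I.sub_mem_tangentSpace hη hmem))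
    (fun η hη => hpos _ (I.sub_mem_tangentSpace hη hmem))
    (fun s w => I.hessian_smul_self C W 1 s w) (betheGradient_sub_isLittleO hI hμ)

/-! ### Spectral criteria for LBP with and without damping. -/

lemma IsFixedPoint.hasFDerivAt_dampedUpdate (hI : I.IsInferenceFamily) {θbar : I.Model} {μ : I.Msg}
    (hμ : I.IsFixedPoint θbar μ) (ε : ℝ) :
    HasFDerivAt (I.dampedUpdate θbar ε) (Matrix.mulVecLin ((1 - ε) •
      I.edgeMatrix (I.edgeWeight θbar μ) + ε • 1)).toContinuousLinearMap μ := by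
  have h1 := ((hμ.hasFDerivAt_lbpUpdate hI).const_smul (1 - ε)).add
    ((hasFDerivAt_id μ).const_smul ε)
  refine h1.congr_fderiv (ContinuousLinearMap.ext fun m => ?_)
  simp

lemma IsFixedPoint.dampedUpdate_eq {θbar : I.Model} {μ : I.Msg}
    (hμ : I.IsFixedPoint θbar μ) (ε : ℝ) : I.dampedUpdate θbar ε μ = μ := by
  rw [dampedUpdate, hμ.fixed, ← add_smul, sub_add_cancel, one_smul]

/-- Loopy belief propagation is locally stable with suitable damping if and only if all eigenvalues
of the derivative have real part less than one. -/
theorem IsFixedPoint.exists_damping_iff (hI : I.IsInferenceFamily) {θbar : I.Model} {μ : I.Msg}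
    (hμ : I.IsFixedPoint θbar μ)
    (hne : ∀ z ∈ complexSpectrum (I.edgeMatrix (I.edgeWeight θbar μ)), ‖z‖ ≠ 1) :
    (∀ z ∈ complexSpectrum (I.edgeMatrix (I.edgeWeight θbar μ)), z.re < 1) ↔
      ∃ ε : ℝ, 0 ≤ ε ∧ ε < 1 ∧ IsLocallyStable (I.dampedUpdate θbar ε) μ := by
  have hmat : ∀ M : Matrix I.MsgIndex I.MsgIndex ℝ, LinearMap.toMatrix'
      ((Matrix.mulVecLin M).toContinuousLinearMap : I.Msg →ₗ[ℝ] I.Msg) = M :=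
    fun M => LinearMap.toMatrix'_toLin' M
  constructor
  · intro h
    obtain ⟨ε, h0, h1, hε⟩ := exists_damping (finite_complexSpectrum _) h
    refine ⟨ε, h0, h1, isLocallyStable_of_spectrum (hμ.hasFDerivAt_dampedUpdate hI ε)
      (hμ.dampedUpdate_eq ε) fun z hz => ?_⟩
    rw [hmat, mem_complexSpectrum_damped h1] at hz
    obtain ⟨y, hy, rfl⟩ := hz
    exact hε y hy
  · rintro ⟨ε, h0, h1, hs⟩ z hz
    by_contra! hre
    have h2 := hs.norm_le_one (hμ.hasFDerivAt_dampedUpdate hI ε) (hμ.dampedUpdate_eq ε)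
      ((1 - ε) * z + ε) (by
        rw [hmat, mem_complexSpectrum_damped h1]
        exact ⟨z, hz, rfl⟩)
    have h3 : Complex.normSq ((1 - ε) * z + ε) ≤ 1 := by
      rw [Complex.normSq_eq_norm_sq]
      exact pow_le_one₀ (norm_nonneg _) h2
    have h4 : Complex.normSq z ≠ 1 := by
      rw [Complex.normSq_eq_norm_sq]
      intro h
      exact hne z hz (by nlinarith [norm_nonneg z])
    simp only [Complex.normSq_apply, Complex.sub_re, Complex.sub_im, Complex.add_re,
      Complex.add_im, Complex.mul_re, Complex.mul_im, Complex.ofReal_re, Complex.ofReal_im,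
      Complex.one_re, Complex.one_im] at h3 h4
    have h5 : 0 < 1 - ε := by linarith
    -- The damped eigenvalue has real part at least `1` and modulus at most `1`, so it equals `1`.
    -- Then `z = 1`, which has unit modulus.
    have h6 : 1 ≤ (1 - ε) * z.re + ε := by nlinarith
    have h7 : ((1 - ε) * z.re + ε) ^ 2 + ((1 - ε) * z.im) ^ 2 ≤ 1 := by nlinarith
    have h8 : ((1 - ε) * z.im) ^ 2 ≤ 0 := by nlinarith
    have h9 : z.im = 0 := by
      have := pow_eq_zero_iff (two_ne_zero) |>.1 (le_antisymm h8 (sq_nonneg _))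
      exact (mul_eq_zero.1 this).resolve_left h5.ne'
    have h10 : z.re = 1 := by
      have : (1 - ε) * z.re + ε ≤ 1 := by nlinarith
      nlinarith
    exact h4 (by rw [h9, h10]; ring)

/-- Loopy belief propagation is locally stable if and only if all eigenvalues of the derivative
have modulus less than one. -/
theorem IsFixedPoint.isLocallyStable_iff (hI : I.IsInferenceFamily) {θbar : I.Model} {μ : I.Msg}
    (hμ : I.IsFixedPoint θbar μ)
    (hne : ∀ z ∈ complexSpectrum (I.edgeMatrix (I.edgeWeight θbar μ)), ‖z‖ ≠ 1) :
    (∀ z ∈ complexSpectrum (I.edgeMatrix (I.edgeWeight θbar μ)), ‖z‖ < 1) ↔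
      IsLocallyStable (I.lbpUpdate θbar) μ := by
  have hmat : ∀ M : Matrix I.MsgIndex I.MsgIndex ℝ, LinearMap.toMatrix'
      ((Matrix.mulVecLin M).toContinuousLinearMap : I.Msg →ₗ[ℝ] I.Msg) = M :=
    fun M => LinearMap.toMatrix'_toLin' M
  constructor
  · intro h
    exact isLocallyStable_of_spectrum (hμ.hasFDerivAt_lbpUpdate hI) hμ.fixed (by rwa [hmat])
  · intro hs z hz
    have := hs.norm_le_one (hμ.hasFDerivAt_lbpUpdate hI) hμ.fixed
    rw [hmat] at this
    exact lt_of_le_of_ne (this z hz) (hne z hz)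

end StatFamily

/-! ### Multinomial families. -/

namespace ExpFam

variable {Ω ι : Type*} [MeasurableSpace Ω] [Fintype ι] {ν : Measure Ω} {φ : Ω → ι → ℝ}

/-- A probability measure with a density proportional to `exp ⟨θ, φ⟩` is a member of the family. -/
lemma eq_law_of_withDensity [NeZero ν] (hφ : Measurable φ) {P : Measure Ω} [IsProbabilityMeasure P]
    {θ : ι → ℝ} {K : ENNReal}
    (hP : P = ν.withDensity fun x => K * ENNReal.ofReal (Real.exp (θ ⬝ᵥ φ x))) :
    Integrable (fun x => Real.exp (θ ⬝ᵥ φ x)) ν ∧ P = law ν φ θ := by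
  have hm := measurable_dotProduct hφ θ
  -- Total mass one forces the partition function to be finite and `K` to be its inverse.
  have h1 : K * ∫⁻ x, ENNReal.ofReal (Real.exp (θ ⬝ᵥ φ x)) ∂ν = 1 := by
    rw [← lintegral_const_mul _ hm.exp.ennreal_ofReal, ← measure_univ (μ := P), hP,
      withDensity_apply _ MeasurableSet.univ, Measure.restrict_univ]
  have hne : ∫⁻ x, ENNReal.ofReal (Real.exp (θ ⬝ᵥ φ x)) ∂ν ≠ ⊤ := by
    intro h
    rw [h] at h1
    by_cases hK : K = 0
    · simp [hK] at h1
    · simp [ENNReal.mul_top hK] at h1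
  have hint : Integrable (fun x => Real.exp (θ ⬝ᵥ φ x)) ν := by
    refine ⟨hm.exp.aestronglyMeasurable, ?_⟩
    rw [hasFiniteIntegral_iff_ofReal (Eventually.of_forall fun x => (Real.exp_pos _).le)]
    exact hne.lt_top
  refine ⟨hint, ?_⟩
  have hZ := moment_one_pos hint
  have h2 : ENNReal.ofReal (moment ν φ (fun _ => 1) θ) =
      ∫⁻ x, ENNReal.ofReal (Real.exp (θ ⬝ᵥ φ x)) ∂ν := by
    rw [← ofReal_integral_eq_lintegral_ofReal hint
      (Eventually.of_forall fun x => (Real.exp_pos _).le)]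
    simp [moment]
  have h3 : K = (ENNReal.ofReal (moment ν φ (fun _ => 1) θ))⁻¹ := by
    rw [← h2] at h1
    exact ENNReal.eq_inv_of_mul_eq_one_left h1
  rw [hP, law]
  congr 1
  ext x
  rw [density_eq hint, ENNReal.ofReal_div_of_pos hZ, h3, mul_comm, div_eq_mul_inv]

lemma IsMultinomialStatistic.eq_zero_of_ae_const (h : IsMultinomialStatistic φ)
    (hpos : ∀ x, ν {x} ≠ 0) (w : ι → ℝ) (c : ℝ) (hae : ∀ᵐ x ∂ν, w ⬝ᵥ φ x = c) : w = 0 := by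
  have hall : ∀ x, w ⬝ᵥ φ x = c := by
    intro x
    by_contra hx
    exact hpos x (measure_mono_null (Set.singleton_subset_iff.2 hx) (ae_iff.1 hae))
  have h1 := Fintype.linearIndependent_iff.1 h.1 (fun o => o.elim (-c) w) (by
    ext x
    rw [Fintype.sum_option]
    simp only [Option.elim, Pi.add_apply, Pi.smul_apply, Finset.sum_apply, smul_eq_mul]
    have := hall x
    simp only [dotProduct] at this
    rw [this]
    simp)
  ext k
  simpa using h1 (some k)

lemma paramSpace_eq_univ_of_finite [Finite Ω] [MeasurableSingletonClass Ω] [IsFiniteMeasure ν] :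
    paramSpace ν φ = Set.univ := by
  rw [paramSpace, interior_eq_univ, Set.eq_univ_iff_forall]
  exact fun θ => Integrable.of_finite

/-- The exponential family of a multinomial statistic consists of all positive distributions. -/
lemma IsMultinomialStatistic.exists_eq_law [Finite Ω] [MeasurableSingletonClass Ω] [NeZero ν]
    (h : IsMultinomialStatistic φ) {c : NNReal} (hc : c ≠ 0) (hν : ν = c • Measure.count)
    (P : Measure Ω) [IsProbabilityMeasure P] (hP : ∀ x, P {x} ≠ 0) :
    ∃ θ ∈ paramSpace ν φ, P = law ν φ θ := by
  have : IsFiniteMeasure ν := by rw [hν]; infer_instance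
  -- The logarithm of the point masses is expanded in the basis `1, φ_k`. The coefficients of the
  -- `φ_k` give `θ`; that of `1` goes into the normalization, together with `c⁻¹` for the base
  -- measure.
  obtain ⟨a, ha⟩ : ∃ a : Option ι → ℝ, ∑ o, a o • (fun o : Option ι =>
      o.elim (fun _ : Ω => (1 : ℝ)) (fun k x => φ x k)) o = fun x => Real.log (P {x}).toReal :=
    (Submodule.mem_span_range_iff_exists_fun ℝ).1 (h.2 ▸ Submodule.mem_top)
  have hφ : Measurable φ := measurable_of_finite φ
  refine ⟨fun k => a (some k), by rw [paramSpace_eq_univ_of_finite]; trivial,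
    (eq_law_of_withDensity hφ (K := ENNReal.ofReal (Real.exp (a none)) * (c : ENNReal)⁻¹) ?_).2⟩
  refine Measure.ext_of_singleton fun x => ?_
  have h1 := congrFun ha x
  rw [Fintype.sum_option] at h1
  simp only [Option.elim, Pi.add_apply, Pi.smul_apply, Finset.sum_apply, smul_eq_mul,
    mul_one] at h1
  have h2 : P {x} = ENNReal.ofReal (Real.exp (a none + ∑ k, a (some k) * φ x k)) := by
    rw [h1, Real.exp_log (ENNReal.toReal_pos (hP x) (measure_ne_top _ _)),
      ENNReal.ofReal_toReal (measure_ne_top _ _)]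
  rw [withDensity_apply _ (measurableSet_singleton x), lintegral_singleton, hν, h2, Real.exp_add,
    ENNReal.ofReal_mul (Real.exp_pos _).le]
  have hc' : (c : ENNReal) ≠ 0 := by exact_mod_cast hc
  simp only [Measure.smul_apply, Measure.count_singleton, dotProduct]
  rw [ENNReal.smul_def, smul_eq_mul, mul_one, mul_right_comm, mul_assoc _ _ (c : ENNReal),
    ENNReal.inv_mul_cancel hc' ENNReal.coe_ne_top, mul_one]

lemma law_ne_zero [NeZero ν] (hφ : Measurable φ) (θ : ι → ℝ) {s : Set Ω} (hs : ν s ≠ 0) :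
    law ν φ θ s ≠ 0 := by
  intro h
  refine hs (withDensity_absolutelyContinuous' (measurable_density hφ θ).ennreal_ofReal.aemeasurable
    (Eventually.of_forall fun x => ?_) h)
  simpa using density_pos θ x

end ExpFam

namespace StatFamily

variable {V : Type*} {H : FactorGraph V} [DecidableEq V] {I : StatFamily H}

/-- Multinomial families are inference families. -/
theorem IsMultinomial.isInferenceFamily (h : I.IsMultinomial) : I.IsInferenceFamily := by
  have := h.finite
  have := h.singleton
  have hpos : ∀ i x, I.ν i {x} ≠ 0 := by
    intro i x
    obtain ⟨c, hc, hν⟩ := h.uniform i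
    rw [hν, Measure.smul_apply, Measure.count_singleton, ENNReal.smul_def, smul_eq_mul, mul_one]
    exact_mod_cast hc
  have hposF : ∀ α x, I.νF α {x} ≠ 0 := by
    intro α x
    rw [νF, Measure.pi_singleton]
    exact Finset.prod_ne_zero_iff.2 fun i _ => hpos _ _
  refine ⟨fun i θ hθ => ?_, fun α θ hθ => ?_, fun α i θ hθ => ?_⟩
  · exact ExpFam.isUnit_cov_of_ae_const (I.measurable_φ i)
      ((h.vertex i).eq_zero_of_ae_const (hpos i)) hθ
  · exact ExpFam.isUnit_cov_of_ae_const (I.measurable_φFull α)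
      ((h.factor α).eq_zero_of_ae_const (hposF α)) hθ
  · obtain ⟨c, hc, hν⟩ := h.uniform i
    have hprob := ExpFam.isProbabilityMeasure_law (ExpFam.integrable_exp_of_mem hθ)
    have hprob' : IsProbabilityMeasure
        ((ExpFam.law (I.νF α) (I.φFull α) θ).map (fun x => x i)) :=
      Measure.isProbabilityMeasure_map (I.measurable_eval α i).aemeasurable
    refine (h.vertex i).exists_eq_law hc hν _ fun x => ?_
    rw [Measure.map_apply (I.measurable_eval α i) (measurableSet_singleton x)]
    refine ExpFam.law_ne_zero (I.measurable_φFull α) θ fun h0 => ?_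
    have hne : ∀ j, Nonempty (I.X j) := fun j => by
      by_contra hempty
      rw [not_nonempty_iff] at hempty
      exact NeZero.ne (I.ν j) (Measure.eq_zero_of_isEmpty _)
    -- A configuration in the fibre over `x`; its positive mass keeps the marginal positive at `x`.
    let y : I.XF α := Function.update (fun j => Classical.choice (hne j)) i x
    exact hposF α y (measure_mono_null (Set.singleton_subset_iff.2 (by simp [y])) h0)

end StatFamily

/-! ### Gaussian families. -/

lemma mul_sq_add_mul_eq {b c : ℝ} (hc : c ≠ 0) (u : ℝ) :
    b * u + c * u ^ 2 = c * (u + b / (2 * c)) ^ 2 - b ^ 2 / (4 * c) := by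
  field_simp
  ring

/-- Adding the reflection `u ↦ -u` removes the linear term, because `e^{bu} + e^{-bu} ≥ 1`.
Conversely, completing the square gives a translated Gaussian. -/
lemma integrable_exp_quadratic_iff {b c : ℝ} :
    Integrable (fun u : ℝ => Real.exp (b * u + c * u ^ 2)) ↔ c < 0 := by
  constructor
  · intro h
    have h1 : Integrable (fun u : ℝ => Real.exp (-(-c) * u ^ 2)) := by
      refine (h.add h.comp_neg).mono' (by fun_prop) (Eventually.of_forall fun u => ?_)
      rw [Real.norm_eq_abs, Real.abs_exp, neg_neg]
      simp only [Pi.add_apply, even_two.neg_pow, mul_neg, Real.exp_add]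
      have h2 : 1 ≤ Real.exp (b * u) + Real.exp (-(b * u)) := by
        rcases le_total 0 (b * u) with h | h
        · linarith [Real.one_le_exp h, Real.exp_pos (-(b * u))]
        · linarith [Real.one_le_exp (neg_nonneg.2 h), Real.exp_pos (b * u)]
      nlinarith [Real.exp_pos (c * u ^ 2)]
    linarith [integrable_exp_neg_mul_sq_iff.1 h1]
  · intro h
    have h1 := ((integrable_exp_neg_mul_sq (neg_pos.2 h)).comp_add_right (b / (2 * c))).const_mul
      (Real.exp (-(b ^ 2 / (4 * c))))
    refine h1.congr (Eventually.of_forall fun u => ?_)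
    simp only [neg_neg]
    rw [← Real.exp_add, mul_sq_add_mul_eq h.ne]
    ring_nf

lemma lintegral_exp_quadratic {b c : ℝ} (hc : c ≠ 0) :
    ∫⁻ u : ℝ, ENNReal.ofReal (Real.exp (b * u + c * u ^ 2)) =
      ENNReal.ofReal (Real.exp (-(b ^ 2 / (4 * c)))) *
        ∫⁻ u : ℝ, ENNReal.ofReal (Real.exp (c * u ^ 2)) := by
  rw [← lintegral_add_right_eq_self (fun u : ℝ => ENNReal.ofReal (Real.exp (c * u ^ 2)))
    (b / (2 * c)), ← lintegral_const_mul _ (by fun_prop)]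
  refine lintegral_congr fun u => ?_
  rw [← ENNReal.ofReal_mul (Real.exp_pos _).le, ← Real.exp_add, mul_sq_add_mul_eq hc]
  ring_nf

/-- Two distinct coordinates that exhaust the index type. -/
lemma map_pair_pi_volume {A : Type*} [Fintype A] [DecidableEq A] {i j : A} (hij : i ≠ j)
    (huniv : (Finset.univ : Finset A) = {i, j}) :
    (Measure.pi fun _ : A => (volume : Measure ℝ)).map (fun x => (x i, x j)) =
      (volume : Measure ℝ).prod volume := by
  refine (Measure.prod_eq fun s t hs ht => ?_).symm
  rw [Measure.map_apply (by fun_prop) (hs.prod ht)]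
  have h1 : (fun x : A → ℝ => (x i, x j)) ⁻¹' s ×ˢ t =
      Set.univ.pi fun v => if v = i then s else t := by
    ext x
    simp only [Set.mem_preimage, Set.mem_prod, Set.mem_pi, Set.mem_univ, true_imp_iff]
    constructor
    · rintro ⟨hi, hj⟩ v
      have hv : v ∈ ({i, j} : Finset A) := huniv ▸ Finset.mem_univ v
      rw [Finset.mem_insert, Finset.mem_singleton] at hv
      rcases hv with rfl | rfl
      · simpa using hi
      · simpa [hij.symm] using hj
    · intro h
      exact ⟨by simpa using h i, by simpa [hij.symm] using h j⟩
  rw [h1, Measure.pi_pi, huniv, Finset.prod_pair hij, if_pos rfl, if_neg hij.symm]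

/-- The marginal of a two-dimensional density that is the exponential of a quadratic polynomial. -/
lemma map_eval_withDensity_exp_quadratic {A : Type*} [Fintype A] [DecidableEq A] {i j : A}
    (hij : i ≠ j) (huniv : (Finset.univ : Finset A) = {i, j}) (a b c d ψ : ℝ) {e : ℝ} (he : e < 0) :
    ((Measure.pi fun _ : A => (volume : Measure ℝ)).withDensity fun x => ENNReal.ofReal (Real.exp
      ((b * x i + c * x i ^ 2) + ((a * x i + d) * x j + e * x j ^ 2) - ψ))).map (fun x => x i) =
    (volume : Measure ℝ).withDensity fun u =>
      ENNReal.ofReal (Real.exp (-(d ^ 2 / (4 * e)) - ψ)) *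
        (∫⁻ u : ℝ, ENNReal.ofReal (Real.exp (e * u ^ 2))) *
        ENNReal.ofReal (Real.exp ((b - a * d / (2 * e)) * u + (c - a ^ 2 / (4 * e)) * u ^ 2)) := by
  refine Measure.ext fun s hs => ?_
  have hev : Measurable fun x : A → ℝ => x i := measurable_pi_apply i
  rw [Measure.map_apply hev hs, withDensity_apply _ (hev hs), withDensity_apply _ hs,
    ← lintegral_indicator (hev hs), ← lintegral_indicator hs]
  let G : ℝ × ℝ → ENNReal := fun p => s.indicator 1 p.1 * ENNReal.ofReal (Real.exp
    ((b * p.1 + c * p.1 ^ 2) + ((a * p.1 + d) * p.2 + e * p.2 ^ 2) - ψ))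
  have hG : Measurable G :=
    ((measurable_one.indicator hs).comp measurable_fst).mul (by fun_prop)
  calc _ = ∫⁻ x, G (x i, x j) ∂(Measure.pi fun _ : A => (volume : Measure ℝ)) := by
        refine lintegral_congr fun x => ?_
        by_cases hx : x i ∈ s
        · rw [Set.indicator_of_mem (show x ∈ (fun x : A → ℝ => x i) ⁻¹' s from hx)]
          simp [G, hx]
        · rw [Set.indicator_of_notMem (show x ∉ (fun x : A → ℝ => x i) ⁻¹' s from hx)]
          simp [G, hx]
    _ = ∫⁻ p, G p ∂(volume : Measure ℝ).prod volume := by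
        rw [← map_pair_pi_volume hij huniv, lintegral_map hG (by fun_prop)]
    _ = ∫⁻ u : ℝ, ∫⁻ v : ℝ, G (u, v) := lintegral_prod _ hG.aemeasurable
    _ = _ := by
        refine lintegral_congr fun u => ?_
        by_cases hu : u ∈ s
        · simp only [G, Set.indicator_of_mem hu, Pi.one_apply, one_mul]
          have h1 : ∀ v : ℝ, ENNReal.ofReal (Real.exp ((b * u + c * u ^ 2) +
              ((a * u + d) * v + e * v ^ 2) - ψ)) =
              ENNReal.ofReal (Real.exp (b * u + c * u ^ 2 - ψ)) *
                ENNReal.ofReal (Real.exp ((a * u + d) * v + e * v ^ 2)) := fun v => by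
            rw [← ENNReal.ofReal_mul (Real.exp_pos _).le, ← Real.exp_add]
            ring_nf
          simp only [h1]
          rw [lintegral_const_mul _ (by fun_prop), lintegral_exp_quadratic he.ne, ← mul_assoc,
            ← ENNReal.ofReal_mul (Real.exp_pos _).le, ← Real.exp_add, mul_right_comm,
            ← ENNReal.ofReal_mul (Real.exp_pos _).le, ← Real.exp_add]
          congr 3
          field_simp
          ring
        · simp [G, hu]

namespace StatFamily

variable {V : Type*} {H : FactorGraph V}

lemma gaussian_dotProduct (i : V) (θ : Fin ((gaussian H).r i) → ℝ) (u : ℝ) :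
    θ ⬝ᵥ (gaussian H).φ i u = θ (0 : Fin 2) * u + θ (1 : Fin 2) * u ^ 2 := by
  change ∑ k : Fin 2, θ k * ![u, u ^ 2] k = _
  rw [Fin.sum_univ_two]
  simp

lemma gaussian_mem_paramSpace {i : V} {θ : Fin ((gaussian H).r i) → ℝ}
    (h : θ (1 : Fin 2) < 0) : θ ∈ ExpFam.paramSpace ((gaussian H).ν i) ((gaussian H).φ i) := by
  refine mem_interior.2 ⟨{θ | θ (1 : Fin 2) < 0}, fun η hη => ?_, ?_, h⟩
  · have h1 := (integrable_exp_quadratic_iff (b := η (0 : Fin 2))).2 hη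
    refine h1.congr (Eventually.of_forall fun u => ?_)
    simp only [gaussian_dotProduct]
  · have h1 : Continuous fun θ : Fin 2 → ℝ => θ 1 := continuous_apply 1
    exact isOpen_lt h1 continuous_const

lemma gaussian_dotProduct_full (α : H.Factor) (θ : (gaussian H).FactorIndex α → ℝ)
    (x : {i : V // i ∈ α.1} → ℝ) :
    θ ⬝ᵥ (gaussian H).φFull α x = θ (Sum.inl (0 : Fin 1)) * ∏ i, x i +
      ∑ i, (θ (Sum.inr ⟨i, (0 : Fin 2)⟩) * x i + θ (Sum.inr ⟨i, (1 : Fin 2)⟩) * x i ^ 2) := by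
  rw [dotProduct, Fintype.sum_sum_type, Fintype.sum_sigma]
  congr 1
  · change ∑ k : Fin 1, θ (Sum.inl k) * ∏ i, x i = _
    simp
  · refine Finset.sum_congr rfl fun i _ => ?_
    change ∑ k : Fin 2, θ (Sum.inr ⟨i, k⟩) * ![x i, x i ^ 2] k = _
    rw [Fin.sum_univ_two]
    simp

lemma eq_zero_of_quadratic_const {a b c d : ℝ} (h : ∀ u : ℝ, a * u + b * u ^ 2 + d = c) :
    a = 0 ∧ b = 0 := by
  have h0 := h 0
  have h1 := h 1
  have h2 := h (-1)
  constructor <;> nlinarith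

lemma gaussian_node_eq_zero (i : V) (w : Fin ((gaussian H).r i) → ℝ) (c : ℝ)
    (h : ∀ᵐ x ∂((gaussian H).ν i), w ⬝ᵥ (gaussian H).φ i x = c) : w = 0 := by
  have h1 : ∀ᵐ x : ℝ, w (0 : Fin 2) * x + w (1 : Fin 2) * x ^ 2 = c := by
    refine Eventually.mono h fun x hx => ?_
    rwa [gaussian_dotProduct] at hx
  have h2 := (Continuous.ae_eq_iff_eq (volume : Measure ℝ) (by fun_prop) continuous_const).1 h1
  obtain ⟨h3, h4⟩ := eq_zero_of_quadratic_const (d := 0) (c := c) fun u => by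
    simpa using congrFun h2 u
  ext k
  change Fin 2 at k
  fin_cases k
  · exact h3
  · exact h4

/-- Continuity upgrades the almost everywhere identity to an identity of polynomials. On the
coordinate axes the product vanishes, which isolates the vertex coefficients; the all-ones point
then gives the coefficient of the product. -/
lemma gaussian_factor_eq_zero {α : H.Factor} (hα : α.1.card = 2)
    (w : (gaussian H).FactorIndex α → ℝ) (c : ℝ)
    (h : ∀ᵐ x ∂((gaussian H).νF α), w ⬝ᵥ (gaussian H).φFull α x = c) : w = 0 := by
  classical
  have h1 : ∀ᵐ x ∂(Measure.pi fun _ : {i : V // i ∈ α.1} => (volume : Measure ℝ)),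
      w (Sum.inl (0 : Fin 1)) * ∏ i, x i + ∑ i, (w (Sum.inr ⟨i, (0 : Fin 2)⟩) * x i +
        w (Sum.inr ⟨i, (1 : Fin 2)⟩) * x i ^ 2) = c := by
    refine Eventually.mono h fun x hx => ?_
    rwa [gaussian_dotProduct_full] at hx
  have h2 := (Continuous.ae_eq_iff_eq
    (Measure.pi fun _ : {i : V // i ∈ α.1} => (volume : Measure ℝ)) (by fun_prop)
    continuous_const).1 h1
  have hcard : Fintype.card {i : V // i ∈ α.1} = 2 := by simpa using hα
  have h3 : ∀ i, w (Sum.inr ⟨i, (0 : Fin 2)⟩) = 0 ∧ w (Sum.inr ⟨i, (1 : Fin 2)⟩) = 0 := by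
    intro i
    refine eq_zero_of_quadratic_const (d := 0) (c := c) fun u => ?_
    have h4 := congrFun h2 (Pi.single i u)
    obtain ⟨j, hj⟩ := Fintype.exists_ne_of_one_lt_card (by omega) i
    rw [Finset.prod_eq_zero (Finset.mem_univ j) (by simp [hj]), mul_zero, zero_add,
      Finset.sum_eq_single i (fun k _ hk => by simp [Pi.single_eq_of_ne hk]) (by simp),
      Pi.single_eq_same] at h4
    rwa [add_zero]
  have hc : c = 0 := by
    have h4 := congrFun h2 0
    obtain ⟨i⟩ : Nonempty {i : V // i ∈ α.1} := Fintype.card_pos_iff.1 (by omega)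
    rw [Finset.prod_eq_zero (Finset.mem_univ i) rfl] at h4
    simp [h3] at h4
    exact h4.symm
  ext (a | ⟨i, k⟩)
  · have h4 := congrFun h2 1
    simp only [h3, hc] at h4
    obtain rfl : a = (0 : Fin 1) := Subsingleton.elim (α := Fin 1) _ _
    simpa using h4
  · change Fin 2 at k
    fin_cases k
    · exact (h3 i).1
    · exact (h3 i).2

/-- Integrating out `x_j` by completing the square leaves the exponential of a quadratic polynomial
in `x_i`. -/
lemma gaussian_marginal {α : H.Factor} (hα : α.1.card = 2) (i : {i : V // i ∈ α.1})
    {θ : (gaussian H).FactorIndex α → ℝ}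
    (hθ : θ ∈ ExpFam.paramSpace ((gaussian H).νF α) ((gaussian H).φFull α)) :
    ∃ θ' ∈ ExpFam.paramSpace ((gaussian H).ν i) ((gaussian H).φ i),
      (ExpFam.law ((gaussian H).νF α) ((gaussian H).φFull α) θ).map (fun x => x i) =
        ExpFam.law ((gaussian H).ν i) ((gaussian H).φ i) θ' := by
  classical
  have hcard : Fintype.card {i : V // i ∈ α.1} = 2 := by simpa using hα
  obtain ⟨j, hji⟩ := Fintype.exists_ne_of_one_lt_card (by omega) i
  have huniv : (Finset.univ : Finset {i : V // i ∈ α.1}) = {i, j} :=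
    (Finset.eq_of_subset_of_card_le (Finset.subset_univ _) (by
      rw [Finset.card_univ, hcard, Finset.card_pair hji.symm])).symm
  set a := θ (Sum.inl (0 : Fin 1))
  set b := θ (Sum.inr ⟨i, (0 : Fin 2)⟩)
  set c := θ (Sum.inr ⟨i, (1 : Fin 2)⟩)
  set d := θ (Sum.inr ⟨j, (0 : Fin 2)⟩)
  set e := θ (Sum.inr ⟨j, (1 : Fin 2)⟩)
  set ψ := ExpFam.logPartition ((gaussian H).νF α) ((gaussian H).φFull α) θ
  have hdot : ∀ x : {i : V // i ∈ α.1} → ℝ, θ ⬝ᵥ (gaussian H).φFull α x =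
      (b * x i + c * x i ^ 2) + ((a * x i + d) * x j + e * x j ^ 2) := by
    intro x
    rw [gaussian_dotProduct_full, huniv, Finset.prod_pair hji.symm, Finset.sum_pair hji.symm]
    ring
  have hmap := map_pair_pi_volume hji.symm huniv
  have hmeas : Measurable fun x : {i : V // i ∈ α.1} → ℝ => (x i, x j) := by fun_prop
  -- By Fubini some slice `x_i = u` is integrable in `x_j`, and its quadratic coefficient is `e`.
  have he : e < 0 := by
    have h1 : Integrable (fun p : ℝ × ℝ => Real.exp ((b * p.1 + c * p.1 ^ 2) +
        ((a * p.1 + d) * p.2 + e * p.2 ^ 2))) ((volume : Measure ℝ).prod volume) := by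
      rw [← hmap, integrable_map_measure (by fun_prop) hmeas.aemeasurable]
      exact (ExpFam.integrable_exp_of_mem hθ).congr
        (Eventually.of_forall fun x => congrArg Real.exp (hdot x))
    obtain ⟨u, hu⟩ := h1.prod_right_ae.exists
    simp only [Real.exp_add (b * u + c * u ^ 2)] at hu
    rw [integrable_const_mul_iff (Real.exp_pos _).ne'.isUnit] at hu
    exact integrable_exp_quadratic_iff.1 hu
  -- The coefficients of `x_i` and `x_i²` in `b x_i + c x_i² - (a x_i + d)² / (4 e)`.
  let θ' : Fin ((gaussian H).r i) → ℝ := (![b - a * d / (2 * e), c - a ^ 2 / (4 * e)] : Fin 2 → ℝ)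
  let K : ENNReal := ENNReal.ofReal (Real.exp (-(d ^ 2 / (4 * e)) - ψ)) *
    ∫⁻ u : ℝ, ENNReal.ofReal (Real.exp (e * u ^ 2))
  have hprob := ExpFam.isProbabilityMeasure_law (ExpFam.integrable_exp_of_mem hθ)
  have hprob' : IsProbabilityMeasure ((ExpFam.law ((gaussian H).νF α)
      ((gaussian H).φFull α) θ).map (fun x => x i)) :=
    Measure.isProbabilityMeasure_map ((gaussian H).measurable_eval α i).aemeasurable
  have hP : (ExpFam.law ((gaussian H).νF α) ((gaussian H).φFull α) θ).map (fun x => x i) =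
      ((gaussian H).ν i).withDensity fun u =>
        K * ENNReal.ofReal (Real.exp (θ' ⬝ᵥ (gaussian H).φ i u)) := by
    have h1 := map_eval_withDensity_exp_quadratic hji.symm huniv a b c d ψ he
    have h2 : ExpFam.law ((gaussian H).νF α) ((gaussian H).φFull α) θ =
        (Measure.pi fun _ : {i : V // i ∈ α.1} => (volume : Measure ℝ)).withDensity fun x =>
          ENNReal.ofReal (Real.exp ((b * x i + c * x i ^ 2) +
            ((a * x i + d) * x j + e * x j ^ 2) - ψ)) := by
      refine congrArg (Measure.withDensity _) (funext fun x => ?_)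
      exact congrArg (fun y => ENNReal.ofReal (Real.exp (y - ψ))) (hdot x)
    rw [h2]
    refine h1.trans (congrArg (Measure.withDensity _) (funext fun u => ?_))
    exact congrArg (fun y => K * ENNReal.ofReal (Real.exp y)) (gaussian_dotProduct i.1 θ' u).symm
  obtain ⟨hint, hlaw⟩ := ExpFam.eq_law_of_withDensity ((gaussian H).measurable_φ i) hP
  -- The marginal is a probability measure, so its exponential is integrable; this already forces
  -- the quadratic coefficient to be negative.
  refine ⟨θ', gaussian_mem_paramSpace ?_, hlaw⟩
  refine (integrable_exp_quadratic_iff (b := θ' (0 : Fin 2))).1 ?_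
  refine Integrable.congr hint (Eventually.of_forall fun u => ?_)
  simp only [gaussian_dotProduct]

/-- The Gaussian family on a graph is an inference family. -/
theorem gaussian_isInferenceFamily [DecidableEq V] (hH : H.IsGraph) :
    (gaussian H).IsInferenceFamily where
  isUnit_cov i _ hθ := ExpFam.isUnit_cov_of_ae_const ((gaussian H).measurable_φ i)
    (gaussian_node_eq_zero i) hθ
  isUnit_covF α _ hθ := ExpFam.isUnit_cov_of_ae_const ((gaussian H).measurable_φFull α)
    (gaussian_factor_eq_zero (hH _ α.2)) hθ
  marginal α i _ hθ := gaussian_marginal (hH _ α.2) i hθ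

end StatFamily

/-! ### The main theorem. -/

theorem theorem9 {V : Type u} [Fintype V] [DecidableEq V] (H : FactorGraph V) :
    (∀ I : StatFamily.{u, v} H, I.IsInferenceFamily →
      ∀ (θbar : I.Model) (μ : I.Msg), I.IsFixedPoint θbar μ →
        (DifferentiableAt ℝ (I.lbpUpdate θbar) μ ∧
          jacobian (I.lbpUpdate θbar) μ = I.edgeMatrix (I.edgeWeight θbar μ)) ∧
        ((∀ z ∈ complexSpectrum (jacobian (I.lbpUpdate θbar) μ), ‖z‖ ≠ 1) →
          ((∀ z ∈ complexSpectrum (jacobian (I.lbpUpdate θbar) μ), ‖z‖ < 1) ↔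
            IsLocallyStable (I.lbpUpdate θbar) μ) ∧
          ((∀ z ∈ complexSpectrum (jacobian (I.lbpUpdate θbar) μ), z.re < 1) ↔
            ∃ ε : ℝ, 0 ≤ ε ∧ ε < 1 ∧ IsLocallyStable (I.dampedUpdate θbar ε) μ) ∧
          ((∀ z ∈ complexSpectrum (jacobian (I.lbpUpdate θbar) μ),
              ¬ ∃ t : ℝ, 1 ≤ t ∧ z = (t : ℂ)) →
            I.IsBetheLocalMin θbar μ) ∧
          (IsLocallyStable (I.lbpUpdate θbar) μ → I.IsBetheLocalMin θbar μ))) ∧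
    (∀ I : StatFamily.{u, v} H, I.IsMultinomial → I.IsInferenceFamily) ∧
    (H.IsGraph → (StatFamily.gaussian H).IsInferenceFamily) := by
  refine ⟨fun I hI θbar μ hμ => ?_, fun I h => h.isInferenceFamily,
    StatFamily.gaussian_isInferenceFamily⟩
  have hJ := hμ.jacobian_lbpUpdate hI
  refine ⟨⟨(hμ.hasFDerivAt_lbpUpdate hI).differentiableAt, hJ⟩, ?_⟩
  rw [hJ]
  intro hne
  refine ⟨hμ.isLocallyStable_iff hI hne, hμ.exists_damping_iff hI hne, hμ.isBetheLocalMin hI,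
    fun hs => hμ.isBetheLocalMin hI ?_⟩
  rintro z hz ⟨t, ht, rfl⟩
  have := (hμ.isLocallyStable_iff hI hne).2 hs _ hz
  rw [Complex.norm_real, Real.norm_eq_abs, abs_of_nonneg (by linarith)] at this
  linarith
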